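/- **Setting.** Let $\alpha:R\to A$ and $\beta:S\to B$ be maps of unital associative rings; $A$-modules are $R$-modules via $\alpha$ and $B$-modules are $S$-modules via $\beta$. Let $T$ be a $B$-$A$ bimodule with a formal dual $\widehat T$: an $A$-$B$ bimodule with an $A$-bimodule map $\mathrm{ev}:\widehat T\otimes_S T\to A$ and a $B$-bimodule map $\widehat{\mathrm{ev}}:T\otimes_R\widehat T\to B$ such that $\widehat{\mathrm{ev}}(x\otimes\widehat x)\,y=x\,\mathrm{ev}(\widehat x\otimes y)$ and $\mathrm{ev}(\widehat x\otimes x)\,\widehat y=\widehat x\,\widehat{\mathrm{ev}}(x\otimes\widehat y)$ for all $x,y\in T$, $\widehat x,\widehat y\in\widehat T$. Let $(T,\gamma)$ be a tame $B$-$A$ herd. This means that $\gamma:T\to T\otimes_R\widehat T\otimes_S T$ is an $S$-$R$ bimodule map with $$(\widehat{\mathrm{ev}}\otimes_S T)\gamma(x)=1_B\otimes_S x,\qquad (T\otimes_R\mathrm{ev})\gamma(x)=x\otimes_R 1_A,\qquad (\gamma\otimes_R\widehat T\otimes_S T)\gamma=(T\otimes_R\widehat T\otimes_S\gamma)\gamma,$$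 that $\mathrm{ev}$ and $\widehat{\mathrm{ev}}$ are surjective, and that $T$ is faithfully flat as a right $R$-module and as a left $S$-module. Put $$\xi_C=(\mathrm{ev}\otimes_R\widehat T\otimes_S T)(\widehat T\otimes_S\gamma),\quad C=\{c\in\widehat T\otimes_S T:\ \xi_C(c)=1_A\otimes_R c\},$$ $$\xi_D=(T\otimes_R\widehat T\otimes_S\widehat{\mathrm{ev}})(\gamma\otimes_R\widehat T),\quad D=\{d\in T\otimes_R\widehat T:\ \xi_D(d)=d\otimes_S 1_B\},$$ an $R$-bimodule and an $S$-bimodule. **Associated structures.** $C$ is an $R$-coring with $\Delta_C=\widehat T\otimes_S\gamma|_C$ and $\alpha\circ\varepsilon_C=\mathrm{ev}|_C$, and it is entwined with $A$ by $\psi:C\otimes_RA\to A\otimes_RC$, $\psi(c\otimes a)=\xi_C(ca)$. $D$ is an $S$-coring with $\Delta_D=\gamma\otimes_R\widehat T|_D$ and $\beta\circ\varepsilon_D=\widehat{\mathrm{ev}}|_D$, and $B$ is entwined with it by $\varphi:B\otimes_SD\to D\otimes_SB$, $\varphi(b\otimes d)=\xi_D(bd)$. With the coaction $\gamma$, corestricted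 to $T\otimes_RC$ and to $D\otimes_ST$ respectively, $T$ is a right entwined module over $(A,C,\psi)$ and a left entwined module over $(B,D,\varphi)$. With the coactions $(C\otimes\psi)(\Delta_C\otimes A)$ and $(\varphi\otimes D)(B\otimes\Delta_D)$, $C\otimes_RA$ is a right and $B\otimes_SD$ is a left entwined module. Let $\mathcal C=A\otimes_RC$ and $\mathcal D=D\otimes_SB$ be the associated $A$-coring and $B$-coring, whose right, respectively left, comodules are the entwined modules. **Theorem.** The canonical maps from $C\otimes_R\widehat T$ and $\widehat T\otimes_SD$ to $\widehat T\otimes_ST\otimes_R\widehat T$ are injective. For the $R$-$S$ bimodule $\overline T=(C\otimes_R\widehat T)\cap(\widehat T\otimes_SD)\subseteq\widehat T\otimes_ST\otimes_R\widehat T$: 1. $h_1:\overline T\to\mathrm{Hom}^{\mathcal C}(T,C\otimes_RA)$, $h_1(\bar x)(y)=(\widehat T\otimes_ST\otimes_R\mathrm{ev})(\bar x\otimes_Sy)$, is an isomorphism of $R$-$S$ bimodules, where $(r f s)(y)=r\,f(sy)$. 2. $h_2:\overline T\to{}^{\mathcal D}\mathrm{Hom}(T,B\otimes_SD)$, $h_2(\bar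 x)(y)=(\widehat{\mathrm{ev}}\otimes_ST\otimes_R\widehat T)(y\otimes_R\bar x)$, is an isomorphism of $R$-$S$ bimodules, where $(r f s)(y)=f(yr)\,s$. 3. $\mathrm{ev}\otimes_A\widehat T:\widehat x\otimes x\otimes\widehat y\mapsto\mathrm{ev}(\widehat x\otimes x)\widehat y$ and $\widehat T\otimes_B\widehat{\mathrm{ev}}:\widehat x\otimes x\otimes\widehat y\mapsto\widehat x\,\widehat{\mathrm{ev}}(x\otimes\widehat y)$ agree on $\overline T$, and their common restriction $h:\overline T\to\widehat T$ is an $R$-$S$ bimodule map. 4. $\overline T$ is a $C$-$D$ bicomodule, with left coaction $\overline T\to C\otimes_R\overline T$ and right coaction $\overline T\to\overline T\otimes_SD$ both given by the restriction of $\widehat T\otimes_S\gamma\otimes_R\widehat T$. -/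

import Mathlib

open MulOpposite
open scoped TensorProduct

universe u

noncomputable section

namespace BimoduleHerds

/-! ### Tensor products over a noncommutative ring

A right `R`-module is a module over `Rᵐᵒᵖ`.  The product `M ⊗_R N` of a right module `M` and a left
module `N` is the quotient of `M ⊗_ℤ N` by the relations `(m r) ⊗ n = m ⊗ (r n)`. -/

section Tensor

/-- The subgroup of `M ⊗_ℤ N` generated by all `(m r) ⊗ n - m ⊗ (r n)`. -/
def balancing (R M N : Type*) [Ring R] [AddCommGroup M] [Module Rᵐᵒᵖ M] [AddCommGroup N]
    [Module R N] : AddSubgroup (M ⊗[ℤ] N) :=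
  AddSubgroup.closure
    {t | ∃ (m : M) (r : R) (n : N), t = (op r • m) ⊗ₜ[ℤ] n - m ⊗ₜ[ℤ] (r • n)}

/-- The tensor product `M ⊗_R N`. -/
def BTensor (R M N : Type*) [Ring R] [AddCommGroup M] [Module Rᵐᵒᵖ M] [AddCommGroup N]
    [Module R N] : Type _ :=
  (M ⊗[ℤ] N) ⧸ balancing R M N

namespace BTensor

variable {R S K L : Type*} [Ring R] [Ring S] [Ring K] [Ring L]
variable {M M' N N' P Q : Type*} [AddCommGroup M] [AddCommGroup M'] [AddCommGroup N]
  [AddCommGroup N'] [AddCommGroup P] [AddCommGroup Q]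

section Basic

variable [Module Rᵐᵒᵖ M] [Module Rᵐᵒᵖ M'] [Module R N] [Module R N']

instance : AddCommGroup (BTensor R M N) :=
  inferInstanceAs (AddCommGroup ((M ⊗[ℤ] N) ⧸ balancing R M N))

variable (R) in
/-- The simple tensor `m ⊗ n`. -/
def tmul (m : M) (n : N) : BTensor R M N :=
  QuotientAddGroup.mk' (balancing R M N) (m ⊗ₜ[ℤ] n)

theorem add_tmul (m m' : M) (n : N) : tmul R (m + m') n = tmul R m n + tmul R m' n := by
  simp only [tmul, TensorProduct.add_tmul]; exact map_add _ _ _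

theorem tmul_add (m : M) (n n' : N) : tmul R m (n + n') = tmul R m n + tmul R m n' := by
  simp only [tmul, TensorProduct.tmul_add]; exact map_add _ _ _

@[simp] theorem zero_tmul (n : N) : tmul R (0 : M) n = 0 := by
  simp only [tmul, TensorProduct.zero_tmul]; exact map_zero _

@[simp] theorem tmul_zero (m : M) : tmul R m (0 : N) = 0 := by
  simp only [tmul, TensorProduct.tmul_zero]; exact map_zero _

theorem smul_tmul (m : M) (r : R) (n : N) : tmul R (op r • m) n = tmul R m (r • n) := by
  refine (QuotientAddGroup.eq_iff_sub_mem).2 ?_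
  exact AddSubgroup.subset_closure ⟨m, r, n, rfl⟩

theorem induction_on {p : BTensor R M N → Prop} (t : BTensor R M N)
    (zero : p 0) (simple : ∀ m n, p (tmul R m n)) (add : ∀ a b, p a → p b → p (a + b)) : p t := by
  obtain ⟨t, rfl⟩ := QuotientAddGroup.mk'_surjective (balancing R M N) t
  induction t using TensorProduct.induction_on with
  | zero => rw [map_zero]; exact zero
  | tmul m n => exact simple m n
  | add a b ha hb => rw [map_add]; exact add _ _ ha hb

/-- The additive map out of `M ⊗_R N` given by a balanced biadditive map. -/
def lift (f : M →+ N →+ P) (hf : ∀ m (r : R) n, f (op r • m) n = f m (r • n)) :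
    BTensor R M N →+ P :=
  QuotientAddGroup.lift (balancing R M N)
    (TensorProduct.liftAddHom f (fun z m n => by simp)) (by
      rw [balancing, AddSubgroup.closure_le]
      rintro _ ⟨m, r, n, rfl⟩
      simp [hf])

@[simp] theorem lift_tmul (f : M →+ N →+ P) (hf : ∀ m (r : R) n, f (op r • m) n = f m (r • n))
    (m : M) (n : N) : lift f hf (tmul R m n) = f m n := by
  change TensorProduct.liftAddHom (R := ℤ) f (fun z m n => by simp) (m ⊗ₜ[ℤ] n) = _
  simp

theorem hom_ext {f g : BTensor R M N →+ P} (h : ∀ m n, f (tmul R m n) = g (tmul R m n)) :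
    f = g := by
  ext t
  induction t using induction_on with
  | zero => simp
  | simple m n => exact h m n
  | add a b ha hb => rw [map_add, map_add, ha, hb]

variable (R M N) in
/-- The biadditive map `(m, n) ↦ m ⊗ n`. -/
def mk : M →+ N →+ BTensor R M N :=
  AddMonoidHom.mk' (fun m => AddMonoidHom.mk' (fun n => tmul R m n) (tmul_add m))
    (fun m m' => by ext n; exact add_tmul m m' n)

@[simp] theorem mk_apply (m : M) (n : N) : mk R M N m n = tmul R m n := rfl

/-- `f ⊗_R g`, for a right `R`-linear `f` and a left `R`-linear `g`. -/
def map (f : M →ₗ[Rᵐᵒᵖ] M') (g : N →ₗ[R] N') : BTensor R M N →+ BTensor R M' N' :=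
  lift (((mk R M' N').comp f.toAddMonoidHom).compr₂ (AddMonoidHom.id _) |>.compl₂
    g.toAddMonoidHom) (fun m r n => by simp [smul_tmul])

@[simp] theorem map_tmul (f : M →ₗ[Rᵐᵒᵖ] M') (g : N →ₗ[R] N') (m : M) (n : N) :
    map f g (tmul R m n) = tmul R (f m) (g n) := by
  simp [map]

end Basic

section Left

variable [Module Rᵐᵒᵖ M] [Module R N] [Module K M] [SMulCommClass K Rᵐᵒᵖ M]

/-- If `M` is a `K`-`R` bimodule, then `M ⊗_R N` is a left `K`-module. -/
instance leftModule : Module K (BTensor R M N) where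
  smul k t := map ({ toFun := fun m => k • m
                     map_add' := smul_add k
                     map_smul' := fun r m => smul_comm k r m } : M →ₗ[Rᵐᵒᵖ] M) LinearMap.id t
  one_smul t := by
    induction t using induction_on with
    | zero => exact map_zero _
    | simple m n => refine (map_tmul _ _ m n).trans ?_; simp
    | add a b ha hb => refine (map_add _ a b).trans ?_; exact congrArg₂ _ ha hb
  mul_smul k l t := by
    induction t using induction_on with
    | zero => exact (map_zero _).trans ((congrArg _ (map_zero _)).trans (map_zero _)).symm
    | simple m n =>
      refine (map_tmul _ _ m n).trans ?_
      refine Eq.trans ?_ (congrArg _ (map_tmul _ _ m n)).symm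
      refine Eq.trans ?_ (map_tmul _ _ _ n).symm
      simp [mul_smul]
    | add a b ha hb =>
      refine (map_add _ a b).trans ?_
      refine Eq.trans (congrArg₂ _ ha hb) ?_
      refine Eq.trans ?_ (congrArg _ (map_add _ a b)).symm
      exact (map_add _ _ _).symm
  smul_zero k := map_zero _
  smul_add k a b := map_add _ a b
  add_smul k l t := by
    induction t using induction_on with
    | zero =>
      exact (map_zero _).trans ((congrArg₂ _ (map_zero _) (map_zero _)).trans (add_zero _)).symm
    | simple m n =>
      refine (map_tmul _ _ m n).trans ?_
      refine Eq.trans ?_ (congrArg₂ _ (map_tmul _ _ m n) (map_tmul _ _ m n)).symm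
      simp [add_smul, add_tmul]
    | add a b ha hb =>
      refine (map_add _ a b).trans ?_
      refine Eq.trans (congrArg₂ _ ha hb) ?_
      refine Eq.trans ?_ (congrArg₂ _ (map_add _ a b) (map_add _ a b)).symm
      exact add_add_add_comm _ _ _ _
  zero_smul t := by
    induction t using induction_on with
    | zero => exact map_zero _
    | simple m n =>
      refine (map_tmul _ _ m n).trans ?_
      simp
    | add a b ha hb =>
      refine (map_add _ a b).trans ?_
      exact (congrArg₂ _ ha hb).trans (add_zero _)

@[simp] theorem smul_tmul' (k : K) (m : M) (n : N) :
    k • tmul R m n = tmul R (k • m) n := map_tmul _ _ m n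

end Left

section Right

variable [Module Rᵐᵒᵖ M] [Module R N] [Module Lᵐᵒᵖ N] [SMulCommClass R Lᵐᵒᵖ N]

/-- If `N` is an `R`-`L` bimodule, then `M ⊗_R N` is a right `L`-module. -/
instance rightModule : Module Lᵐᵒᵖ (BTensor R M N) where
  smul l t := map LinearMap.id ({ toFun := fun n => l • n
                                  map_add' := smul_add l
                                  map_smul' := fun r n => (smul_comm r l n).symm } :
                                N →ₗ[R] N) t
  one_smul t := by
    induction t using induction_on with
    | zero => exact map_zero _
    | simple m n => refine (map_tmul _ _ m n).trans ?_; simp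
    | add a b ha hb => refine (map_add _ a b).trans ?_; exact congrArg₂ _ ha hb
  mul_smul k l t := by
    induction t using induction_on with
    | zero => exact (map_zero _).trans ((congrArg _ (map_zero _)).trans (map_zero _)).symm
    | simple m n =>
      refine (map_tmul _ _ m n).trans ?_
      refine Eq.trans ?_ (congrArg _ (map_tmul _ _ m n)).symm
      refine Eq.trans ?_ (map_tmul _ _ m _).symm
      simp [mul_smul]
    | add a b ha hb =>
      refine (map_add _ a b).trans ?_
      refine Eq.trans (congrArg₂ _ ha hb) ?_
      refine Eq.trans ?_ (congrArg _ (map_add _ a b)).symm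
      exact (map_add _ _ _).symm
  smul_zero k := map_zero _
  smul_add k a b := map_add _ a b
  add_smul k l t := by
    induction t using induction_on with
    | zero =>
      exact (map_zero _).trans ((congrArg₂ _ (map_zero _) (map_zero _)).trans (add_zero _)).symm
    | simple m n =>
      refine (map_tmul _ _ m n).trans ?_
      refine Eq.trans ?_ (congrArg₂ _ (map_tmul _ _ m n) (map_tmul _ _ m n)).symm
      simp [add_smul, tmul_add]
    | add a b ha hb =>
      refine (map_add _ a b).trans ?_
      refine Eq.trans (congrArg₂ _ ha hb) ?_
      refine Eq.trans ?_ (congrArg₂ _ (map_add _ a b) (map_add _ a b)).symm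
      exact add_add_add_comm _ _ _ _
  zero_smul t := by
    induction t using induction_on with
    | zero => exact map_zero _
    | simple m n =>
      refine (map_tmul _ _ m n).trans ?_
      simp
    | add a b ha hb =>
      refine (map_add _ a b).trans ?_
      exact (congrArg₂ _ ha hb).trans (add_zero _)

@[simp] theorem op_smul_tmul (l : Lᵐᵒᵖ) (m : M) (n : N) :
    l • tmul R m n = tmul R m (l • n) := map_tmul _ _ m n

end Right

instance [Module Rᵐᵒᵖ M] [Module R N] [Module K M] [SMulCommClass K Rᵐᵒᵖ M] [Module Lᵐᵒᵖ N]
    [SMulCommClass R Lᵐᵒᵖ N] : SMulCommClass K Lᵐᵒᵖ (BTensor R M N) where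
  smul_comm k l t := by
    induction t using induction_on with
    | zero => simp
    | simple m n => simp
    | add a b ha hb => rw [smul_add, smul_add, smul_add, smul_add, ha, hb]

section Assoc

variable [Module Rᵐᵒᵖ M] [Module R N] [Module Sᵐᵒᵖ N] [SMulCommClass R Sᵐᵒᵖ N] [Module S P]

/-- For fixed `p`, the map `t ↦ (M ⊗_R (- ⊗ p)) t`. -/
def assocFwdAux (p : P) : BTensor R M N →+ BTensor R M (BTensor S N P) :=
  lift (AddMonoidHom.mk' (fun m => (mk R M (BTensor S N P) m).comp ((mk S N P).flip p))
    (fun m m' => by ext n; exact add_tmul m m' _))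
    (fun m r n => by
      change tmul R (op r • m) (tmul S n p) = tmul R m (tmul S (r • n) p)
      rw [smul_tmul, smul_tmul'])

theorem assocFwdAux_tmul (p : P) (m : M) (n : N) :
    assocFwdAux (R := R) (S := S) p (tmul R m n) = tmul R m (tmul S n p) :=
  lift_tmul _ _ _ _

variable (R S M N P) in
/-- The canonical map `(M ⊗_R N) ⊗_S P → M ⊗_R (N ⊗_S P)`. -/
def assocFwd : BTensor S (BTensor R M N) P →+ BTensor R M (BTensor S N P) :=
  lift (AddMonoidHom.flip (AddMonoidHom.mk' (fun p : P => assocFwdAux (R := R) (S := S) p)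
    (fun p p' => hom_ext fun m n => by
      rw [AddMonoidHom.add_apply, assocFwdAux_tmul, assocFwdAux_tmul, assocFwdAux_tmul,
        tmul_add, tmul_add])))
    (fun t s p => by
      change assocFwdAux p (op s • t) = assocFwdAux (s • p) t
      induction t using induction_on with
      | zero => rw [smul_zero, map_zero, map_zero]
      | simple m n => rw [op_smul_tmul, assocFwdAux_tmul, assocFwdAux_tmul, smul_tmul]
      | add a b ha hb => rw [smul_add, map_add, map_add, ha, hb])

theorem assocFwd_tmul (m : M) (n : N) (p : P) :
    assocFwd R S M N P (tmul S (tmul R m n) p) = tmul R m (tmul S n p) :=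
  (lift_tmul _ _ _ _).trans (assocFwdAux_tmul p m n)

/-- For fixed `m`, the map `t ↦ ((m ⊗ -) ⊗_S P) t`. -/
def assocInvAux (m : M) : BTensor S N P →+ BTensor S (BTensor R M N) P :=
  lift ((mk S (BTensor R M N) P).comp (mk R M N m))
    (fun n s p => by
      change tmul S (tmul R m (op s • n)) p = tmul S (tmul R m n) (s • p)
      rw [← smul_tmul, op_smul_tmul])

theorem assocInvAux_tmul (m : M) (n : N) (p : P) :
    assocInvAux (R := R) (S := S) m (tmul S n p) = tmul S (tmul R m n) p :=
  lift_tmul _ _ _ _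

variable (R S M N P) in
/-- The canonical map `M ⊗_R (N ⊗_S P) → (M ⊗_R N) ⊗_S P`. -/
def assocInv : BTensor R M (BTensor S N P) →+ BTensor S (BTensor R M N) P :=
  lift (AddMonoidHom.mk' (fun m : M => assocInvAux (R := R) (S := S) m)
    (fun m m' => hom_ext fun n p => by
      rw [AddMonoidHom.add_apply, assocInvAux_tmul, assocInvAux_tmul, assocInvAux_tmul,
        add_tmul, add_tmul]))
    (fun m r t => by
      change assocInvAux (op r • m) t = assocInvAux m (r • t)
      induction t using induction_on with
      | zero => rw [smul_zero, map_zero, map_zero]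
      | simple n p => rw [smul_tmul', assocInvAux_tmul, assocInvAux_tmul, smul_tmul]
      | add a b ha hb => rw [smul_add, map_add, map_add, ha, hb])

theorem assocInv_tmul (m : M) (n : N) (p : P) :
    assocInv R S M N P (tmul R m (tmul S n p)) = tmul S (tmul R m n) p :=
  (lift_tmul _ _ _ _).trans (assocInvAux_tmul m n p)

variable (R S M N P) in
/-- The canonical isomorphism `(M ⊗_R N) ⊗_S P ≅ M ⊗_R (N ⊗_S P)`. -/
def assoc : BTensor S (BTensor R M N) P ≃+ BTensor R M (BTensor S N P) :=
  AddMonoidHom.toAddEquiv (assocFwd R S M N P) (assocInv R S M N P)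
    (hom_ext fun t p => by
      change assocInv R S M N P (assocFwd R S M N P (tmul S t p)) = tmul S t p
      induction t using induction_on with
      | zero => rw [zero_tmul, map_zero, map_zero]
      | simple m n => rw [assocFwd_tmul, assocInv_tmul]
      | add a b ha hb => rw [add_tmul, map_add, map_add, ha, hb])
    (hom_ext fun m t => by
      change assocFwd R S M N P (assocInv R S M N P (tmul R m t)) = tmul R m t
      induction t using induction_on with
      | zero => rw [tmul_zero, map_zero, map_zero]
      | simple n p => rw [assocInv_tmul, assocFwd_tmul]
      | add a b ha hb => rw [tmul_add, map_add, map_add, ha, hb])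

@[simp] theorem assoc_tmul (m : M) (n : N) (p : P) :
    assoc R S M N P (tmul S (tmul R m n) p) = tmul R m (tmul S n p) :=
  assocFwd_tmul m n p

@[simp] theorem assoc_symm_tmul (m : M) (n : N) (p : P) :
    (assoc R S M N P).symm (tmul R m (tmul S n p)) = tmul S (tmul R m n) p := by
  rw [AddEquiv.symm_apply_eq, assoc_tmul]

end Assoc

end BTensor

end Tensor

/-! ### Faithful flatness over noncommutative rings -/

/-- A right `R`-module `M` is faithfully flat: a sequence of left `R`-modules is exact if and only
if it is exact after applying `M ⊗_R -`. -/
def RightFaithfullyFlat (R M : Type u) [Ring R] [AddCommGroup M] [Module Rᵐᵒᵖ M] : Prop :=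
  ∀ (X Y Z : Type u) [AddCommGroup X] [AddCommGroup Y] [AddCommGroup Z]
    [Module R X] [Module R Y] [Module R Z] (f : X →ₗ[R] Y) (g : Y →ₗ[R] Z),
    Function.Exact f g ↔
      Function.Exact (BTensor.map (LinearMap.id : M →ₗ[Rᵐᵒᵖ] M) f)
        (BTensor.map (LinearMap.id : M →ₗ[Rᵐᵒᵖ] M) g)

/-- A left `S`-module `M` is faithfully flat: a sequence of right `S`-modules is exact if and only
if it is exact after applying `- ⊗_S M`. -/
def LeftFaithfullyFlat (S M : Type u) [Ring S] [AddCommGroup M] [Module S M] : Prop :=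
  ∀ (X Y Z : Type u) [AddCommGroup X] [AddCommGroup Y] [AddCommGroup Z]
    [Module Sᵐᵒᵖ X] [Module Sᵐᵒᵖ Y] [Module Sᵐᵒᵖ Z] (f : X →ₗ[Sᵐᵒᵖ] Y) (g : Y →ₗ[Sᵐᵒᵖ] Z),
    Function.Exact f g ↔
      Function.Exact (BTensor.map f (LinearMap.id : M →ₗ[S] M))
        (BTensor.map g (LinearMap.id : M →ₗ[S] M))

/-! ### Bimodule maps and sub-bimodules -/

/-- A map of `K`-`L` bimodules. -/
structure BHom (K L M N : Type*) [Ring K] [Ring L] [AddCommGroup M] [AddCommGroup N]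
    [Module K M] [Module Lᵐᵒᵖ M] [Module K N] [Module Lᵐᵒᵖ N] extends M →+ N where
  map_smul' : ∀ (k : K) (m : M), toFun (k • m) = k • toFun m
  map_op_smul' : ∀ (l : L) (m : M), toFun (op l • m) = op l • toFun m

namespace BHom

variable {K L R S M N P M' N' : Type*} [Ring K] [Ring L] [Ring R] [Ring S]
  [AddCommGroup M] [AddCommGroup N] [AddCommGroup P] [AddCommGroup M'] [AddCommGroup N']

section

variable [Module K M] [Module Lᵐᵒᵖ M] [Module K N] [Module Lᵐᵒᵖ N] [Module K P] [Module Lᵐᵒᵖ P]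

instance : FunLike (BHom K L M N) M N where
  coe f := f.toAddMonoidHom
  coe_injective f g h := by
    obtain ⟨f, _, _⟩ := f
    obtain ⟨g, _, _⟩ := g
    congr
    exact DFunLike.coe_injective h

instance : AddMonoidHomClass (BHom K L M N) M N where
  map_add f := f.toAddMonoidHom.map_add
  map_zero f := f.toAddMonoidHom.map_zero

/-- A bimodule map as a left linear map. -/
def l (f : BHom K L M N) : M →ₗ[K] N where
  toFun := f
  map_add' := map_add f
  map_smul' := f.map_smul'

/-- A bimodule map as a right linear map. -/
def r (f : BHom K L M N) : M →ₗ[Lᵐᵒᵖ] N where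
  toFun := f
  map_add' := map_add f
  map_smul' c m := f.map_op_smul' c.unop m

@[simp] theorem l_apply (f : BHom K L M N) (m : M) : f.l m = f m := rfl

@[simp] theorem r_apply (f : BHom K L M N) (m : M) : f.r m = f m := rfl

theorem map_smul (f : BHom K L M N) (k : K) (m : M) : f (k • m) = k • f m := f.map_smul' k m

theorem map_op_smul (f : BHom K L M N) (c : L) (m : M) : f (op c • m) = op c • f m :=
  f.map_op_smul' c m

/-- The identity bimodule map. -/
def id (K L M : Type*) [Ring K] [Ring L] [AddCommGroup M] [Module K M] [Module Lᵐᵒᵖ M] :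
    BHom K L M M where
  toAddMonoidHom := AddMonoidHom.id M
  map_smul' _ _ := rfl
  map_op_smul' _ _ := rfl

/-- The composite of two bimodule maps. -/
def comp (g : BHom K L N P) (f : BHom K L M N) : BHom K L M P where
  toAddMonoidHom := g.toAddMonoidHom.comp f.toAddMonoidHom
  map_smul' k m := by
    change g (f (k • m)) = k • g (f m)
    rw [f.map_smul, g.map_smul]
  map_op_smul' c m := by
    change g (f (op c • m)) = op c • g (f m)
    rw [f.map_op_smul, g.map_op_smul]

@[simp] theorem id_apply (m : M) : BHom.id K L M m = m := rfl

@[simp] theorem comp_apply (g : BHom K L N P) (f : BHom K L M N) (m : M) :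
    g.comp f m = g (f m) := rfl

end

section Tensor

variable [Module K M] [Module Rᵐᵒᵖ M] [SMulCommClass K Rᵐᵒᵖ M]
  [Module K M'] [Module Rᵐᵒᵖ M'] [SMulCommClass K Rᵐᵒᵖ M']
  [Module R N] [Module Lᵐᵒᵖ N] [SMulCommClass R Lᵐᵒᵖ N]
  [Module R N'] [Module Lᵐᵒᵖ N'] [SMulCommClass R Lᵐᵒᵖ N']

/-- `f ⊗_R g` as a map of `K`-`L` bimodules. -/
def tmap (f : BHom K R M M') (g : BHom R L N N') :
    BHom K L (BTensor R M N) (BTensor R M' N') where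
  toAddMonoidHom := BTensor.map f.r g.l
  map_smul' k t := by
    change BTensor.map f.r g.l (k • t) = k • BTensor.map f.r g.l t
    induction t using BTensor.induction_on with
    | zero => simp
    | simple m n => simp [f.map_smul]
    | add a b ha hb => rw [smul_add, map_add, map_add, smul_add, ha, hb]
  map_op_smul' c t := by
    change BTensor.map f.r g.l (op c • t) = op c • BTensor.map f.r g.l t
    induction t using BTensor.induction_on with
    | zero => simp
    | simple m n => simp [g.map_op_smul]
    | add a b ha hb => rw [smul_add, map_add, map_add, smul_add, ha, hb]

@[simp] theorem tmap_tmul (f : BHom K R M M') (g : BHom R L N N') (m : M) (n : N) :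
    tmap f g (BTensor.tmul R m n) = BTensor.tmul R (f m) (g n) :=
  BTensor.map_tmul _ _ _ _

end Tensor

section Assoc

variable [Module K M] [Module Rᵐᵒᵖ M] [SMulCommClass K Rᵐᵒᵖ M]
  [Module R N] [Module Sᵐᵒᵖ N] [SMulCommClass R Sᵐᵒᵖ N]
  [Module S P] [Module Lᵐᵒᵖ P] [SMulCommClass S Lᵐᵒᵖ P]

variable (K L R S M N P) in
/-- The associativity isomorphism as a map of bimodules. -/
def assoc : BHom K L (BTensor S (BTensor R M N) P) (BTensor R M (BTensor S N P)) where
  toAddMonoidHom := (BTensor.assoc R S M N P).toAddMonoidHom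
  map_smul' k t := by
    change BTensor.assoc R S M N P (k • t) = k • BTensor.assoc R S M N P t
    induction t using BTensor.induction_on with
    | zero => simp
    | simple t p =>
      induction t using BTensor.induction_on with
      | zero => simp
      | simple m n => simp
      | add a b ha hb => rw [BTensor.add_tmul, smul_add, map_add, map_add, smul_add, ha, hb]
    | add a b ha hb => rw [smul_add, map_add, map_add, smul_add, ha, hb]
  map_op_smul' c t := by
    change BTensor.assoc R S M N P (op c • t) = op c • BTensor.assoc R S M N P t
    induction t using BTensor.induction_on with
    | zero => simp
    | simple t p =>
      induction t using BTensor.induction_on with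
      | zero => simp
      | simple m n => simp
      | add a b ha hb => rw [BTensor.add_tmul, smul_add, map_add, map_add, smul_add, ha, hb]
    | add a b ha hb => rw [smul_add, map_add, map_add, smul_add, ha, hb]

variable (K L R S M N P) in
/-- The inverse of the associativity isomorphism as a map of bimodules. -/
def assocSymm : BHom K L (BTensor R M (BTensor S N P)) (BTensor S (BTensor R M N) P) where
  toAddMonoidHom := (BTensor.assoc R S M N P).symm.toAddMonoidHom
  map_smul' k t := by
    change (BTensor.assoc R S M N P).symm (k • t) = k • (BTensor.assoc R S M N P).symm t
    obtain ⟨t, rfl⟩ := (BTensor.assoc R S M N P).surjective t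
    rw [AddEquiv.symm_apply_apply, AddEquiv.symm_apply_eq]
    exact ((assoc K L R S M N P).map_smul k t).symm
  map_op_smul' c t := by
    change (BTensor.assoc R S M N P).symm (op c • t) = op c • (BTensor.assoc R S M N P).symm t
    obtain ⟨t, rfl⟩ := (BTensor.assoc R S M N P).surjective t
    rw [AddEquiv.symm_apply_apply, AddEquiv.symm_apply_eq]
    exact ((assoc K L R S M N P).map_op_smul c t).symm

end Assoc

end BHom

/-- A sub-bimodule of a `K`-`L` bimodule. -/
structure SubBimodule (K L M : Type*) [Ring K] [Ring L] [AddCommGroup M] [Module K M]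
    [Module Lᵐᵒᵖ M] extends AddSubgroup M where
  smul_mem' : ∀ (k : K) {m : M}, m ∈ carrier → k • m ∈ carrier
  op_smul_mem' : ∀ (l : L) {m : M}, m ∈ carrier → op l • m ∈ carrier

namespace SubBimodule

variable {K L M N : Type*} [Ring K] [Ring L] [AddCommGroup M] [AddCommGroup N]
  [Module K M] [Module Lᵐᵒᵖ M] [Module K N] [Module Lᵐᵒᵖ N]

instance (X : SubBimodule K L M) : Module K X.toAddSubgroup where
  smul k m := ⟨k • (m : M), X.smul_mem' k m.2⟩
  one_smul m := Subtype.ext (one_smul K (m : M))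
  mul_smul k l m := Subtype.ext (mul_smul k l (m : M))
  smul_zero k := Subtype.ext (smul_zero k)
  smul_add k m n := Subtype.ext (smul_add k (m : M) (n : M))
  add_smul k l m := Subtype.ext (add_smul k l (m : M))
  zero_smul m := Subtype.ext (zero_smul K (m : M))

instance (X : SubBimodule K L M) : Module Lᵐᵒᵖ X.toAddSubgroup where
  smul k m := ⟨k • (m : M), X.op_smul_mem' k.unop m.2⟩
  one_smul m := Subtype.ext (one_smul Lᵐᵒᵖ (m : M))
  mul_smul k l m := Subtype.ext (mul_smul k l (m : M))
  smul_zero k := Subtype.ext (smul_zero k)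
  smul_add k m n := Subtype.ext (smul_add k (m : M) (n : M))
  add_smul k l m := Subtype.ext (add_smul k l (m : M))
  zero_smul m := Subtype.ext (zero_smul Lᵐᵒᵖ (m : M))

instance [SMulCommClass K Lᵐᵒᵖ M] (X : SubBimodule K L M) :
    SMulCommClass K Lᵐᵒᵖ X.toAddSubgroup where
  smul_comm k l m := Subtype.ext (smul_comm k l (m : M))

/-- The inclusion of a sub-bimodule. -/
def incl (X : SubBimodule K L M) : BHom K L X.toAddSubgroup M where
  toAddMonoidHom := X.toAddSubgroup.subtype
  map_smul' _ _ := rfl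
  map_op_smul' _ _ := rfl

/-- The equaliser of two bimodule maps. -/
def equaliser (f g : BHom K L M N) : SubBimodule K L M where
  carrier := {m | f m = g m}
  add_mem' := by
    intro a b (ha : f a = g a) (hb : f b = g b)
    change f (a + b) = g (a + b)
    rw [map_add, map_add, ha, hb]
  zero_mem' := (map_zero f).trans (map_zero g).symm
  neg_mem' := by
    intro a (ha : f a = g a)
    change f (-a) = g (-a)
    rw [map_neg, map_neg, ha]
  smul_mem' := by
    intro k a (ha : f a = g a)
    change f (k • a) = g (k • a)
    rw [f.map_smul, g.map_smul, ha]
  op_smul_mem' := by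
    intro k a (ha : f a = g a)
    change f (op k • a) = g (op k • a)
    rw [f.map_op_smul, g.map_op_smul, ha]

/-- The image of a bimodule map. -/
def range (f : BHom K L M N) : SubBimodule K L N where
  toAddSubgroup := f.toAddMonoidHom.range
  smul_mem' := by
    rintro k _ ⟨m, rfl⟩
    exact ⟨k • m, f.map_smul k m⟩
  op_smul_mem' := by
    rintro k _ ⟨m, rfl⟩
    exact ⟨op k • m, f.map_op_smul k m⟩

/-- The intersection of two sub-bimodules. -/
def inter (X Y : SubBimodule K L M) : SubBimodule K L M where
  toAddSubgroup := X.toAddSubgroup ⊓ Y.toAddSubgroup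
  smul_mem' := fun k _ h => ⟨X.smul_mem' k h.1, Y.smul_mem' k h.2⟩
  op_smul_mem' := fun k _ h => ⟨X.op_smul_mem' k h.1, Y.op_smul_mem' k h.2⟩

end SubBimodule

/-! ### Corings and comodules -/

/-- The structure of an `R`-coring on an `R`-bimodule `C`. -/
structure Coring (R C : Type*) [Ring R] [AddCommGroup C] [Module R C] [Module Rᵐᵒᵖ C]
    [SMulCommClass R Rᵐᵒᵖ C] where
  /-- the coproduct -/
  comul : BHom R R C (BTensor R C C)
  /-- the counit -/
  counit : BHom R R C R
  coassoc : ∀ c, BTensor.assoc R R C C C (comul.tmap (BHom.id R R C) (comul c)) =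
    (BHom.id R R C).tmap comul (comul c)
  counit_left : ∀ c, counit.tmap (BHom.id R R C) (comul c) = BTensor.tmul R 1 c
  counit_right : ∀ c, (BHom.id R R C).tmap counit (comul c) = BTensor.tmul R c 1

section Comodules

variable {R S C D M : Type*} [Ring R] [Ring S]
  [AddCommGroup C] [Module R C] [Module Rᵐᵒᵖ C] [SMulCommClass R Rᵐᵒᵖ C]
  [AddCommGroup D] [Module S D] [Module Sᵐᵒᵖ D] [SMulCommClass S Sᵐᵒᵖ D]
  [AddCommGroup M]

/-- `ρ` makes the right `R`-module `M` a right `C`-comodule. -/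
structure IsRightComodule [Module Rᵐᵒᵖ M] (cC : Coring R C)
    (ρ : M →ₗ[Rᵐᵒᵖ] BTensor R M C) : Prop where
  coassoc : ∀ m, BTensor.assoc R R M C C (BTensor.map ρ (LinearMap.id : C →ₗ[R] C) (ρ m)) =
    BTensor.map LinearMap.id cC.comul.l (ρ m)
  counit : ∀ m, BTensor.map LinearMap.id cC.counit.l (ρ m) = BTensor.tmul R m 1

/-- `ρ` makes the left `S`-module `M` a left `D`-comodule. -/
structure IsLeftComodule [Module S M] (cD : Coring S D)
    (ρ : M →ₗ[S] BTensor S D M) : Prop where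
  coassoc : ∀ m, (BTensor.assoc S S D D M).symm
      (BTensor.map (LinearMap.id : D →ₗ[Sᵐᵒᵖ] D) ρ (ρ m)) =
    BTensor.map cD.comul.r LinearMap.id (ρ m)
  counit : ∀ m, BTensor.map cD.counit.r LinearMap.id (ρ m) = BTensor.tmul S 1 m

/-- The `R`-`S` bimodule maps `ρC`, `ρD` make the `R`-`S` bimodule `M` a `C`-`D` bicomodule. -/
structure IsBicomodule [Module R M] [Module Sᵐᵒᵖ M] [SMulCommClass R Sᵐᵒᵖ M]
    (cC : Coring R C) (cD : Coring S D)
    (ρC : BHom R S M (BTensor R C M)) (ρD : BHom R S M (BTensor S M D)) : Prop where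
  left : IsLeftComodule cC ρC.l
  right : IsRightComodule cD ρD.r
  comm : ∀ m, BTensor.assoc R S C M D (BTensor.map ρC.r (LinearMap.id : D →ₗ[S] D) (ρD m)) =
    BTensor.map (LinearMap.id : C →ₗ[Rᵐᵒᵖ] C) ρD.l (ρC m)

end Comodules

/-! ### Ring maps and restriction of scalars -/

/-- A ring `A` equipped with a ring map `R → A`. -/
class RingMap (R A : Type*) [Ring R] [Ring A] where
  /-- the ring map -/
  hom : R →+* A

section RingMap

variable {R A M : Type*} [Ring R] [Ring A] [RingMap R A] [AddCommGroup M]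

instance : Module R A := Module.compHom A (RingMap.hom : R →+* A)

instance : Module Rᵐᵒᵖ A := Module.compHom A (RingHom.op (RingMap.hom : R →+* A))

theorem RingMap.smul_def (r : R) (a : A) : r • a = RingMap.hom r * a := rfl

theorem RingMap.op_smul_def (r : R) (a : A) : op r • a = a * RingMap.hom r := rfl

instance : SMulCommClass R Rᵐᵒᵖ A where
  smul_comm r s a := by
    induction s using MulOpposite.rec'
    simp only [RingMap.smul_def, RingMap.op_smul_def, mul_assoc]

instance : SMulCommClass A Rᵐᵒᵖ A where
  smul_comm r s a := by
    induction s using MulOpposite.rec'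
    simp only [RingMap.op_smul_def, smul_eq_mul, mul_assoc]

instance : SMulCommClass R Aᵐᵒᵖ A where
  smul_comm r s a := by
    induction s using MulOpposite.rec'
    simp only [RingMap.smul_def, _root_.op_smul_eq_mul, mul_assoc]

/-- The right `R`-module structure of a right `A`-module is obtained along the ring map. -/
class RightRestricted (R A M : Type*) [Ring R] [Ring A] [RingMap R A] [AddCommGroup M]
    [Module Aᵐᵒᵖ M] [Module Rᵐᵒᵖ M] : Prop where
  op_smul_eq : ∀ (r : R) (m : M), op r • m = op (RingMap.hom r : A) • m

/-- The left `R`-module structure of a left `A`-module is obtained along the ring map. -/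
class LeftRestricted (R A M : Type*) [Ring R] [Ring A] [RingMap R A] [AddCommGroup M]
    [Module A M] [Module R M] : Prop where
  smul_eq : ∀ (r : R) (m : M), r • m = (RingMap.hom r : A) • m

instance {C : Type*} [AddCommGroup C] [Module Rᵐᵒᵖ C] : RightRestricted R A (BTensor R C A) where
  op_smul_eq r t := by
    induction t using BTensor.induction_on with
    | zero => simp
    | simple m n => simp [RingMap.op_smul_def]
    | add a b ha hb => rw [smul_add, smul_add, ha, hb]

instance {C : Type*} [AddCommGroup C] [Module R C] : LeftRestricted R A (BTensor R A C) where
  smul_eq r t := by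
    induction t using BTensor.induction_on with
    | zero => simp
    | simple m n => simp [RingMap.smul_def]
    | add a b ha hb => rw [smul_add, smul_add, ha, hb]

theorem RingMap.balanced (a : A) (r : R) (b : A) :
    AddMonoidHom.mul (op r • a) b = AddMonoidHom.mul a (r • b) :=
  mul_assoc a (RingMap.hom r) b

variable (R A) in
/-- The multiplication `A ⊗_R A → A` as an additive map. -/
def mulAux : BTensor R A A →+ A :=
  BTensor.lift AddMonoidHom.mul RingMap.balanced

theorem mulAux_tmul (a b : A) : mulAux R A (BTensor.tmul R a b) = a * b :=
  BTensor.lift_tmul _ _ _ _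

variable (R A) in
/-- The multiplication `A ⊗_R A → A`. -/
def mulMap : BHom R R (BTensor R A A) A where
  toAddMonoidHom := mulAux R A
  map_smul' r t := by
    change mulAux R A (r • t) = r • mulAux R A t
    induction t using BTensor.induction_on with
    | zero => rw [smul_zero, map_zero, smul_zero]
    | simple m n =>
      rw [BTensor.smul_tmul', mulAux_tmul, mulAux_tmul]
      exact mul_assoc _ _ _
    | add a b ha hb => rw [smul_add, map_add, map_add, smul_add, ha, hb]
  map_op_smul' r t := by
    change mulAux R A (op r • t) = op r • mulAux R A t
    induction t using BTensor.induction_on with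
    | zero => rw [smul_zero, map_zero, smul_zero]
    | simple m n =>
      rw [BTensor.op_smul_tmul, mulAux_tmul, mulAux_tmul]
      exact (mul_assoc _ _ _).symm
    | add a b ha hb => rw [smul_add, map_add, map_add, smul_add, ha, hb]

variable (R A M) in
/-- The action `M ⊗_R A → M` of a right `A`-module. -/
def rightAct [Module Aᵐᵒᵖ M] [Module Rᵐᵒᵖ M] [RightRestricted R A M] :
    BTensor R M A →ₗ[Rᵐᵒᵖ] M where
  toFun := BTensor.lift
    (AddMonoidHom.mk' (fun m => AddMonoidHom.mk' (fun a : A => op a • m)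
      (fun a b => by rw [op_add, add_smul])) (fun m n => by ext a; exact smul_add _ _ _))
    (fun m r a => by simp [RightRestricted.op_smul_eq (A := A) r m, RingMap.smul_def, mul_smul])
  map_add' := map_add _
  map_smul' r t := by
    induction r using MulOpposite.rec' with
    | _ r =>
    induction t using BTensor.induction_on with
    | zero => simp
    | simple m n =>
      simp [RingMap.op_smul_def, RightRestricted.op_smul_eq (A := A) r (op n • m), mul_smul]
    | add a b ha hb => rw [smul_add, map_add, map_add, smul_add, ha, hb]

variable (R A M) in
/-- The action `A ⊗_R M → M` of a left `A`-module. -/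
def leftAct [Module A M] [Module R M] [LeftRestricted R A M] :
    BTensor R A M →ₗ[R] M where
  toFun := BTensor.lift
    (AddMonoidHom.mk' (fun a => AddMonoidHom.mk' (fun m : M => a • m) (smul_add a))
      (fun a b => by ext m; exact add_smul _ _ _))
    (fun a r m => by
      simp [LeftRestricted.smul_eq (A := A) r m, RingMap.op_smul_def, mul_smul])
  map_add' := map_add _
  map_smul' r t := by
    induction t using BTensor.induction_on with
    | zero => simp
    | simple m n =>
      simp [RingMap.smul_def, LeftRestricted.smul_eq (A := A) r (m • n), mul_smul]
    | add a b ha hb => rw [smul_add, map_add, map_add, smul_add, ha, hb]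

end RingMap

/-! ### Entwining structures, entwined modules, comodules of the associated corings -/

section RightEntwining

variable {R A C M N : Type*} [Ring R] [Ring A] [RingMap R A]
  [AddCommGroup C] [Module R C] [Module Rᵐᵒᵖ C] [SMulCommClass R Rᵐᵒᵖ C]
  [AddCommGroup M] [AddCommGroup N]

/-- The `R`-coring `C` is entwined with the `R`-ring `A` by `ψ : C ⊗_R A → A ⊗_R C`. -/
structure IsRightEntwining (cC : Coring R C)
    (ψ : BHom R R (BTensor R C A) (BTensor R A C)) : Prop where
  mul : ∀ (c : C) (a b : A), ψ (BTensor.tmul R c (a * b)) =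
    (mulMap R A).tmap (BHom.id R R C) ((BTensor.assoc R R A A C).symm
      ((BHom.id R R A).tmap ψ (BTensor.assoc R R A C A
        (BTensor.tmul R (ψ (BTensor.tmul R c a)) b))))
  one : ∀ c : C, ψ (BTensor.tmul R c 1) = BTensor.tmul R 1 c
  comul : ∀ (c : C) (a : A), (BHom.id R R A).tmap cC.comul (ψ (BTensor.tmul R c a)) =
    BTensor.assoc R R A C C (ψ.tmap (BHom.id R R C) ((BTensor.assoc R R C A C).symm
      ((BHom.id R R C).tmap ψ (BTensor.assoc R R C C A (BTensor.tmul R (cC.comul c) a)))))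
  counit : ∀ (c : C) (a : A), (BHom.id R R A).tmap cC.counit (ψ (BTensor.tmul R c a)) =
    BTensor.tmul R (cC.counit c • a) 1

/-- `ρ` makes the right `A`-module `M` a right entwined module, that is, a right `C`-comodule with
`ρ(m a) = m₀ ψ(m₁ ⊗ a)`. -/
structure IsRightEntwinedModule [Module Aᵐᵒᵖ M] [Module Rᵐᵒᵖ M] [RightRestricted R A M]
    (cC : Coring R C) (ψ : BHom R R (BTensor R C A) (BTensor R A C))
    (ρ : M →ₗ[Rᵐᵒᵖ] BTensor R M C) : Prop where
  comodule : IsRightComodule cC ρ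
  compat : ∀ (m : M) (a : A), ρ (op a • m) =
    BTensor.map (rightAct R A M) (LinearMap.id : C →ₗ[R] C) ((BTensor.assoc R R M A C).symm
      (BTensor.map LinearMap.id ψ.l (BTensor.assoc R R M C A (BTensor.tmul R (ρ m) a))))

variable (R A C M) in
/-- The canonical map `M ⊗_R C → M ⊗_A (A ⊗_R C)`, `m ⊗ c ↦ m ⊗ (1 ⊗ c)`. -/
def toRightCoring [Module Aᵐᵒᵖ M] [Module Rᵐᵒᵖ M] [RightRestricted R A M] :
    BTensor R M C →+ BTensor A M (BTensor R A C) :=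
  BTensor.lift
    (AddMonoidHom.mk' (fun m => (BTensor.mk A M (BTensor R A C) m).comp (BTensor.mk R A C 1))
      (fun m n => by ext c; simp))
    (fun m r c => by
      simp only [AddMonoidHom.mk'_apply, AddMonoidHom.comp_apply, BTensor.mk_apply]
      rw [RightRestricted.op_smul_eq (A := A) r m, BTensor.smul_tmul, ← BTensor.smul_tmul 1 r c,
        BTensor.smul_tmul', RingMap.op_smul_def, smul_eq_mul, mul_one, one_mul])

/-- The set `Hom^𝒞(M, N)` of morphisms of right comodules of the `A`-coring `𝒞 = A ⊗_R C`: the right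
`A`-linear maps that commute with the coactions `M → M ⊗_A 𝒞`, `m ↦ m₀ ⊗ (1 ⊗ m₁)`, and
`N → N ⊗_A 𝒞` induced by `ρM` and `ρN`. -/
def rightComoduleHom [Module Aᵐᵒᵖ M] [Module Rᵐᵒᵖ M] [RightRestricted R A M]
    [Module Aᵐᵒᵖ N] [Module Rᵐᵒᵖ N] [RightRestricted R A N]
    (ρM : M →ₗ[Rᵐᵒᵖ] BTensor R M C) (ρN : N →ₗ[Rᵐᵒᵖ] BTensor R N C) :
    Set (M →ₗ[Aᵐᵒᵖ] N) :=
  {f | ∀ m, BTensor.map f (LinearMap.id : BTensor R A C →ₗ[A] BTensor R A C)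
      (toRightCoring R A C M (ρM m)) = toRightCoring R A C N (ρN (f m))}

/-- The right coaction `(C ⊗ ψ) ∘ (Δ ⊗ A)` on `C ⊗_R A`. -/
def rightEntwinedCoaction (cC : Coring R C) (ψ : BHom R R (BTensor R C A) (BTensor R A C)) :
    BHom R R (BTensor R C A) (BTensor R (BTensor R C A) C) :=
  (BHom.assocSymm R R R R C A C).comp (((BHom.id R R C).tmap ψ).comp
    ((BHom.assoc R R R R C C A).comp (cC.comul.tmap (BHom.id R R A))))

end RightEntwining

section LeftEntwining

variable {S B D M N : Type*} [Ring S] [Ring B] [RingMap S B]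
  [AddCommGroup D] [Module S D] [Module Sᵐᵒᵖ D] [SMulCommClass S Sᵐᵒᵖ D]
  [AddCommGroup M] [AddCommGroup N]

/-- The `S`-ring `B` is entwined with the `S`-coring `D` by `φ : B ⊗_S D → D ⊗_S B`. -/
structure IsLeftEntwining (cD : Coring S D)
    (φ : BHom S S (BTensor S B D) (BTensor S D B)) : Prop where
  mul : ∀ (a b : B) (d : D), φ (BTensor.tmul S (a * b) d) =
    (BHom.id S S D).tmap (mulMap S B) (BTensor.assoc S S D B B
      (φ.tmap (BHom.id S S B) ((BTensor.assoc S S B D B).symm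
        (BTensor.tmul S a (φ (BTensor.tmul S b d))))))
  one : ∀ d : D, φ (BTensor.tmul S 1 d) = BTensor.tmul S d 1
  comul : ∀ (b : B) (d : D), cD.comul.tmap (BHom.id S S B) (φ (BTensor.tmul S b d)) =
    (BTensor.assoc S S D D B).symm ((BHom.id S S D).tmap φ (BTensor.assoc S S D B D
      (φ.tmap (BHom.id S S D) ((BTensor.assoc S S B D D).symm
        (BTensor.tmul S b (cD.comul d))))))
  counit : ∀ (b : B) (d : D), cD.counit.tmap (BHom.id S S B) (φ (BTensor.tmul S b d)) =
    BTensor.tmul S 1 (op (cD.counit d) • b)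

/-- `ρ` makes the left `B`-module `M` a left entwined module, that is, a left `D`-comodule with
`ρ(b m) = φ(b ⊗ m₋₁) m₀`. -/
structure IsLeftEntwinedModule [Module B M] [Module S M] [LeftRestricted S B M]
    (cD : Coring S D) (φ : BHom S S (BTensor S B D) (BTensor S D B))
    (ρ : M →ₗ[S] BTensor S D M) : Prop where
  comodule : IsLeftComodule cD ρ
  compat : ∀ (b : B) (m : M), ρ (b • m) =
    BTensor.map (LinearMap.id : D →ₗ[Sᵐᵒᵖ] D) (leftAct S B M) (BTensor.assoc S S D B M
      (BTensor.map φ.r LinearMap.id ((BTensor.assoc S S B D M).symm (BTensor.tmul S b (ρ m)))))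

variable (S B D M) in
/-- The canonical map `D ⊗_S M → (D ⊗_S B) ⊗_B M`, `d ⊗ m ↦ (d ⊗ 1) ⊗ m`. -/
def toLeftCoring [Module B M] [Module S M] [LeftRestricted S B M] :
    BTensor S D M →+ BTensor B (BTensor S D B) M :=
  BTensor.lift
    (AddMonoidHom.mk' (fun d => BTensor.mk B (BTensor S D B) M (BTensor.tmul S d 1))
      (fun m n => by ext c; simp [BTensor.add_tmul]))
    (fun d s m => by
      simp only [AddMonoidHom.mk'_apply, BTensor.mk_apply]
      rw [LeftRestricted.smul_eq (A := B) s m, ← BTensor.smul_tmul, BTensor.smul_tmul,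
        BTensor.op_smul_tmul, RingMap.smul_def, _root_.op_smul_eq_mul, mul_one, one_mul])

/-- The set `^𝒟Hom(M, N)` of morphisms of left comodules of the `B`-coring `𝒟 = D ⊗_S B`: the left
`B`-linear maps that commute with the coactions `M → 𝒟 ⊗_B M`, `m ↦ (m₋₁ ⊗ 1) ⊗ m₀`, and
`N → 𝒟 ⊗_B N` induced by `ρM` and `ρN`. -/
def leftComoduleHom [Module B M] [Module S M] [LeftRestricted S B M]
    [Module B N] [Module S N] [LeftRestricted S B N]
    (ρM : M →ₗ[S] BTensor S D M) (ρN : N →ₗ[S] BTensor S D N) :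
    Set (M →ₗ[B] N) :=
  {f | ∀ m, BTensor.map (LinearMap.id : BTensor S D B →ₗ[Bᵐᵒᵖ] BTensor S D B) f
      (toLeftCoring S B D M (ρM m)) = toLeftCoring S B D N (ρN (f m))}

/-- The left coaction `(φ ⊗ D) ∘ (B ⊗ Δ)` on `B ⊗_S D`. -/
def leftEntwinedCoaction (cD : Coring S D) (φ : BHom S S (BTensor S B D) (BTensor S D B)) :
    BHom S S (BTensor S B D) (BTensor S D (BTensor S B D)) :=
  (BHom.assoc S S S S D B D).comp ((φ.tmap (BHom.id S S D)).comp
    ((BHom.assocSymm S S S S B D D).comp ((BHom.id S S B).tmap cD.comul)))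

end LeftEntwining

/-! ### Bimodule herds -/

/-- Ring maps `α : R → A` and `β : S → B`, a `B`-`A` bimodule `T` and an `A`-`B` bimodule `T'`. -/
structure BimodulePair : Type (u + 1) where
  (R S A B T T' : Type u)
  [ringR : Ring R]
  [ringS : Ring S]
  [ringA : Ring A]
  [ringB : Ring B]
  [addT : AddCommGroup T]
  [addT' : AddCommGroup T']
  α : R →+* A
  β : S →+* B
  [leftT : Module B T]
  [rightT : Module Aᵐᵒᵖ T]
  [commT : SMulCommClass B Aᵐᵒᵖ T]
  [leftT' : Module A T']
  [rightT' : Module Bᵐᵒᵖ T']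
  [commT' : SMulCommClass A Bᵐᵒᵖ T']

namespace BimodulePair

attribute [instance] ringR ringS ringA ringB addT addT' leftT rightT commT leftT' rightT' commT'

variable (P : BimodulePair.{u})

instance : RingMap P.R P.A := ⟨P.α⟩

instance : RingMap P.S P.B := ⟨P.β⟩

instance : Module P.S P.T := Module.compHom P.T P.β

instance : Module P.Rᵐᵒᵖ P.T := Module.compHom P.T (RingHom.op P.α)

instance : Module P.R P.T' := Module.compHom P.T' P.α

instance : Module P.Sᵐᵒᵖ P.T' := Module.compHom P.T' (RingHom.op P.β)

instance : LeftRestricted P.S P.B P.T := ⟨fun _ _ => rfl⟩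

instance : RightRestricted P.R P.A P.T := ⟨fun _ _ => rfl⟩

instance : LeftRestricted P.R P.A P.T' := ⟨fun _ _ => rfl⟩

instance : RightRestricted P.S P.B P.T' := ⟨fun _ _ => rfl⟩

instance : SMulCommClass P.S P.Rᵐᵒᵖ P.T :=
  ⟨fun s r x => smul_comm (P.β s) (RingHom.op P.α r) x⟩

instance : SMulCommClass P.B P.Rᵐᵒᵖ P.T :=
  ⟨fun b r x => smul_comm b (RingHom.op P.α r) x⟩

instance : SMulCommClass P.S P.Aᵐᵒᵖ P.T :=
  ⟨fun s a x => smul_comm (P.β s) a x⟩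

instance : SMulCommClass P.R P.Sᵐᵒᵖ P.T' :=
  ⟨fun r s x => smul_comm (P.α r) (RingHom.op P.β s) x⟩

instance : SMulCommClass P.A P.Sᵐᵒᵖ P.T' :=
  ⟨fun a s x => smul_comm a (RingHom.op P.β s) x⟩

instance : SMulCommClass P.R P.Bᵐᵒᵖ P.T' :=
  ⟨fun r b x => smul_comm (P.α r) b x⟩

/-- `T' ⊗_S T` -/
abbrev T'T : Type u := BTensor P.S P.T' P.T

/-- `T ⊗_R T'` -/
abbrev TT' : Type u := BTensor P.R P.T P.T'

/-- `T ⊗_R T' ⊗_S T` -/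
abbrev TT'T : Type u := BTensor P.R P.T P.T'T

/-- `T' ⊗_S T ⊗_R T'` -/
abbrev T'TT' : Type u := BTensor P.R P.T'T P.T'

/-- `α ⊗_R T' ⊗_S T : T' ⊗_S T → A ⊗_R T' ⊗_S T`. -/
def ζC : BHom P.R P.R P.T'T (BTensor P.R P.A P.T'T) where
  toAddMonoidHom := BTensor.mk P.R P.A P.T'T 1
  map_smul' r t := by
    change BTensor.tmul P.R 1 (r • t) = r • BTensor.tmul P.R 1 t
    rw [← BTensor.smul_tmul, BTensor.smul_tmul', RingMap.smul_def, RingMap.op_smul_def,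
      one_mul, mul_one]
  map_op_smul' r t := (BTensor.op_smul_tmul (op r) (1 : P.A) t).symm

/-- `T ⊗_R T' ⊗_S β : T ⊗_R T' → T ⊗_R T' ⊗_S B`. -/
def ζD : BHom P.S P.S P.TT' (BTensor P.S P.TT' P.B) where
  toAddMonoidHom := (BTensor.mk P.S P.TT' P.B).flip 1
  map_smul' r t := (BTensor.smul_tmul' r t (1 : P.B)).symm
  map_op_smul' r t := by
    change BTensor.tmul P.S (op r • t) 1 = op r • BTensor.tmul P.S t 1
    rw [BTensor.smul_tmul, BTensor.op_smul_tmul, RingMap.smul_def, RingMap.op_smul_def,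
      one_mul, mul_one]

end BimodulePair

/-- The `A`-`B` bimodule `T'` is a formal dual of the `B`-`A` bimodule `T`, with evaluation maps
`ev` and `ev'`. -/
structure FormalDual (P : BimodulePair.{u}) where
  /-- the map `T' ⊗_S T → A` -/
  ev : BHom P.A P.A P.T'T P.A
  /-- the map `T ⊗_R T' → B` -/
  ev' : BHom P.B P.B P.TT' P.B
  triangle : ∀ (x : P.T) (x' : P.T') (y : P.T),
    ev' (BTensor.tmul P.R x x') • y = op (ev (BTensor.tmul P.S x' y)) • x
  triangle' : ∀ (x' : P.T') (x : P.T) (y' : P.T'),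
    ev (BTensor.tmul P.S x' x) • y' = op (ev' (BTensor.tmul P.R x y')) • x'

namespace FormalDual

variable {P : BimodulePair.{u}} (F : FormalDual P)

/-- `ev` as a map of `R`-bimodules. -/
def evR : BHom P.R P.R P.T'T P.A where
  toAddMonoidHom := F.ev.toAddMonoidHom
  map_smul' r t := by
    have h : r • t = P.α r • t := by
      induction t using BTensor.induction_on with
      | zero => simp
      | simple m n => rfl
      | add a b ha hb => rw [smul_add, smul_add, ha, hb]
    rw [h]
    exact F.ev.map_smul (P.α r) t
  map_op_smul' r t := by
    have h : op r • t = op (P.α r) • t := by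
      induction t using BTensor.induction_on with
      | zero => simp
      | simple m n => rfl
      | add a b ha hb => rw [smul_add, smul_add, ha, hb]
    rw [h]
    exact F.ev.map_op_smul (P.α r) t

/-- `ev'` as a map of `S`-bimodules. -/
def ev'S : BHom P.S P.S P.TT' P.B where
  toAddMonoidHom := F.ev'.toAddMonoidHom
  map_smul' r t := by
    have h : r • t = P.β r • t := by
      induction t using BTensor.induction_on with
      | zero => simp
      | simple m n => rfl
      | add a b ha hb => rw [smul_add, smul_add, ha, hb]
    rw [h]
    exact F.ev'.map_smul (P.β r) t
  map_op_smul' r t := by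
    have h : op r • t = op (P.β r) • t := by
      induction t using BTensor.induction_on with
      | zero => simp
      | simple m n => rfl
      | add a b ha hb => rw [smul_add, smul_add, ha, hb]
    rw [h]
    exact F.ev'.map_op_smul (P.β r) t

/-- `(T' ⊗_S T ⊗_R ev)(z ⊗_S y)` -/
def contractRight (z : P.T'TT') (y : P.T) : BTensor P.R P.T'T P.A :=
  (BHom.id P.R P.R P.T'T).tmap F.evR (BTensor.assoc P.R P.S P.T'T P.T' P.T (BTensor.tmul P.S z y))

/-- `(ev' ⊗_S T ⊗_R T')(y ⊗_R z)` -/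
def contractLeft (y : P.T) (z : P.T'TT') : BTensor P.S P.B P.TT' :=
  F.ev'S.tmap (BHom.id P.S P.S P.TT') ((BTensor.assoc P.R P.S P.T P.T' P.TT').symm
    (BTensor.tmul P.R y (BTensor.assoc P.S P.R P.T' P.T P.T' z)))

/-- `ev ⊗_A T' : T' ⊗_S T ⊗_R T' → T'`, `x' ⊗ x ⊗ y' ↦ ev(x' ⊗ x) y'`. -/
def evLeft : P.T'TT' →+ P.T' :=
  (leftAct P.R P.A P.T').toAddMonoidHom.comp (F.evR.tmap (BHom.id P.R P.S P.T')).toAddMonoidHom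

/-- `T' ⊗_B ev' : T' ⊗_S T ⊗_R T' → T'`, `x' ⊗ x ⊗ y' ↦ x' ev'(x ⊗ y')`. -/
def evRight : P.T'TT' →+ P.T' :=
  (rightAct P.S P.B P.T').toAddMonoidHom.comp
    (((BHom.id P.R P.S P.T').tmap F.ev'S).toAddMonoidHom.comp
      (BTensor.assoc P.S P.R P.T' P.T P.T').toAddMonoidHom)

end FormalDual

/-- A `B`-`A` herd structure on a `B`-`A` bimodule `T` with a formal dual `T'` (the pen): an `S`-`R`
bimodule map `γ : T → T ⊗_R T' ⊗_S T` (the shepherd). -/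
structure BimoduleHerd {P : BimodulePair.{u}} (F : FormalDual P) where
  /-- the shepherd -/
  γ : BHom P.S P.R P.T P.TT'T
  /-- `(ev' ⊗_S T) ∘ γ = β ⊗_S T` -/
  unit_left : ∀ x : P.T, BTensor.map F.ev'S.r (LinearMap.id : P.T →ₗ[P.S] P.T)
    ((BTensor.assoc P.R P.S P.T P.T' P.T).symm (γ x)) = BTensor.tmul P.S 1 x
  /-- `(T ⊗_R ev) ∘ γ = T ⊗_R α` -/
  unit_right : ∀ x : P.T, BTensor.map (LinearMap.id : P.T →ₗ[P.Rᵐᵒᵖ] P.T) F.evR.l (γ x) =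
    BTensor.tmul P.R x 1
  /-- `(γ ⊗_R T' ⊗_S T) ∘ γ = (T ⊗_R T' ⊗_S γ) ∘ γ` in `T ⊗_R T' ⊗_S T ⊗_R T' ⊗_S T` -/
  coassoc : ∀ x : P.T,
    (BHom.id P.S P.R P.T).tmap (BHom.assoc P.R P.R P.S P.R P.T' P.T P.T'T)
      (BTensor.assoc P.R P.R P.T P.T'T P.T'T (γ.tmap (BHom.id P.R P.R P.T'T) (γ x))) =
    (BHom.id P.S P.R P.T).tmap ((BHom.id P.R P.S P.T').tmap γ) (γ x)

namespace BimoduleHerd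

/-- The herd is tame: both evaluation maps are surjective and `T` is faithfully flat as a right
`R`-module and as a left `S`-module. -/
structure Tame {P : BimodulePair.{u}} {F : FormalDual P} (_H : BimoduleHerd F) : Prop where
  ev_surjective : Function.Surjective F.ev
  ev'_surjective : Function.Surjective F.ev'
  flat_right : RightFaithfullyFlat P.R P.T
  flat_left : LeftFaithfullyFlat P.S P.T

variable {P : BimodulePair.{u}} {F : FormalDual P} (H : BimoduleHerd F)

/-- `T' ⊗_S γ`, as a map `T' ⊗_S T → (T' ⊗_S T) ⊗_R (T' ⊗_S T)`. -/
def γr : BHom P.R P.R P.T'T (BTensor P.R P.T'T P.T'T) :=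
  (BHom.assocSymm P.R P.R P.S P.R P.T' P.T P.T'T).comp ((BHom.id P.R P.S P.T').tmap H.γ)

/-- `γ ⊗_R T'`, as a map `T ⊗_R T' → (T ⊗_R T') ⊗_S (T ⊗_R T')`. -/
def γl : BHom P.S P.S P.TT' (BTensor P.S P.TT' P.TT') :=
  (BHom.assoc P.S P.S P.S P.R P.TT' P.T P.T').comp
    (((BHom.assocSymm P.S P.R P.R P.S P.T P.T' P.T).comp H.γ).tmap (BHom.id P.R P.S P.T'))

/-- `(ev ⊗_R T' ⊗_S T) ∘ (T' ⊗_S γ) : T' ⊗_S T → A ⊗_R T' ⊗_S T`. -/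
def ξC : BHom P.R P.R P.T'T (BTensor P.R P.A P.T'T) :=
  (F.evR.tmap (BHom.id P.R P.R P.T'T)).comp H.γr

/-- `(T ⊗_R T' ⊗_S ev') ∘ (γ ⊗_R T') : T ⊗_R T' → T ⊗_R T' ⊗_S B`. -/
def ξD : BHom P.S P.S P.TT' (BTensor P.S P.TT' P.B) :=
  ((BHom.id P.S P.S P.TT').tmap F.ev'S).comp H.γl

/-- The `R`-bimodule `C`, as a sub-bimodule of `T' ⊗_S T`. -/
def subC : SubBimodule P.R P.R P.T'T := SubBimodule.equaliser H.ξC P.ζC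

/-- The `S`-bimodule `D`, as a sub-bimodule of `T ⊗_R T'`. -/
def subD : SubBimodule P.S P.S P.TT' := SubBimodule.equaliser H.ξD P.ζD

/-- The `R`-bimodule `C`. -/
abbrev C : Type u := H.subC.toAddSubgroup

/-- The `S`-bimodule `D`. -/
abbrev D : Type u := H.subD.toAddSubgroup

/-- The inclusion `C → T' ⊗_S T`. -/
abbrev ιC : BHom P.R P.R H.C P.T'T := H.subC.incl

/-- The inclusion `D → T ⊗_R T'`. -/
abbrev ιD : BHom P.S P.S H.D P.TT' := H.subD.incl

/-- The canonical map `C ⊗_R T' → T' ⊗_S T ⊗_R T'`. -/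
def fromCT' : BHom P.R P.S (BTensor P.R H.C P.T') P.T'TT' :=
  H.ιC.tmap (BHom.id P.R P.S P.T')

/-- The canonical map `T' ⊗_S D → T' ⊗_S T ⊗_R T'`. -/
def fromT'D : BHom P.R P.S (BTensor P.S P.T' H.D) P.T'TT' :=
  (BHom.assocSymm P.R P.S P.S P.R P.T' P.T P.T').comp ((BHom.id P.R P.S P.T').tmap H.ιD)

/-- `(C ⊗_R T') ∩ (T' ⊗_S D)`, as a sub-bimodule of `T' ⊗_S T ⊗_R T'`. -/
def subTbar : SubBimodule P.R P.S P.T'TT' :=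
  (SubBimodule.range H.fromCT').inter (SubBimodule.range H.fromT'D)

/-- The `R`-`S` bimodule `T̄ = (C ⊗_R T') ∩ (T' ⊗_S D)`. -/
abbrev Tbar : Type u := H.subTbar.toAddSubgroup

/-- The inclusion `T̄ → T' ⊗_S T ⊗_R T'`. -/
abbrev ιT : BHom P.R P.S H.Tbar P.T'TT' := H.subTbar.incl

/-- `T' ⊗_S γ ⊗_R T'`, as a map `T' ⊗_S T ⊗_R T' → (T' ⊗_S T) ⊗_R (T' ⊗_S T ⊗_R T')`. -/
def γmidLeft : BHom P.R P.S P.T'TT' (BTensor P.R P.T'T P.T'TT') :=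
  (BHom.assoc P.R P.S P.R P.R P.T'T P.T'T P.T').comp (H.γr.tmap (BHom.id P.R P.S P.T'))

/-- `T' ⊗_S γ ⊗_R T'`, as a map `T' ⊗_S T ⊗_R T' → (T' ⊗_S T ⊗_R T') ⊗_S (T ⊗_R T')`. -/
def γmidRight : BHom P.R P.S P.T'TT' (BTensor P.S P.T'TT' P.TT') :=
  (BHom.assoc P.R P.S P.S P.R P.T'TT' P.T P.T').comp
    (((BHom.assocSymm P.R P.R P.R P.S P.T'T P.T' P.T).comp H.γr).tmap (BHom.id P.R P.S P.T'))

end BimoduleHerd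

end BimoduleHerds

end

open BimoduleHerds

/-! The proof is faithfully flat descent along `T`, carried out with split forks. `C` is the
equaliser of `ξC` and `ζC` on `T' ⊗_S T`. After `T ⊗_R -` this fork splits. The map `x ⊗ a ⊗ t ↦ xa
⊗ t` (`absorbRight`) is a retraction of `T ⊗ ζC`. By the triangle identity `x ev(x' ⊗ y) = ev'(x ⊗
x') y`, it turns `T ⊗ ξC` into `x ⊗ x' ⊗ y ↦ ev'(x ⊗ x') γ(y)`, and this factors through `T ⊗_R C`
because `γ` does, by coassociativity (`γ_mem`). Every additional tensor factor preserves a split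
fork, and `T ⊗_R -` reflects equalisers. Hence `C ⊗_R N` is the equaliser of `ξC ⊗ N` and `ζC ⊗ N`
for every bimodule `N`, flat or not (`ιC_tmap_id_equaliser`). The mirror image for `D` is
`id_tmap_ιD_equaliser`. So `C ⊗_R T'` and `T' ⊗_S D` embed in `T' ⊗_S T ⊗_R T'`, and a map into `C
⊗_R N` is obtained by checking a single equation.

All structures are then restrictions of `γ` and of the evaluations, and their axioms are checked
after an injection into tensor powers of `T` and `T'`, where they are coassociativity, the unit laws
and the triangle identities. The counits take values in `R` and `S` because `R → A` and `S → B` are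
themselves equalisers, again by descent along `T`. Multiplication `A ⊗_R C → T' ⊗_S T` is bijective
(`actC_actCInv`, `actCInv_actC`), and `ψ` is the right action of `A` on `T' ⊗_S T` transported
through it. This reduces the entwining axioms to properties of that action.

For `h₁`, colinearity is forgotten first. Contraction gives a bijection between `C ⊗_R T'` and
`Hom_A(T, C ⊗_R A)`, with inverse `f ↦ Σ f(xᵢ) xᵢ'` for any `Σ xᵢ ⊗ xᵢ'` with `Σ ev'(xᵢ ⊗ xᵢ') = 1`.
A contracted element is colinear exactly when it satisfies the equation that cuts out `T' ⊗_S D`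
(`contractC_mem_iff`), that is, when it lies in `T̄`. The map `h₂` is the mirror image, and the two
candidates for `h` agree by the second triangle identity.

For the bicomodule structure, flatness shows that `γ ⊗ T'` maps `D` into `T ⊗_R T̄` and that `T' ⊗
γ` maps `C` into `T̄ ⊗_S T` (`galD`, `galC`). The first of these maps also splits a contraction of
`T ⊗_R T̄`, so `T ⊗ T̄ ⊗ T` is a direct summand of `T ⊗ (T' ⊗ T ⊗ T') ⊗ T` (`isSplit_T_ιT_T`). This
purity is what makes the tensor products of inclusions that involve `T̄` injective, so that the
coactions can be constructed and their axioms checked in the ambient tensor products. -/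

noncomputable section

namespace BimoduleHerds

/-! ### Calculus of tensor products of bimodules -/

namespace BTensor

variable {R S K L : Type*} [Ring R] [Ring S] [Ring K] [Ring L]
variable {M N P Q : Type*} [AddCommGroup M] [AddCommGroup N] [AddCommGroup P] [AddCommGroup Q]

theorem induction_on_right [Module Rᵐᵒᵖ M] [Module R N] [Module Sᵐᵒᵖ N] [SMulCommClass R Sᵐᵒᵖ N]
    [Module S P] {p : BTensor R M (BTensor S N P) → Prop} (t : BTensor R M (BTensor S N P))
    (zero : p 0) (simple : ∀ m n x, p (tmul R m (tmul S n x)))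
    (add : ∀ a b, p a → p b → p (a + b)) : p t := by
  induction t using induction_on with
  | zero => exact zero
  | simple m t =>
    induction t using induction_on with
    | zero => rw [tmul_zero]; exact zero
    | simple n x => exact simple m n x
    | add a b ha hb => rw [tmul_add]; exact add _ _ ha hb
  | add a b ha hb => exact add a b ha hb

theorem induction_on_left [Module Rᵐᵒᵖ M] [Module R N] [Module Sᵐᵒᵖ N] [SMulCommClass R Sᵐᵒᵖ N]
    [Module S P] {p : BTensor S (BTensor R M N) P → Prop} (t : BTensor S (BTensor R M N) P)
    (zero : p 0) (simple : ∀ m n x, p (tmul S (tmul R m n) x))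
    (add : ∀ a b, p a → p b → p (a + b)) : p t := by
  induction t using induction_on with
  | zero => exact zero
  | simple t x =>
    induction t using induction_on with
    | zero => rw [zero_tmul]; exact zero
    | simple m n => exact simple m n x
    | add a b ha hb => rw [add_tmul]; exact add _ _ ha hb
  | add a b ha hb => exact add a b ha hb

end BTensor

namespace BHom

variable {K L R S M N P M' N' P' M'' N'' : Type*} [Ring K] [Ring L] [Ring R] [Ring S]
  [AddCommGroup M] [AddCommGroup N] [AddCommGroup P] [AddCommGroup M'] [AddCommGroup N']
  [AddCommGroup P'] [AddCommGroup M''] [AddCommGroup N'']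

section Basic

variable [Module K M] [Module Lᵐᵒᵖ M] [Module K N] [Module Lᵐᵒᵖ N] [Module K P] [Module Lᵐᵒᵖ P]

theorem ext {f g : BHom K L M N} (h : ∀ m, f m = g m) : f = g := DFunLike.ext _ _ h

theorem map_mop_smul (f : BHom K L M N) (c : Lᵐᵒᵖ) (m : M) : f (c • m) = c • f m :=
  f.map_op_smul' c.unop m

/-- The factorisation of a bimodule map through an injective one. -/
def factor (i : BHom K L N P) (hi : Function.Injective i) (f : BHom K L M P)
    (h : ∀ m, ∃ n, i n = f m) : BHom K L M N where
  toFun m := (h m).choose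
  map_zero' := hi (by rw [(h 0).choose_spec, map_zero, map_zero])
  map_add' a b := hi ((h (a + b)).choose_spec.trans ((map_add f a b).trans
    ((map_add i _ _).trans (congrArg₂ _ (h a).choose_spec (h b).choose_spec)).symm))
  map_smul' k m := hi (by
    rw [i.map_smul]
    exact (h _).choose_spec.trans ((f.map_smul k m).trans
      (congrArg _ (h m).choose_spec).symm))
  map_op_smul' k m := hi (by
    rw [i.map_op_smul]
    exact (h _).choose_spec.trans ((f.map_op_smul k m).trans
      (congrArg _ (h m).choose_spec).symm))

theorem apply_factor (i : BHom K L N P) (hi : Function.Injective i) (f : BHom K L M P)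
    (h : ∀ m, ∃ n, i n = f m) (m : M) : i (factor i hi f h m) = f m :=
  (h m).choose_spec

end Basic

section Tensor

variable [Module K M] [Module Rᵐᵒᵖ M] [SMulCommClass K Rᵐᵒᵖ M]
  [Module K M'] [Module Rᵐᵒᵖ M'] [SMulCommClass K Rᵐᵒᵖ M']
  [Module K M''] [Module Rᵐᵒᵖ M''] [SMulCommClass K Rᵐᵒᵖ M'']
  [Module R N] [Module Lᵐᵒᵖ N] [SMulCommClass R Lᵐᵒᵖ N]
  [Module R N'] [Module Lᵐᵒᵖ N'] [SMulCommClass R Lᵐᵒᵖ N']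
  [Module R N''] [Module Lᵐᵒᵖ N''] [SMulCommClass R Lᵐᵒᵖ N'']

theorem tmap_tmap (f : BHom K R M' M'') (g : BHom R L N' N'') (f' : BHom K R M M')
    (g' : BHom R L N N') (t : BTensor R M N) :
    tmap f g (tmap f' g' t) = tmap (f.comp f') (g.comp g') t := by
  induction t using BTensor.induction_on with
  | zero => simp
  | simple m n => simp
  | add a b ha hb => simp only [map_add, ha, hb]

theorem tmap_congr {f f' : BHom K R M M'} {g g' : BHom R L N N'} (hf : ∀ m, f m = f' m)
    (hg : ∀ n, g n = g' n) (t : BTensor R M N) : tmap f g t = tmap f' g' t := by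
  rw [ext hf, ext hg]

/-- The tensor product of two commuting squares. It serves to move inclusions such as `ιC` and `ιD`
past a structure map, replacing that map by its ambient version. -/
theorem tmap_tmap_congr {M₀ N₀ : Type*} [AddCommGroup M₀] [AddCommGroup N₀]
    [Module K M₀] [Module Rᵐᵒᵖ M₀] [SMulCommClass K Rᵐᵒᵖ M₀]
    [Module R N₀] [Module Lᵐᵒᵖ N₀] [SMulCommClass R Lᵐᵒᵖ N₀]
    {f : BHom K R M' M''} {g : BHom R L N' N''} {f' : BHom K R M M'} {g' : BHom R L N N'}
    {h : BHom K R M₀ M''} {k : BHom R L N₀ N''} {h' : BHom K R M M₀} {k' : BHom R L N N₀}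
    (hf : ∀ m, f (f' m) = h (h' m)) (hg : ∀ n, g (g' n) = k (k' n)) (t : BTensor R M N) :
    tmap f g (tmap f' g' t) = tmap h k (tmap h' k' t) := by
  rw [tmap_tmap, tmap_tmap]
  exact tmap_congr hf hg t

theorem tmap_eq_self {f : BHom K R M M} {g : BHom R L N N} (hf : ∀ m, f m = m)
    (hg : ∀ n, g n = n) (t : BTensor R M N) : tmap f g t = t := by
  induction t using BTensor.induction_on with
  | zero => simp
  | simple m n => simp [hf, hg]
  | add a b ha hb => simp only [map_add, ha, hb]

@[simp] theorem tmap_id (t : BTensor R M N) : tmap (id K R M) (id R L N) t = t :=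
  tmap_eq_self (fun _ => rfl) (fun _ => rfl) t

theorem tmap_id_comp (f : BHom K R M' M'') (f' : BHom K R M M') (t : BTensor R M N) :
    tmap (f.comp f') (id R L N) t = tmap f (id R L N) (tmap f' (id R L N) t) := by
  rw [tmap_tmap]
  exact tmap_congr (fun _ => rfl) (fun _ => rfl) t

theorem id_tmap_comp (g : BHom R L N' N'') (g' : BHom R L N N') (t : BTensor R M N) :
    tmap (id K R M) (g.comp g') t = tmap (id K R M) g (tmap (id K R M) g' t) := by
  rw [tmap_tmap]
  exact tmap_congr (fun _ => rfl) (fun _ => rfl) t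

theorem tmap_eq_left (f : BHom K R M M') (g : BHom R L N N') (t : BTensor R M N) :
    tmap f g t = tmap f (id R L N') (tmap (id K R M) g t) := by
  rw [tmap_tmap]
  exact tmap_congr (fun _ => rfl) (fun _ => rfl) t

theorem tmap_eq_right (f : BHom K R M M') (g : BHom R L N N') (t : BTensor R M N) :
    tmap f g t = tmap (id K R M') g (tmap f (id R L N) t) := by
  rw [tmap_tmap]
  exact tmap_congr (fun _ => rfl) (fun _ => rfl) t

end Tensor

section Assoc

variable [Module K M] [Module Rᵐᵒᵖ M] [SMulCommClass K Rᵐᵒᵖ M]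
  [Module R N] [Module Sᵐᵒᵖ N] [SMulCommClass R Sᵐᵒᵖ N]
  [Module S P] [Module Lᵐᵒᵖ P] [SMulCommClass S Lᵐᵒᵖ P]
  [Module K M'] [Module Rᵐᵒᵖ M'] [SMulCommClass K Rᵐᵒᵖ M']
  [Module R N'] [Module Sᵐᵒᵖ N'] [SMulCommClass R Sᵐᵒᵖ N']
  [Module S P'] [Module Lᵐᵒᵖ P'] [SMulCommClass S Lᵐᵒᵖ P']

@[simp] theorem assoc_apply (t : BTensor S (BTensor R M N) P) :
    assoc K L R S M N P t = BTensor.assoc R S M N P t := rfl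

@[simp] theorem assocSymm_apply (t : BTensor R M (BTensor S N P)) :
    assocSymm K L R S M N P t = (BTensor.assoc R S M N P).symm t := rfl

theorem assoc_tmap (f : BHom K R M M') (g : BHom R S N N') (h : BHom S L P P')
    (t : BTensor S (BTensor R M N) P) :
    BTensor.assoc R S M' N' P' (tmap (tmap f g) h t) =
      tmap f (tmap g h) (BTensor.assoc R S M N P t) := by
  induction t using BTensor.induction_on_left with
  | zero => simp
  | simple m n p => simp
  | add a b ha hb => simp only [map_add, ha, hb]

theorem assoc_symm_tmap (f : BHom K R M M') (g : BHom R S N N') (h : BHom S L P P')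
    (t : BTensor R M (BTensor S N P)) :
    (BTensor.assoc R S M' N' P').symm (tmap f (tmap g h) t) =
      tmap (tmap f g) h ((BTensor.assoc R S M N P).symm t) := by
  rw [AddEquiv.symm_apply_eq, assoc_tmap, AddEquiv.apply_symm_apply]

/-- Injectivity of `M ⊗ f ⊗ P` does not depend on the bracketing. -/
theorem tmap_tmap_injective_iff (f : BHom K R M M') (g : BHom R S N N') (h : BHom S L P P') :
    Function.Injective (tmap (tmap f g) h) ↔ Function.Injective (tmap f (tmap g h)) := by
  have e : ⇑(tmap f (tmap g h)) =
      BTensor.assoc R S M' N' P' ∘ tmap (tmap f g) h ∘ (BTensor.assoc R S M N P).symm := by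
    funext t
    simp [assoc_tmap]
  rw [e, EquivLike.comp_injective, EquivLike.injective_comp]

end Assoc

end BHom

/-! ### Actions as bimodule maps -/

section Actions

variable {R S A B K L M N : Type*} [Ring R] [Ring S] [Ring A] [Ring B] [RingMap R A] [Ring K]
  [Ring L] [AddCommGroup M] [AddCommGroup N]

namespace Restriction

-- Restriction of scalars passes to a tensor product through its outer factor. This makes `T' ⊗_S T`
-- an `A`-module and `T ⊗_R C` a `B`-module in a way compatible with `R` and `S`.
scoped instance [Module A M] [Module R M] [LeftRestricted R A M] [Module Sᵐᵒᵖ M]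
    [SMulCommClass A Sᵐᵒᵖ M] [SMulCommClass R Sᵐᵒᵖ M] [Module S N] : LeftRestricted R A (BTensor S M N) where
  smul_eq r t := by
    induction t using BTensor.induction_on with
    | zero => simp
    | simple m n => simp [LeftRestricted.smul_eq (A := A) r m]
    | add a b ha hb => rw [smul_add, smul_add, ha, hb]

scoped instance [Module Aᵐᵒᵖ N] [Module Rᵐᵒᵖ N] [RightRestricted R A N] [Module S N]
    [SMulCommClass S Aᵐᵒᵖ N] [SMulCommClass S Rᵐᵒᵖ N] [Module Sᵐᵒᵖ M] :
    RightRestricted R A (BTensor S M N) where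
  op_smul_eq r t := by
    induction t using BTensor.induction_on with
    | zero => simp
    | simple m n => simp [RightRestricted.op_smul_eq (A := A) r n]
    | add a b ha hb => rw [smul_add, smul_add, ha, hb]

end Restriction

open Restriction

@[simp] theorem leftAct_tmul [Module A M] [Module R M] [LeftRestricted R A M] (a : A) (m : M) :
    leftAct R A M (BTensor.tmul R a m) = a • m := by
  simp [leftAct]

@[simp] theorem rightAct_tmul [Module Aᵐᵒᵖ M] [Module Rᵐᵒᵖ M] [RightRestricted R A M] (m : M)
    (a : A) : rightAct R A M (BTensor.tmul R m a) = op a • m := by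
  simp [rightAct]

@[simp] theorem mulMap_tmul (a b : A) : mulMap R A (BTensor.tmul R a b) = a * b :=
  mulAux_tmul a b

variable (R A L M) in
/-- The left action `A ⊗_R M → M` as a map of bimodules. -/
def lact [Module A M] [Module R M] [LeftRestricted R A M] [Module Lᵐᵒᵖ M] [SMulCommClass A Lᵐᵒᵖ M]
    [SMulCommClass R Lᵐᵒᵖ M] : BHom R L (BTensor R A M) M where
  toAddMonoidHom := (leftAct R A M).toAddMonoidHom
  map_smul' r t := map_smul (leftAct R A M) r t
  map_op_smul' l t := by
    change leftAct R A M (op l • t) = op l • leftAct R A M t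
    induction t using BTensor.induction_on with
    | zero => simp
    | simple a m => simp [smul_comm]
    | add a b ha hb => simp only [smul_add, map_add, ha, hb]

@[simp] theorem lact_tmul [Module A M] [Module R M] [LeftRestricted R A M] [Module Lᵐᵒᵖ M]
    [SMulCommClass A Lᵐᵒᵖ M] [SMulCommClass R Lᵐᵒᵖ M] (a : A) (m : M) :
    lact R A L M (BTensor.tmul R a m) = a • m :=
  leftAct_tmul a m

variable (R A K M) in
/-- The right action `M ⊗_R A → M` as a map of bimodules. -/
def ract [Module Aᵐᵒᵖ M] [Module Rᵐᵒᵖ M] [RightRestricted R A M] [Module K M]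
    [SMulCommClass K Aᵐᵒᵖ M] [SMulCommClass K Rᵐᵒᵖ M] : BHom K R (BTensor R M A) M where
  toAddMonoidHom := (rightAct R A M).toAddMonoidHom
  map_smul' k t := by
    change rightAct R A M (k • t) = k • rightAct R A M t
    induction t using BTensor.induction_on with
    | zero => simp
    | simple m a => simp [smul_comm]
    | add a b ha hb => simp only [smul_add, map_add, ha, hb]
  map_op_smul' r t := map_smul (rightAct R A M) (op r) t

@[simp] theorem ract_tmul [Module Aᵐᵒᵖ M] [Module Rᵐᵒᵖ M] [RightRestricted R A M] [Module K M]
    [SMulCommClass K Aᵐᵒᵖ M] [SMulCommClass K Rᵐᵒᵖ M] (m : M) (a : A) :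
    ract R A K M (BTensor.tmul R m a) = op a • m :=
  rightAct_tmul m a

variable (R A) in
/-- The ring map `R → A` as a map of `R`-bimodules. -/
def unitMap : BHom R R R A where
  toFun r := RingMap.hom r
  map_zero' := map_zero _
  map_add' := map_add _
  map_smul' r s := map_mul _ r s
  map_op_smul' r s := map_mul _ s r

theorem unitMap_apply (r : R) : unitMap R A r = RingMap.hom r := rfl

@[simp] theorem unitMap_one : unitMap R A 1 = 1 := map_one (RingMap.hom : R →+* A)

variable (R A L M) in
/-- The map `m ↦ 1 ⊗ m`. -/
def oneTmul [Module R M] [Module Lᵐᵒᵖ M] [SMulCommClass R Lᵐᵒᵖ M] :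
    BHom R L M (BTensor R A M) where
  toAddMonoidHom := BTensor.mk R A M 1
  map_smul' r t := by
    change BTensor.tmul R 1 (r • t) = r • BTensor.tmul R 1 t
    rw [← BTensor.smul_tmul, BTensor.smul_tmul', RingMap.smul_def, RingMap.op_smul_def,
      one_mul, mul_one]
  map_op_smul' r t := (BTensor.op_smul_tmul (op r) (1 : A) t).symm

@[simp] theorem oneTmul_apply [Module R M] [Module Lᵐᵒᵖ M] [SMulCommClass R Lᵐᵒᵖ M] (m : M) :
    oneTmul R A L M m = BTensor.tmul R 1 m := rfl

variable (R A K M) in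
/-- The map `m ↦ m ⊗ 1`. -/
def tmulOne [Module K M] [Module Rᵐᵒᵖ M] [SMulCommClass K Rᵐᵒᵖ M] :
    BHom K R M (BTensor R M A) where
  toAddMonoidHom := (BTensor.mk R M A).flip 1
  map_smul' r t := (BTensor.smul_tmul' r t (1 : A)).symm
  map_op_smul' r t := by
    change BTensor.tmul R (op r • t) 1 = op r • BTensor.tmul R t 1
    rw [BTensor.smul_tmul, BTensor.op_smul_tmul, RingMap.smul_def, RingMap.op_smul_def,
      one_mul, mul_one]

@[simp] theorem tmulOne_apply [Module K M] [Module Rᵐᵒᵖ M] [SMulCommClass K Rᵐᵒᵖ M] (m : M) :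
    tmulOne R A K M m = BTensor.tmul R m 1 := rfl

end Actions

open Restriction

/-! ### Consequences of flatness -/

namespace RightFaithfullyFlat

variable {R S L T X Y Z N : Type u} [Ring R] [Ring S] [Ring L] [AddCommGroup T] [Module S T]
  [Module Rᵐᵒᵖ T] [SMulCommClass S Rᵐᵒᵖ T]
  [AddCommGroup X] [Module R X] [Module Lᵐᵒᵖ X] [SMulCommClass R Lᵐᵒᵖ X]
  [AddCommGroup Y] [Module R Y] [Module Lᵐᵒᵖ Y] [SMulCommClass R Lᵐᵒᵖ Y]
  [AddCommGroup Z] [Module R Z] [Module Lᵐᵒᵖ Z] [SMulCommClass R Lᵐᵒᵖ Z]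

/-- Faithful flatness applied to `f` and `g₁ - g₂`: exactness at `Y` says that the image of `f` is
the equaliser of `g₁` and `g₂`. Injectivity of `f` is a separate matter, treated in `injective_iff`.
-/
theorem exact_iff (hT : RightFaithfullyFlat R T) (f : BHom R L X Y) (g₁ g₂ : BHom R L Y Z) :
    (∀ y, g₁ y = g₂ y ↔ ∃ x, f x = y) ↔
      ∀ t, (BHom.id S R T).tmap g₁ t = (BHom.id S R T).tmap g₂ t ↔
        ∃ s, (BHom.id S R T).tmap f s = t := by
  have h := hT X Y Z f.l (g₁.l - g₂.l)
  have e : ∀ t, BTensor.map (LinearMap.id : T →ₗ[Rᵐᵒᵖ] T) (g₁.l - g₂.l) t =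
      (BHom.id S R T).tmap g₁ t - (BHom.id S R T).tmap g₂ t := by
    intro t
    induction t using BTensor.induction_on with
    | zero => simp
    | simple m n =>
      simp only [BTensor.map_tmul, BHom.tmap_tmul, LinearMap.sub_apply, BHom.l_apply,
        BHom.id_apply, LinearMap.id_apply]
      exact map_sub (BTensor.mk R T Z m) _ _
    | add a b ha hb => rw [map_add, map_add, map_add, ha, hb]; abel
  have h₁ : Function.Exact f.l (g₁.l - g₂.l) ↔ ∀ y, g₁ y = g₂ y ↔ ∃ x, f x = y :=
    forall_congr' fun y => by
      rw [LinearMap.sub_apply, sub_eq_zero]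
      rfl
  rw [← h₁, h]
  refine forall_congr' fun t => ?_
  rw [e, sub_eq_zero]
  rfl

/-- Injectivity is exactness of `0 → X → Y` at `X`, with `PUnit` as the zero module. The zero map
remains zero after `T ⊗_R -`. -/
theorem injective_iff (hT : RightFaithfullyFlat R T) (f : BHom R L X Y) :
    Function.Injective f ↔ Function.Injective ((BHom.id S R T).tmap f) := by
  have h := hT PUnit.{u + 1} X Y (0 : PUnit.{u + 1} →ₗ[R] X) f.l
  have e : ∀ t, BTensor.map (LinearMap.id : T →ₗ[Rᵐᵒᵖ] T) (0 : PUnit.{u + 1} →ₗ[R] X) t = 0 := by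
    intro t
    induction t using BTensor.induction_on with
    | zero => simp
    | simple m n => simp
    | add a b ha hb => rw [map_add, ha, hb, add_zero]
  rw [injective_iff_map_eq_zero, injective_iff_map_eq_zero]
  have h₁ : Function.Exact (0 : PUnit.{u + 1} →ₗ[R] X) f.l ↔ ∀ a, f a = 0 → a = 0 := by
    refine forall_congr' fun y => ⟨fun h hy => ?_, fun h => ⟨fun hy => ⟨0, (h hy).symm⟩, ?_⟩⟩
    · obtain ⟨x, hx⟩ := h.1 hy
      exact hx.symm
    · rintro ⟨x, rfl⟩
      exact map_zero f
  rw [← h₁, h]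
  refine forall_congr' fun y => ⟨fun h hy => ?_, fun h => ⟨fun hy => ⟨0, ?_⟩, ?_⟩⟩
  · obtain ⟨x, hx⟩ := h.1 hy
    rw [← hx, e]
  · rw [h hy, map_zero]
  · rintro ⟨x, rfl⟩
    rw [e, map_zero]

/-- A fork that splits after applying `T ⊗_R -` is an equaliser. -/
theorem equaliser_of_split (hT : RightFaithfullyFlat R T) (f : BHom R L X Y)
    (g₁ g₂ : BHom R L Y Z)
    (p : BHom S L (BTensor R T Y) (BTensor R T X)) (q : BHom S L (BTensor R T Z) (BTensor R T Y))
    (hp : ∀ t, p ((BHom.id S R T).tmap f t) = t) (hq₁ : ∀ t, q ((BHom.id S R T).tmap g₁ t) = t)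
    (hq₂ : ∀ t, q ((BHom.id S R T).tmap g₂ t) = (BHom.id S R T).tmap f (p t))
    (hf : ∀ x, g₁ (f x) = g₂ (f x)) :
    Function.Injective f ∧ ∀ y, g₁ y = g₂ y → ∃ x, f x = y := by
  refine ⟨(injective_iff (S := S) hT f).2 (Function.LeftInverse.injective hp), fun y hy =>
    ((exact_iff (S := S) hT f g₁ g₂).2 (fun t => ⟨fun ht => ⟨p t, ?_⟩, ?_⟩) y).1 hy⟩
  -- The element `t` is the image of `p t`: `f (p t) = q (g₂ t) = q (g₁ t) = t`.
  · rw [← hq₂, ← ht, hq₁]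
  · rintro ⟨s, rfl⟩
    rw [BHom.tmap_tmap, BHom.tmap_tmap]
    exact BHom.tmap_congr (fun _ => rfl) hf s

variable {L' : Type u} [Ring L'] [AddCommGroup N] [Module L N] [Module L'ᵐᵒᵖ N]
  [SMulCommClass L L'ᵐᵒᵖ N]

/-- A fork that splits after applying `T ⊗_R -` is a universal equaliser. -/
theorem equaliser_tmap_of_split (hT : RightFaithfullyFlat R T) (f : BHom R L X Y)
    (g₁ g₂ : BHom R L Y Z)
    (p : BHom S L (BTensor R T Y) (BTensor R T X)) (q : BHom S L (BTensor R T Z) (BTensor R T Y))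
    (hp : ∀ t, p ((BHom.id S R T).tmap f t) = t) (hq₁ : ∀ t, q ((BHom.id S R T).tmap g₁ t) = t)
    (hq₂ : ∀ t, q ((BHom.id S R T).tmap g₂ t) = (BHom.id S R T).tmap f (p t))
    (hf : ∀ x, g₁ (f x) = g₂ (f x)) :
    Function.Injective (f.tmap (BHom.id L L' N)) ∧
      ∀ y, g₁.tmap (BHom.id L L' N) y = g₂.tmap (BHom.id L L' N) y →
        ∃ x, f.tmap (BHom.id L L' N) x = y := by
  -- Up to bracketing, `p ⊗ N` and `q ⊗ N` split the fork tensored with `N`. This is why nothing is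
  -- assumed about `N`.
  refine equaliser_of_split hT _ _ _
    ((BHom.assoc S L' R L T X N).comp
      ((p.tmap (BHom.id L L' N)).comp (BHom.assocSymm S L' R L T Y N)))
    ((BHom.assoc S L' R L T Y N).comp
      ((q.tmap (BHom.id L L' N)).comp (BHom.assocSymm S L' R L T Z N))) ?_ ?_ ?_ ?_
  · intro t
    simp only [BHom.comp_apply, BHom.assoc_apply, BHom.assocSymm_apply, BHom.assoc_symm_tmap,
      BHom.tmap_tmap]
    rw [BHom.tmap_eq_self (fun t => hp t) (fun _ => rfl), AddEquiv.apply_symm_apply]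
  · intro t
    simp only [BHom.comp_apply, BHom.assoc_apply, BHom.assocSymm_apply, BHom.assoc_symm_tmap,
      BHom.tmap_tmap]
    rw [BHom.tmap_eq_self (fun t => hq₁ t) (fun _ => rfl), AddEquiv.apply_symm_apply]
  · intro t
    simp only [BHom.comp_apply, BHom.assoc_apply, BHom.assocSymm_apply, BHom.assoc_symm_tmap,
      BHom.tmap_tmap, ← BHom.assoc_tmap]
    exact congrArg _ (BHom.tmap_congr (fun t => hq₂ t) (fun _ => rfl) _)
  · intro t
    simp only [BHom.tmap_tmap]
    exact BHom.tmap_congr hf (fun _ => rfl) _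

end RightFaithfullyFlat

namespace LeftFaithfullyFlat

variable {R S L T X Y Z N : Type u} [Ring R] [Ring S] [Ring L] [AddCommGroup T] [Module S T]
  [Module Rᵐᵒᵖ T] [SMulCommClass S Rᵐᵒᵖ T]
  [AddCommGroup X] [Module L X] [Module Sᵐᵒᵖ X] [SMulCommClass L Sᵐᵒᵖ X]
  [AddCommGroup Y] [Module L Y] [Module Sᵐᵒᵖ Y] [SMulCommClass L Sᵐᵒᵖ Y]
  [AddCommGroup Z] [Module L Z] [Module Sᵐᵒᵖ Z] [SMulCommClass L Sᵐᵒᵖ Z]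

theorem exact_iff (hT : LeftFaithfullyFlat S T) (f : BHom L S X Y) (g₁ g₂ : BHom L S Y Z) :
    (∀ y, g₁ y = g₂ y ↔ ∃ x, f x = y) ↔
      ∀ t, g₁.tmap (BHom.id S R T) t = g₂.tmap (BHom.id S R T) t ↔
        ∃ s, f.tmap (BHom.id S R T) s = t := by
  have h := hT X Y Z f.r (g₁.r - g₂.r)
  have e : ∀ t, BTensor.map (g₁.r - g₂.r) (LinearMap.id : T →ₗ[S] T) t =
      g₁.tmap (BHom.id S R T) t - g₂.tmap (BHom.id S R T) t := by
    intro t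
    induction t using BTensor.induction_on with
    | zero => simp
    | simple m n =>
      simp only [BTensor.map_tmul, BHom.tmap_tmul, LinearMap.sub_apply, BHom.r_apply,
        BHom.id_apply, LinearMap.id_apply]
      exact map_sub ((BTensor.mk S Z T).flip n) _ _
    | add a b ha hb => rw [map_add, map_add, map_add, ha, hb]; abel
  have h₁ : Function.Exact f.r (g₁.r - g₂.r) ↔ ∀ y, g₁ y = g₂ y ↔ ∃ x, f x = y :=
    forall_congr' fun y => by
      rw [LinearMap.sub_apply, sub_eq_zero]
      rfl
  rw [← h₁, h]
  refine forall_congr' fun t => ?_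
  rw [e, sub_eq_zero]
  rfl

theorem injective_iff (hT : LeftFaithfullyFlat S T) (f : BHom L S X Y) :
    Function.Injective f ↔ Function.Injective (f.tmap (BHom.id S R T)) := by
  have h := hT PUnit.{u + 1} X Y (0 : PUnit.{u + 1} →ₗ[Sᵐᵒᵖ] X) f.r
  have e : ∀ t, BTensor.map (0 : PUnit.{u + 1} →ₗ[Sᵐᵒᵖ] X) (LinearMap.id : T →ₗ[S] T) t = 0 := by
    intro t
    induction t using BTensor.induction_on with
    | zero => simp
    | simple m n => simp
    | add a b ha hb => rw [map_add, ha, hb, add_zero]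
  rw [injective_iff_map_eq_zero, injective_iff_map_eq_zero]
  have h₁ : Function.Exact (0 : PUnit.{u + 1} →ₗ[Sᵐᵒᵖ] X) f.r ↔ ∀ a, f a = 0 → a = 0 := by
    refine forall_congr' fun y => ⟨fun h hy => ?_, fun h => ⟨fun hy => ⟨0, (h hy).symm⟩, ?_⟩⟩
    · obtain ⟨x, hx⟩ := h.1 hy
      exact hx.symm
    · rintro ⟨x, rfl⟩
      exact map_zero f
  rw [← h₁, h]
  refine forall_congr' fun y => ⟨fun h hy => ?_, fun h => ⟨fun hy => ⟨0, ?_⟩, ?_⟩⟩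
  · obtain ⟨x, hx⟩ := h.1 hy
    rw [← hx, e]
  · rw [h hy, map_zero]
  · rintro ⟨x, rfl⟩
    rw [e, map_zero]

/-- A fork that splits after applying `- ⊗_S T` is an equaliser. -/
theorem equaliser_of_split (hT : LeftFaithfullyFlat S T) (f : BHom L S X Y)
    (g₁ g₂ : BHom L S Y Z)
    (p : BHom L R (BTensor S Y T) (BTensor S X T)) (q : BHom L R (BTensor S Z T) (BTensor S Y T))
    (hp : ∀ t, p (f.tmap (BHom.id S R T) t) = t) (hq₁ : ∀ t, q (g₁.tmap (BHom.id S R T) t) = t)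
    (hq₂ : ∀ t, q (g₂.tmap (BHom.id S R T) t) = f.tmap (BHom.id S R T) (p t))
    (hf : ∀ x, g₁ (f x) = g₂ (f x)) :
    Function.Injective f ∧ ∀ y, g₁ y = g₂ y → ∃ x, f x = y := by
  refine ⟨(injective_iff (R := R) hT f).2 (Function.LeftInverse.injective hp), fun y hy =>
    ((exact_iff (R := R) hT f g₁ g₂).2 (fun t => ⟨fun ht => ⟨p t, ?_⟩, ?_⟩) y).1 hy⟩
  · rw [← hq₂, ← ht, hq₁]
  · rintro ⟨s, rfl⟩
    rw [BHom.tmap_tmap, BHom.tmap_tmap]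
    exact BHom.tmap_congr hf (fun _ => rfl) s

variable {L' : Type u} [Ring L'] [AddCommGroup N] [Module L' N] [Module Lᵐᵒᵖ N]
  [SMulCommClass L' Lᵐᵒᵖ N]

/-- A fork that splits after applying `- ⊗_S T` is a universal equaliser. -/
theorem equaliser_tmap_of_split (hT : LeftFaithfullyFlat S T) (f : BHom L S X Y)
    (g₁ g₂ : BHom L S Y Z)
    (p : BHom L R (BTensor S Y T) (BTensor S X T)) (q : BHom L R (BTensor S Z T) (BTensor S Y T))
    (hp : ∀ t, p (f.tmap (BHom.id S R T) t) = t) (hq₁ : ∀ t, q (g₁.tmap (BHom.id S R T) t) = t)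
    (hq₂ : ∀ t, q (g₂.tmap (BHom.id S R T) t) = f.tmap (BHom.id S R T) (p t))
    (hf : ∀ x, g₁ (f x) = g₂ (f x)) :
    Function.Injective ((BHom.id L' L N).tmap f) ∧
      ∀ y, (BHom.id L' L N).tmap g₁ y = (BHom.id L' L N).tmap g₂ y →
        ∃ x, (BHom.id L' L N).tmap f x = y := by
  refine equaliser_of_split hT _ _ _
    ((BHom.assocSymm L' R L S N X T).comp
      (((BHom.id L' L N).tmap p).comp (BHom.assoc L' R L S N Y T)))
    ((BHom.assocSymm L' R L S N Y T).comp
      (((BHom.id L' L N).tmap q).comp (BHom.assoc L' R L S N Z T))) ?_ ?_ ?_ ?_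
  · intro t
    simp only [BHom.comp_apply, BHom.assoc_apply, BHom.assocSymm_apply, BHom.assoc_tmap,
      BHom.tmap_tmap]
    rw [BHom.tmap_eq_self (fun _ => rfl) (fun t => hp t), AddEquiv.symm_apply_apply]
  · intro t
    simp only [BHom.comp_apply, BHom.assoc_apply, BHom.assocSymm_apply, BHom.assoc_tmap,
      BHom.tmap_tmap]
    rw [BHom.tmap_eq_self (fun _ => rfl) (fun t => hq₁ t), AddEquiv.symm_apply_apply]
  · intro t
    simp only [BHom.comp_apply, BHom.assoc_apply, BHom.assocSymm_apply, BHom.assoc_tmap,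
      BHom.tmap_tmap, ← BHom.assoc_symm_tmap]
    exact congrArg _ (BHom.tmap_congr (fun _ => rfl) (fun t => hq₂ t) _)
  · intro t
    simp only [BHom.tmap_tmap]
    exact BHom.tmap_congr (fun _ => rfl) hf _

end LeftFaithfullyFlat

/-! ### Evaluations and absorption of scalars -/

namespace FormalDual

variable {P : BimodulePair.{u}} (F : FormalDual P)

@[simp] theorem evR_apply (t : P.T'T) : F.evR t = F.ev t := rfl

@[simp] theorem ev'S_apply (t : P.TT') : F.ev'S t = F.ev' t := rfl

end FormalDual

namespace BimodulePair

variable (P : BimodulePair.{u})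

@[simp] theorem ζC_apply (t : P.T'T) : P.ζC t = BTensor.tmul P.R 1 t := rfl

@[simp] theorem ζD_apply (t : P.TT') : P.ζD t = BTensor.tmul P.S t 1 := rfl

/-- The map `x ⊗ a ⊗ t ↦ x a ⊗ t`. -/
def absorbRight : BHom P.S P.R (BTensor P.R P.T (BTensor P.R P.A P.T'T)) P.TT'T :=
  ((ract P.R P.A P.S P.T).tmap (BHom.id P.R P.R P.T'T)).comp
    (BHom.assocSymm P.S P.R P.R P.R P.T P.A P.T'T)

@[simp] theorem absorbRight_tmul (x : P.T) (a : P.A) (t : P.T'T) :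
    P.absorbRight (BTensor.tmul P.R x (BTensor.tmul P.R a t)) = BTensor.tmul P.R (op a • x) t := by
  simp [absorbRight]

/-- The map `t ⊗ b ⊗ y ↦ t ⊗ b y`. -/
def absorbLeft : BHom P.S P.R (BTensor P.S (BTensor P.S P.TT' P.B) P.T) (BTensor P.S P.TT' P.T) :=
  ((BHom.id P.S P.S P.TT').tmap (lact P.S P.B P.R P.T)).comp
    (BHom.assoc P.S P.R P.S P.S P.TT' P.B P.T)

@[simp] theorem absorbLeft_tmul (t : P.TT') (b : P.B) (y : P.T) :
    P.absorbLeft (BTensor.tmul P.S (BTensor.tmul P.S t b) y) = BTensor.tmul P.S t (b • y) := by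
  simp [absorbLeft]

end BimodulePair

namespace BimoduleHerd

variable {P : BimodulePair.{u}} {F : FormalDual P} (H : BimoduleHerd F)

/-! ### The coaction of `C` on `T` -/

theorem γr_tmul (x' : P.T') (y : P.T) : H.γr (BTensor.tmul P.S x' y) =
    (BTensor.assoc P.S P.R P.T' P.T P.T'T).symm (BTensor.tmul P.S x' (H.γ y)) := by
  simp [γr]

theorem ξC_apply (t : P.T'T) : H.ξC t = F.evR.tmap (BHom.id P.R P.R P.T'T) (H.γr t) := rfl

/-- The triangle identity `x ev(x' ⊗ y) = ev'(x ⊗ x') y`, applied to the first leg of `u`. -/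
theorem absorbRight_evR (x : P.T) (x' : P.T') (u : P.TT'T) :
    P.absorbRight (BTensor.tmul P.R x (F.evR.tmap (BHom.id P.R P.R P.T'T)
      ((BTensor.assoc P.S P.R P.T' P.T P.T'T).symm (BTensor.tmul P.S x' u)))) =
      F.ev' (BTensor.tmul P.R x x') • u := by
  induction u using BTensor.induction_on with
  | zero => simp
  | simple m n => simp [F.triangle]
  | add a b ha hb => simp only [BTensor.tmul_add, map_add, smul_add, ha, hb]

/-- This formula yields the splitting of the fork that defines `C`, and later the compatibility of
`γ` with the action of `A`. -/
theorem absorbRight_ξC (x : P.T) (x' : P.T') (y : P.T) :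
    P.absorbRight (BTensor.tmul P.R x (H.ξC (BTensor.tmul P.S x' y))) =
      F.ev' (BTensor.tmul P.R x x') • H.γ y := by
  rw [ξC_apply, γr_tmul, absorbRight_evR]

/-- The shepherd as a map `T → (T ⊗_R T') ⊗_S T`. -/
def γL : BHom P.S P.R P.T (BTensor P.S P.TT' P.T) :=
  (BHom.assocSymm P.S P.R P.R P.S P.T P.T' P.T).comp H.γ

theorem γL_apply (x : P.T) : H.γL x = (BTensor.assoc P.R P.S P.T P.T' P.T).symm (H.γ x) := rfl

theorem assoc_γL (x : P.T) : BTensor.assoc P.R P.S P.T P.T' P.T (H.γL x) = H.γ x :=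
  AddEquiv.apply_symm_apply _ _

theorem id_tmap_evR_γ (x : P.T) :
    (BHom.id P.S P.R P.T).tmap F.evR (H.γ x) = BTensor.tmul P.R x 1 := H.unit_right x

theorem ev'S_tmap_id_γL (x : P.T) :
    F.ev'S.tmap (BHom.id P.S P.R P.T) (H.γL x) = BTensor.tmul P.S 1 x := H.unit_left x

/-- Coassociativity with all brackets to the left, the form needed for `D`. The map `E` takes the
fully right-bracketed fivefold tensor product to the left-bracketed one, and both sides are images
under `E` of the two sides of `H.coassoc`. -/
theorem γL_coassoc (x : P.T) :
    (BHom.assocSymm P.S P.S P.S P.R P.TT' P.T P.T').tmap (BHom.id P.S P.R P.T)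
      ((BTensor.assoc P.S P.S P.TT' P.TT' P.T).symm ((BHom.id P.S P.S P.TT').tmap H.γL (H.γL x))) =
    (H.γL.tmap (BHom.id P.R P.S P.T')).tmap (BHom.id P.S P.R P.T) (H.γL x) := by
  let E : BHom P.S P.R (BTensor P.R P.T (BTensor P.S P.T' P.TT'T))
      (BTensor P.S (BTensor P.R (BTensor P.S P.TT' P.T) P.T') P.T) :=
    ((BHom.assocSymm P.S P.S P.S P.R P.TT' P.T P.T').tmap (BHom.id P.S P.R P.T)).comp
      ((BHom.assocSymm P.S P.R P.S P.S P.TT' P.TT' P.T).comp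
        (((BHom.id P.S P.S P.TT').tmap (BHom.assocSymm P.S P.R P.R P.S P.T P.T' P.T)).comp
          (BHom.assocSymm P.S P.R P.R P.S P.T P.T' P.TT'T)))
  have h₁ : ∀ u : P.TT'T, E ((BHom.id P.S P.R P.T).tmap ((BHom.id P.R P.S P.T').tmap H.γ) u) =
      (BHom.assocSymm P.S P.S P.S P.R P.TT' P.T P.T').tmap (BHom.id P.S P.R P.T)
        ((BTensor.assoc P.S P.S P.TT' P.TT' P.T).symm ((BHom.id P.S P.S P.TT').tmap H.γL
          ((BTensor.assoc P.R P.S P.T P.T' P.T).symm u))) := by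
    intro u
    induction u using BTensor.induction_on_right with
    | zero => simp
    | simple x x' y => simp [E, γL]
    | add a b ha hb => simp only [map_add, ha, hb]
  have h₃ : ∀ (v : P.TT'T) (x' : P.T') (y : P.T),
      E ((BHom.id P.S P.R P.T).tmap (BHom.assoc P.R P.R P.S P.R P.T' P.T P.T'T)
        (BTensor.assoc P.R P.R P.T P.T'T P.T'T (BTensor.tmul P.R v (BTensor.tmul P.S x' y)))) =
      BTensor.tmul P.S (BTensor.tmul P.R ((BTensor.assoc P.R P.S P.T P.T' P.T).symm v) x') y := by
    intro v x' y
    induction v using BTensor.induction_on_right with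
    | zero => simp
    | simple x x' y => simp [E]
    | add a b ha hb => simp only [BTensor.add_tmul, map_add, ha, hb]
  have h₂ : ∀ u : P.TT'T, E ((BHom.id P.S P.R P.T).tmap (BHom.assoc P.R P.R P.S P.R P.T' P.T P.T'T)
      (BTensor.assoc P.R P.R P.T P.T'T P.T'T (H.γ.tmap (BHom.id P.R P.R P.T'T) u))) =
      (H.γL.tmap (BHom.id P.R P.S P.T')).tmap (BHom.id P.S P.R P.T)
        ((BTensor.assoc P.R P.S P.T P.T' P.T).symm u) := by
    intro u
    induction u using BTensor.induction_on_right with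
    | zero => simp
    | simple x x' y => simp [h₃, γL_apply]
    | add a b ha hb => simp only [map_add, ha, hb]
  rw [γL_apply, ← h₁, ← h₂, H.coassoc]

/-- By coassociativity, applying `ξC` to the last two legs of `γ x` amounts to applying `(T ⊗ ev) ∘
γ` to the first leg. The unit law `unit_right` replaces that leg by `y ⊗ 1`. -/
theorem γ_mem (x : P.T) : (BHom.id P.S P.R P.T).tmap H.ξC (H.γ x) =
    (BHom.id P.S P.R P.T).tmap P.ζC (H.γ x) := by
  have h₁ : (BHom.id P.S P.R P.T).tmap H.ξC (H.γ x) =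
      (BHom.id P.S P.R P.T).tmap ((F.evR.tmap (BHom.id P.R P.R P.T'T)).comp
        (BHom.assocSymm P.R P.R P.S P.R P.T' P.T P.T'T))
          ((BHom.id P.S P.R P.T).tmap ((BHom.id P.R P.S P.T').tmap H.γ) (H.γ x)) := by
    rw [BHom.tmap_tmap]
    exact BHom.tmap_congr (fun _ => rfl) (fun _ => rfl) _
  have h₂ : ∀ u : BTensor P.R P.TT'T P.T'T,
      (BHom.id P.S P.R P.T).tmap ((F.evR.tmap (BHom.id P.R P.R P.T'T)).comp
        (BHom.assocSymm P.R P.R P.S P.R P.T' P.T P.T'T))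
          ((BHom.id P.S P.R P.T).tmap (BHom.assoc P.R P.R P.S P.R P.T' P.T P.T'T)
            (BTensor.assoc P.R P.R P.T P.T'T P.T'T u)) =
      BTensor.assoc P.R P.R P.T P.A P.T'T
        (((BHom.id P.S P.R P.T).tmap F.evR).tmap (BHom.id P.R P.R P.T'T) u) := by
    intro u
    rw [BHom.assoc_tmap, BHom.tmap_tmap]
    exact BHom.tmap_congr (fun _ => rfl) (fun t => by simp) _
  have h₃ : ∀ u : P.TT'T, BTensor.assoc P.R P.R P.T P.A P.T'T
      ((tmulOne P.R P.A P.S P.T).tmap (BHom.id P.R P.R P.T'T) u) =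
      (BHom.id P.S P.R P.T).tmap P.ζC u := by
    intro u
    induction u using BTensor.induction_on with
    | zero => simp
    | simple m n => simp
    | add a b ha hb => simp only [map_add, ha, hb]
  rw [h₁, ← H.coassoc, h₂, BHom.tmap_tmap, ← h₃]
  exact congrArg _ (BHom.tmap_congr (fun y => H.id_tmap_evR_γ y) (fun _ => rfl) _)

theorem γl_tmul (y : P.T) (x' : P.T') : H.γl (BTensor.tmul P.R y x') =
    BTensor.assoc P.S P.R P.TT' P.T P.T' (BTensor.tmul P.R (H.γL y) x') := by
  simp [γl, γL]

theorem ξD_apply (t : P.TT') : H.ξD t = (BHom.id P.S P.S P.TT').tmap F.ev'S (H.γl t) := rfl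

theorem absorbLeft_ev'S (x' : P.T') (y : P.T) (u : BTensor P.S P.TT' P.T) :
    P.absorbLeft (BTensor.tmul P.S ((BHom.id P.S P.S P.TT').tmap F.ev'S
      (BTensor.assoc P.S P.R P.TT' P.T P.T' (BTensor.tmul P.R u x'))) y) =
      op (F.ev (BTensor.tmul P.S x' y)) • u := by
  induction u using BTensor.induction_on with
  | zero => simp
  | simple m n => simp [F.triangle]
  | add a b ha hb => simp only [BTensor.add_tmul, map_add, smul_add, ha, hb]

theorem absorbLeft_ξD (x : P.T) (x' : P.T') (y : P.T) :
    P.absorbLeft (BTensor.tmul P.S (H.ξD (BTensor.tmul P.R x x')) y) =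
      op (F.ev (BTensor.tmul P.S x' y)) • H.γL x := by
  rw [ξD_apply, γl_tmul, absorbLeft_ev'S]

/-- Mirror image of `γ_mem`, with `unit_left` in place of `unit_right`. -/
theorem γL_mem (x : P.T) : H.ξD.tmap (BHom.id P.S P.R P.T) (H.γL x) =
    P.ζD.tmap (BHom.id P.S P.R P.T) (H.γL x) := by
  have h₁ : H.ξD.tmap (BHom.id P.S P.R P.T) (H.γL x) =
      (((BHom.id P.S P.S P.TT').tmap F.ev'S).comp
        (BHom.assoc P.S P.S P.S P.R P.TT' P.T P.T')).tmap (BHom.id P.S P.R P.T)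
          ((H.γL.tmap (BHom.id P.R P.S P.T')).tmap (BHom.id P.S P.R P.T) (H.γL x)) := by
    rw [BHom.tmap_tmap]
    exact BHom.tmap_congr (fun _ => rfl) (fun _ => rfl) _
  have h₂ : ∀ u : BTensor P.S P.TT' (BTensor P.S P.TT' P.T),
      (((BHom.id P.S P.S P.TT').tmap F.ev'S).comp
        (BHom.assoc P.S P.S P.S P.R P.TT' P.T P.T')).tmap (BHom.id P.S P.R P.T)
          ((BHom.assocSymm P.S P.S P.S P.R P.TT' P.T P.T').tmap (BHom.id P.S P.R P.T)
            ((BTensor.assoc P.S P.S P.TT' P.TT' P.T).symm u)) =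
      (BTensor.assoc P.S P.S P.TT' P.B P.T).symm
        ((BHom.id P.S P.S P.TT').tmap (F.ev'S.tmap (BHom.id P.S P.R P.T)) u) := by
    intro u
    rw [BHom.assoc_symm_tmap, BHom.tmap_tmap]
    exact BHom.tmap_congr (fun t => by simp) (fun _ => rfl) _
  have h₃ : ∀ u : BTensor P.S P.TT' P.T, (BTensor.assoc P.S P.S P.TT' P.B P.T).symm
      ((BHom.id P.S P.S P.TT').tmap (oneTmul P.S P.B P.R P.T) u) =
      P.ζD.tmap (BHom.id P.S P.R P.T) u := by
    intro u
    induction u using BTensor.induction_on with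
    | zero => simp
    | simple m n => simp
    | add a b ha hb => simp only [map_add, ha, hb]
  rw [h₁, ← H.γL_coassoc, h₂, BHom.tmap_tmap, ← h₃]
  exact congrArg _ (BHom.tmap_congr (fun _ => rfl) (fun y => H.ev'S_tmap_id_γL y) _)

theorem ιC_injective : Function.Injective H.ιC := Subtype.val_injective

theorem ξC_ιC (c : H.C) : H.ξC (H.ιC c) = P.ζC (H.ιC c) := c.2

theorem exists_ιC {t : P.T'T} (h : H.ξC t = P.ζC t) : ∃ c, H.ιC c = t := ⟨⟨t, h⟩, rfl⟩

theorem ιD_injective : Function.Injective H.ιD := Subtype.val_injective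

theorem ξD_ιD (d : H.D) : H.ξD (H.ιD d) = P.ζD (H.ιD d) := d.2

theorem exists_ιD {t : P.TT'} (h : H.ξD t = P.ζD t) : ∃ d, H.ιD d = t := ⟨⟨t, h⟩, rfl⟩

variable {H} in
-- Only flatness is used: `T ⊗_R -` preserves the equaliser that defines `C`.
theorem exists_id_tmap_ιC (hH : H.Tame) {t : P.TT'T}
    (h : (BHom.id P.S P.R P.T).tmap H.ξC t = (BHom.id P.S P.R P.T).tmap P.ζC t) :
    ∃ s, (BHom.id P.S P.R P.T).tmap H.ιC s = t :=
  ((RightFaithfullyFlat.exact_iff (S := P.S) hH.flat_right H.ιC H.ξC P.ζC).1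
    (fun _ => ⟨H.exists_ιC, by rintro ⟨c, rfl⟩; exact H.ξC_ιC c⟩) t).1 h

variable {H} in
theorem exists_ιD_tmap_id (hH : H.Tame) {t : BTensor P.S P.TT' P.T}
    (h : H.ξD.tmap (BHom.id P.S P.R P.T) t = P.ζD.tmap (BHom.id P.S P.R P.T) t) :
    ∃ s, H.ιD.tmap (BHom.id P.S P.R P.T) s = t :=
  ((LeftFaithfullyFlat.exact_iff (R := P.R) hH.flat_left H.ιD H.ξD P.ζD).1
    (fun _ => ⟨H.exists_ιD, by rintro ⟨c, rfl⟩; exact H.ξD_ιD c⟩) t).1 h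

namespace Tame

variable {H}

theorem id_tmap_injective (hH : H.Tame) {L X Y : Type u} [Ring L]
    [AddCommGroup X] [Module P.R X] [Module Lᵐᵒᵖ X] [SMulCommClass P.R Lᵐᵒᵖ X]
    [AddCommGroup Y] [Module P.R Y] [Module Lᵐᵒᵖ Y] [SMulCommClass P.R Lᵐᵒᵖ Y]
    {f : BHom P.R L X Y} (hf : Function.Injective f) :
    Function.Injective ((BHom.id P.S P.R P.T).tmap f) :=
  (RightFaithfullyFlat.injective_iff hH.flat_right f).1 hf

theorem tmap_id_injective (hH : H.Tame) {L X Y : Type u} [Ring L]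
    [AddCommGroup X] [Module L X] [Module P.Sᵐᵒᵖ X] [SMulCommClass L P.Sᵐᵒᵖ X]
    [AddCommGroup Y] [Module L Y] [Module P.Sᵐᵒᵖ Y] [SMulCommClass L P.Sᵐᵒᵖ Y]
    {f : BHom L P.S X Y} (hf : Function.Injective f) :
    Function.Injective (f.tmap (BHom.id P.S P.R P.T)) :=
  (LeftFaithfullyFlat.injective_iff hH.flat_left f).1 hf

/-- The coaction `T → T ⊗_R C`. -/
def ρTC (hH : H.Tame) : BHom P.S P.R P.T (BTensor P.R P.T H.C) :=
  BHom.factor ((BHom.id P.S P.R P.T).tmap H.ιC) (hH.id_tmap_injective H.ιC_injective) H.γ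
    (fun x => exists_id_tmap_ιC hH (H.γ_mem x))

theorem ρTC_spec (hH : H.Tame) (x : P.T) : (BHom.id P.S P.R P.T).tmap H.ιC (hH.ρTC x) = H.γ x :=
  BHom.apply_factor _ _ _ _ x

/-- The coaction `T → D ⊗_S T`. -/
def ρTD (hH : H.Tame) : BHom P.S P.R P.T (BTensor P.S H.D P.T) :=
  BHom.factor (H.ιD.tmap (BHom.id P.S P.R P.T)) (hH.tmap_id_injective H.ιD_injective) H.γL
    (fun x => exists_ιD_tmap_id hH (H.γL_mem x))

theorem ρTD_spec (hH : H.Tame) (x : P.T) : H.ιD.tmap (BHom.id P.S P.R P.T) (hH.ρTD x) = H.γL x :=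
  BHom.apply_factor _ _ _ _ x

/-- The map `x ⊗ x' ⊗ y ↦ ev'(x ⊗ x') ρ(y)`, a retraction of `T ⊗_R C → T ⊗_R T' ⊗_S T`. -/
def retrC (hH : H.Tame) : BHom P.S P.R P.TT'T (BTensor P.R P.T H.C) :=
  (lact P.S P.B P.R (BTensor P.R P.T H.C)).comp ((F.ev'S.tmap hH.ρTC).comp
    (BHom.assocSymm P.S P.R P.R P.S P.T P.T' P.T))

theorem retrC_tmul (hH : H.Tame) (x : P.T) (x' : P.T') (y : P.T) :
    hH.retrC (BTensor.tmul P.R x (BTensor.tmul P.S x' y)) =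
      F.ev' (BTensor.tmul P.R x x') • hH.ρTC y := by
  simp [retrC]

/-- The map `x ⊗ x' ⊗ y ↦ ρ(x) ev(x' ⊗ y)`, a retraction of `D ⊗_S T → T ⊗_R T' ⊗_S T`. -/
def retrD (hH : H.Tame) : BHom P.S P.R (BTensor P.S P.TT' P.T) (BTensor P.S H.D P.T) :=
  (ract P.R P.A P.S (BTensor P.S H.D P.T)).comp ((hH.ρTD.tmap F.evR).comp
    (BHom.assoc P.S P.R P.R P.S P.T P.T' P.T))

theorem retrD_tmul (hH : H.Tame) (x : P.T) (x' : P.T') (y : P.T) :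
    hH.retrD (BTensor.tmul P.S (BTensor.tmul P.R x x') y) =
      op (F.ev (BTensor.tmul P.S x' y)) • hH.ρTD x := by
  simp [retrD]

/-- The relation `q ∘ g₂ = f ∘ p` of a split fork, with `q = absorbRight` and `p = retrC`. -/
theorem absorbRight_id_tmap_ξC (hH : H.Tame) (t : P.TT'T) :
    P.absorbRight ((BHom.id P.S P.R P.T).tmap H.ξC t) =
      (BHom.id P.S P.R P.T).tmap H.ιC (hH.retrC t) := by
  -- The same underlying map arises from the identity of `T` as a `B`-`R` bimodule, hence it is
  -- `B`-linear.
  have e : ∀ (b : P.B) (s : BTensor P.R P.T H.C),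
      (BHom.id P.S P.R P.T).tmap H.ιC (b • s) = b • (BHom.id P.S P.R P.T).tmap H.ιC s :=
    fun b s => ((BHom.id P.B P.R P.T).tmap H.ιC).map_smul b s
  induction t using BTensor.induction_on_right with
  | zero => simp
  | simple x x' y =>
    rw [BHom.tmap_tmul, BHom.id_apply, absorbRight_ξC, retrC_tmul, e, hH.ρTC_spec]
  | add a b ha hb => simp only [map_add, ha, hb]

theorem absorbRight_id_tmap_ζC (t : P.TT'T) :
    P.absorbRight ((BHom.id P.S P.R P.T).tmap P.ζC t) = t := by
  induction t using BTensor.induction_on with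
  | zero => simp
  | simple x y => simp
  | add a b ha hb => simp only [map_add, ha, hb]

theorem absorbLeft_ξD_tmap_id (hH : H.Tame) (t : BTensor P.S P.TT' P.T) :
    P.absorbLeft (H.ξD.tmap (BHom.id P.S P.R P.T) t) =
      H.ιD.tmap (BHom.id P.S P.R P.T) (hH.retrD t) := by
  have e : ∀ (a : P.A) (s : BTensor P.S H.D P.T),
      H.ιD.tmap (BHom.id P.S P.R P.T) (op a • s) = op a • H.ιD.tmap (BHom.id P.S P.R P.T) s :=
    fun a s => (H.ιD.tmap (BHom.id P.S P.A P.T)).map_op_smul a s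
  induction t using BTensor.induction_on_left with
  | zero => simp
  | simple x x' y =>
    rw [BHom.tmap_tmul, BHom.id_apply, absorbLeft_ξD, retrD_tmul, e, hH.ρTD_spec]
  | add a b ha hb => simp only [map_add, ha, hb]

theorem absorbLeft_ζD_tmap_id (t : BTensor P.S P.TT' P.T) :
    P.absorbLeft (P.ζD.tmap (BHom.id P.S P.R P.T) t) = t := by
  induction t using BTensor.induction_on with
  | zero => simp
  | simple x y => simp
  | add a b ha hb => simp only [map_add, ha, hb]

/-- Equality may be tested after the injective map `T ⊗ ιC`. There the left side is `absorbRight`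
after `T ⊗ ξC`, which on `C` is the same as after `T ⊗ ζC`, that is, the identity. -/
theorem retrC_id_tmap_ιC (hH : H.Tame) (t : BTensor P.R P.T H.C) :
    hH.retrC ((BHom.id P.S P.R P.T).tmap H.ιC t) = t := by
  apply hH.id_tmap_injective H.ιC_injective
  rw [← absorbRight_id_tmap_ξC, BHom.tmap_tmap]
  refine (congrArg _ (BHom.tmap_congr (g' := P.ζC.comp H.ιC) (fun _ => rfl)
    (fun c => H.ξC_ιC c) t)).trans ?_
  rw [← BHom.tmap_tmap]
  exact absorbRight_id_tmap_ζC _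

theorem retrD_ιD_tmap_id (hH : H.Tame) (t : BTensor P.S H.D P.T) :
    hH.retrD (H.ιD.tmap (BHom.id P.S P.R P.T) t) = t := by
  apply hH.tmap_id_injective H.ιD_injective
  rw [← absorbLeft_ξD_tmap_id, BHom.tmap_tmap]
  refine (congrArg _ (BHom.tmap_congr (f' := P.ζD.comp H.ιD) (fun c => H.ξD_ιD c)
    (fun _ => rfl) t)).trans ?_
  rw [← BHom.tmap_tmap]
  exact absorbLeft_ζD_tmap_id _

variable {L N : Type u} [Ring L] [AddCommGroup N]

/-- The central descent statement: `C` is a universal equaliser. The pair is ordered as `ζC`, `ξC`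
because `absorbRight` is a retraction of `T ⊗ ζC`. -/
theorem ιC_tmap_id_equaliser (hH : H.Tame) [Module P.R N] [Module Lᵐᵒᵖ N]
    [SMulCommClass P.R Lᵐᵒᵖ N] :
    Function.Injective (H.ιC.tmap (BHom.id P.R L N)) ∧
      ∀ y, P.ζC.tmap (BHom.id P.R L N) y = H.ξC.tmap (BHom.id P.R L N) y →
        ∃ x, H.ιC.tmap (BHom.id P.R L N) x = y :=
  RightFaithfullyFlat.equaliser_tmap_of_split hH.flat_right H.ιC P.ζC H.ξC hH.retrC P.absorbRight
    hH.retrC_id_tmap_ιC absorbRight_id_tmap_ζC hH.absorbRight_id_tmap_ξC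
    (fun c => (H.ξC_ιC c).symm)

theorem id_tmap_ιD_equaliser (hH : H.Tame) [Module L N] [Module P.Sᵐᵒᵖ N]
    [SMulCommClass L P.Sᵐᵒᵖ N] :
    Function.Injective ((BHom.id L P.S N).tmap H.ιD) ∧
      ∀ y, (BHom.id L P.S N).tmap P.ζD y = (BHom.id L P.S N).tmap H.ξD y →
        ∃ x, (BHom.id L P.S N).tmap H.ιD x = y :=
  LeftFaithfullyFlat.equaliser_tmap_of_split hH.flat_left H.ιD P.ζD H.ξD hH.retrD P.absorbLeft
    hH.retrD_ιD_tmap_id absorbLeft_ζD_tmap_id hH.absorbLeft_ξD_tmap_id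
    (fun c => (H.ξD_ιD c).symm)

end Tame

end BimoduleHerd

/-! ### Split maps and units -/

namespace BTensor

variable {R M : Type*} [Ring R] [AddCommGroup M]

theorem exists_eq_one_tmul [Module R M] (t : BTensor R R M) : ∃ m, t = tmul R 1 m := by
  induction t using induction_on with
  | zero => exact ⟨0, by simp⟩
  | simple r m =>
    refine ⟨r • m, ?_⟩
    rw [← smul_tmul, op_smul_eq_mul, one_mul]
  | add a b ha hb =>
    obtain ⟨m, rfl⟩ := ha
    obtain ⟨n, rfl⟩ := hb
    exact ⟨m + n, (tmul_add _ _ _).symm⟩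

theorem exists_eq_tmul_one [Module Rᵐᵒᵖ M] (t : BTensor R M R) : ∃ m, t = tmul R m 1 := by
  induction t using induction_on with
  | zero => exact ⟨0, by simp⟩
  | simple m r =>
    refine ⟨op r • m, ?_⟩
    rw [smul_tmul, smul_eq_mul, mul_one]
  | add a b ha hb =>
    obtain ⟨m, rfl⟩ := ha
    obtain ⟨n, rfl⟩ := hb
    exact ⟨m + n, (add_tmul _ _ _).symm⟩

end BTensor

section Units

variable {R A K L M N : Type*} [Ring R] [Ring A] [RingMap R A] [Ring K] [Ring L]
  [AddCommGroup M] [AddCommGroup N]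

/-- Every element of `R ⊗_R M` is of the form `1 ⊗ m`, and the action of `A` on `N` recovers `f m`
from `1 ⊗ f m`. No flatness enters. Counit axioms are tested through this injection. -/
theorem unitMap_tmap_injective [Module R M] [Module Lᵐᵒᵖ M] [SMulCommClass R Lᵐᵒᵖ M]
    [Module A N] [Module R N] [LeftRestricted R A N] [Module Lᵐᵒᵖ N] [SMulCommClass A Lᵐᵒᵖ N]
    [SMulCommClass R Lᵐᵒᵖ N] {f : BHom R L M N} (hf : Function.Injective f) :
    Function.Injective ((unitMap R A).tmap f) := by
  intro s t h
  obtain ⟨m, rfl⟩ := BTensor.exists_eq_one_tmul s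
  obtain ⟨n, rfl⟩ := BTensor.exists_eq_one_tmul t
  have h' := congrArg (lact R A L N) h
  simp only [BHom.tmap_tmul, unitMap_one, lact_tmul, one_smul] at h'
  rw [hf h']

theorem tmap_unitMap_injective [Module Rᵐᵒᵖ M] [Module K M] [SMulCommClass K Rᵐᵒᵖ M]
    [Module Aᵐᵒᵖ N] [Module Rᵐᵒᵖ N] [RightRestricted R A N] [Module K N] [SMulCommClass K Aᵐᵒᵖ N]
    [SMulCommClass K Rᵐᵒᵖ N] {f : BHom K R M N} (hf : Function.Injective f) :
    Function.Injective (f.tmap (unitMap R A)) := by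
  intro s t h
  obtain ⟨m, rfl⟩ := BTensor.exists_eq_tmul_one s
  obtain ⟨n, rfl⟩ := BTensor.exists_eq_tmul_one t
  have h' := congrArg (ract R A K N) h
  simp only [BHom.tmap_tmul, unitMap_one, ract_tmul, op_one, one_smul] at h'
  rw [hf h']

end Units

namespace BHom

variable {K L R S M N P M' N' P' : Type*} [Ring K] [Ring L] [Ring R] [Ring S]
  [AddCommGroup M] [AddCommGroup N] [AddCommGroup P] [AddCommGroup M'] [AddCommGroup N']
  [AddCommGroup P']

section Basic

variable [Module K M] [Module Lᵐᵒᵖ M] [Module K N] [Module Lᵐᵒᵖ N] [Module K P] [Module Lᵐᵒᵖ P]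

/-- A bimodule map that has a retraction. -/
def IsSplit (f : BHom K L M N) : Prop := ∃ g : BHom K L N M, ∀ m, g (f m) = m

theorem IsSplit.injective {f : BHom K L M N} (hf : f.IsSplit) : Function.Injective f :=
  Function.LeftInverse.injective hf.choose_spec

theorem IsSplit.comp {g : BHom K L N P} {f : BHom K L M N} (hg : g.IsSplit) (hf : f.IsSplit) :
    (g.comp f).IsSplit := by
  obtain ⟨g', hg⟩ := hg
  obtain ⟨f', hf⟩ := hf
  exact ⟨f'.comp g', fun m => by simp [hg, hf]⟩

end Basic

section Tensor

variable [Module K M] [Module Rᵐᵒᵖ M] [SMulCommClass K Rᵐᵒᵖ M]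
  [Module K M'] [Module Rᵐᵒᵖ M'] [SMulCommClass K Rᵐᵒᵖ M']
  [Module R N] [Module Lᵐᵒᵖ N] [SMulCommClass R Lᵐᵒᵖ N]
  [Module R N'] [Module Lᵐᵒᵖ N'] [SMulCommClass R Lᵐᵒᵖ N']

theorem IsSplit.tmap_id {f : BHom K R M M'} (hf : f.IsSplit) :
    (f.tmap (BHom.id R L N)).IsSplit := by
  obtain ⟨g, hg⟩ := hf
  refine ⟨g.tmap (BHom.id R L N), fun t => ?_⟩
  rw [tmap_tmap]
  exact tmap_eq_self hg (fun _ => rfl) t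

theorem IsSplit.id_tmap {f : BHom R L N N'} (hf : f.IsSplit) :
    ((BHom.id K R M).tmap f).IsSplit := by
  obtain ⟨g, hg⟩ := hf
  refine ⟨(BHom.id K R M).tmap g, fun t => ?_⟩
  rw [tmap_tmap]
  exact tmap_eq_self (fun _ => rfl) hg t

theorem tmap_comp_left (f : BHom K R M M') (g : BHom R L N N') :
    f.tmap g = (f.tmap (BHom.id R L N')).comp ((BHom.id K R M).tmap g) :=
  ext fun t => tmap_eq_left f g t

theorem tmap_comp_right (f : BHom K R M M') (g : BHom R L N N') :
    f.tmap g = ((BHom.id K R M').tmap g).comp (f.tmap (BHom.id R L N)) :=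
  ext fun t => tmap_eq_right f g t

end Tensor

section Assoc

variable [Module K M] [Module Rᵐᵒᵖ M] [SMulCommClass K Rᵐᵒᵖ M]
  [Module R N] [Module Sᵐᵒᵖ N] [SMulCommClass R Sᵐᵒᵖ N]
  [Module S P] [Module Lᵐᵒᵖ P] [SMulCommClass S Lᵐᵒᵖ P]
  [Module K M'] [Module Rᵐᵒᵖ M'] [SMulCommClass K Rᵐᵒᵖ M']
  [Module R N'] [Module Sᵐᵒᵖ N'] [SMulCommClass R Sᵐᵒᵖ N']
  [Module S P'] [Module Lᵐᵒᵖ P'] [SMulCommClass S Lᵐᵒᵖ P']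

theorem isSplit_tmap_tmap_iff (f : BHom K R M M') (g : BHom R S N N') (h : BHom S L P P') :
    (tmap (tmap f g) h).IsSplit ↔ (tmap f (tmap g h)).IsSplit := by
  constructor
  · rintro ⟨k, hk⟩
    refine ⟨(assoc K L R S M N P).comp (k.comp (assocSymm K L R S M' N' P')), fun m => ?_⟩
    simp [assoc_symm_tmap, hk]
  · rintro ⟨k, hk⟩
    refine ⟨(assocSymm K L R S M N P).comp (k.comp (assoc K L R S M' N' P')), fun m => ?_⟩
    simp [assoc_tmap, hk]

/-- Unlike injectivity, splitness survives any further tensor factor, and `(M ⊗ N) ⊗ h` is `M ⊗ (N ⊗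
h)` up to bracketing. -/
theorem IsSplit.id_tensor_tmap {h : BHom S L P P'} (hh : ((BHom.id R S N).tmap h).IsSplit) :
    ((BHom.id K S (BTensor R M N)).tmap h).IsSplit := by
  have e : BHom.id K S (BTensor R M N) = tmap (BHom.id K R M) (BHom.id R S N) :=
    ext fun t => (BHom.tmap_id t).symm
  rw [e, isSplit_tmap_tmap_iff]
  exact hh.id_tmap

theorem IsSplit.tmap_id_tensor {f : BHom K R M M'} (hf : (f.tmap (BHom.id R S N)).IsSplit) :
    (f.tmap (BHom.id R L (BTensor S N P))).IsSplit := by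
  have e : BHom.id R L (BTensor S N P) = tmap (BHom.id R S N) (BHom.id S L P) :=
    ext fun t => (BHom.tmap_id t).symm
  rw [e, ← isSplit_tmap_tmap_iff]
  exact hf.tmap_id

theorem IsSplit.id_tmap_tmap {f : BHom R S N N'} (hf : ((BHom.id K R M).tmap f).IsSplit) :
    ((BHom.id K R M).tmap (f.tmap (BHom.id S L P))).IsSplit :=
  (isSplit_tmap_tmap_iff _ _ _).1 hf.tmap_id

theorem IsSplit.tmap_tmap_id {f : BHom R S N N'} (hf : (f.tmap (BHom.id S L P)).IsSplit) :
    (((BHom.id K R M).tmap f).tmap (BHom.id S L P)).IsSplit :=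
  (isSplit_tmap_tmap_iff _ _ _).2 hf.id_tmap

end Assoc

end BHom

namespace BimoduleHerd

variable {P : BimodulePair.{u}} {F : FormalDual P} (H : BimoduleHerd F)

/-! ### Identities for the shepherd -/

/-- `H.coassoc` with a factor `T'` placed in front. The auxiliary `K x'` prefixes `x'` and
rebrackets. -/
theorem γr_coassoc (t : P.T'T) :
    BTensor.assoc P.R P.R P.T'T P.T'T P.T'T (H.γr.tmap (BHom.id P.R P.R P.T'T) (H.γr t)) =
      (BHom.id P.R P.R P.T'T).tmap H.γr (H.γr t) := by
  let K (x' : P.T') (v : BTensor P.R P.T (BTensor P.S P.T' P.TT'T)) :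
      BTensor P.R P.T'T (BTensor P.R P.T'T P.T'T) :=
    (BHom.id P.R P.R P.T'T).tmap (BHom.assocSymm P.R P.R P.S P.R P.T' P.T P.T'T)
      ((BTensor.assoc P.S P.R P.T' P.T (BTensor P.S P.T' P.TT'T)).symm (BTensor.tmul P.S x' v))
  have h₁ : ∀ (x' : P.T') (u : P.TT'T), (BHom.id P.R P.R P.T'T).tmap H.γr
      ((BTensor.assoc P.S P.R P.T' P.T P.T'T).symm (BTensor.tmul P.S x' u)) =
      K x' ((BHom.id P.S P.R P.T).tmap ((BHom.id P.R P.S P.T').tmap H.γ) u) := by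
    intro x' u
    induction u using BTensor.induction_on_right with
    | zero => simp [K]
    | simple x z y => simp [K, γr]
    | add a b ha hb => simp only [K, map_add, BTensor.tmul_add] at ha hb ⊢; rw [ha, hb]
  have h₂ : ∀ (x' : P.T') (w : P.T'T) (v : P.TT'T),
      BTensor.assoc P.R P.R P.T'T P.T'T P.T'T (BTensor.tmul P.R
        ((BTensor.assoc P.S P.R P.T' P.T P.T'T).symm (BTensor.tmul P.S x' v)) w) =
      K x' ((BHom.id P.S P.R P.T).tmap (BHom.assoc P.R P.R P.S P.R P.T' P.T P.T'T)
        (BTensor.assoc P.R P.R P.T P.T'T P.T'T (BTensor.tmul P.R v w))) := by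
    intro x' w v
    induction v using BTensor.induction_on_right with
    | zero => simp [K]
    | simple x z y => simp [K]
    | add a b ha hb =>
      simp only [K, map_add, BTensor.tmul_add, BTensor.add_tmul] at ha hb ⊢; rw [ha, hb]
  have h₃ : ∀ (x' : P.T') (u : P.TT'T),
      BTensor.assoc P.R P.R P.T'T P.T'T P.T'T (H.γr.tmap (BHom.id P.R P.R P.T'T)
        ((BTensor.assoc P.S P.R P.T' P.T P.T'T).symm (BTensor.tmul P.S x' u))) =
      K x' ((BHom.id P.S P.R P.T).tmap (BHom.assoc P.R P.R P.S P.R P.T' P.T P.T'T)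
        (BTensor.assoc P.R P.R P.T P.T'T P.T'T (H.γ.tmap (BHom.id P.R P.R P.T'T) u))) := by
    intro x' u
    induction u using BTensor.induction_on with
    | zero => simp [K]
    | simple x w => simp [γr_tmul, h₂]
    | add a b ha hb =>
      simp only [K, map_add, BTensor.tmul_add] at ha hb ⊢; rw [ha, hb]
  induction t using BTensor.induction_on with
  | zero => simp
  | simple x' y => rw [γr_tmul, h₁, h₃, H.coassoc]
  | add a b ha hb => simp only [map_add, ha, hb]

theorem γl_coassoc (t : P.TT') :
    BTensor.assoc P.S P.S P.TT' P.TT' P.TT' (H.γl.tmap (BHom.id P.S P.S P.TT') (H.γl t)) =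
      (BHom.id P.S P.S P.TT').tmap H.γl (H.γl t) := by
  let K (x' : P.T') (v : BTensor P.S (BTensor P.R (BTensor P.S P.TT' P.T) P.T') P.T) :
      BTensor P.S P.TT' (BTensor P.S P.TT' P.TT') :=
    BTensor.assoc P.S P.S P.TT' P.TT' P.TT'
      ((BHom.assoc P.S P.S P.S P.R P.TT' P.T P.T').tmap (BHom.id P.S P.S P.TT')
        (BTensor.assoc P.S P.R (BTensor P.R (BTensor P.S P.TT' P.T) P.T') P.T P.T'
          (BTensor.tmul P.R v x')))
  have h₁ : ∀ (x' : P.T') (u : BTensor P.S P.TT' P.T),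
      BTensor.assoc P.S P.S P.TT' P.TT' P.TT' (H.γl.tmap (BHom.id P.S P.S P.TT')
        (BTensor.assoc P.S P.R P.TT' P.T P.T' (BTensor.tmul P.R u x'))) =
      K x' ((H.γL.tmap (BHom.id P.R P.S P.T')).tmap (BHom.id P.S P.R P.T) u) := by
    intro x' u
    induction u using BTensor.induction_on_left with
    | zero => simp [K]
    | simple x z y => simp [K, γl_tmul]
    | add a b ha hb => simp only [K, map_add, BTensor.add_tmul] at ha hb ⊢; rw [ha, hb]
  have h₂ : ∀ (x' : P.T') (w : P.TT') (v : BTensor P.S P.TT' P.T),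
      BTensor.tmul P.S w (BTensor.assoc P.S P.R P.TT' P.T P.T' (BTensor.tmul P.R v x')) =
      K x' ((BHom.assocSymm P.S P.S P.S P.R P.TT' P.T P.T').tmap (BHom.id P.S P.R P.T)
        ((BTensor.assoc P.S P.S P.TT' P.TT' P.T).symm (BTensor.tmul P.S w v))) := by
    intro x' w v
    induction v using BTensor.induction_on_left with
    | zero => simp [K]
    | simple x z y => simp [K]
    | add a b ha hb =>
      simp only [K, map_add, BTensor.tmul_add, BTensor.add_tmul] at ha hb ⊢; rw [ha, hb]
  have h₃ : ∀ (x' : P.T') (u : BTensor P.S P.TT' P.T),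
      (BHom.id P.S P.S P.TT').tmap H.γl
        (BTensor.assoc P.S P.R P.TT' P.T P.T' (BTensor.tmul P.R u x')) =
      K x' ((BHom.assocSymm P.S P.S P.S P.R P.TT' P.T P.T').tmap (BHom.id P.S P.R P.T)
        ((BTensor.assoc P.S P.S P.TT' P.TT' P.T).symm
          ((BHom.id P.S P.S P.TT').tmap H.γL u))) := by
    intro x' u
    induction u using BTensor.induction_on with
    | zero => simp [K]
    | simple x w => simp [γl_tmul, h₂]
    | add a b ha hb =>
      simp only [K, map_add, BTensor.add_tmul] at ha hb ⊢; rw [ha, hb]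
  induction t using BTensor.induction_on with
  | zero => simp
  | simple y x' => rw [γl_tmul, h₁, h₃, H.γL_coassoc]
  | add a b ha hb => simp only [map_add, ha, hb]

theorem id_tmap_evR_γr (t : P.T'T) :
    (BHom.id P.R P.R P.T'T).tmap F.evR (H.γr t) = BTensor.tmul P.R t 1 := by
  induction t using BTensor.induction_on with
  | zero => simp
  | simple x' y =>
    have e : BHom.id P.R P.R P.T'T = (BHom.id P.R P.S P.T').tmap (BHom.id P.S P.R P.T) :=
      BHom.ext fun t => (BHom.tmap_id t).symm
    rw [γr_tmul, e, ← BHom.assoc_symm_tmap, BHom.tmap_tmul, id_tmap_evR_γ]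
    simp
  | add a b ha hb => simp only [map_add, BTensor.add_tmul, ha, hb]

theorem ev'S_tmap_id_γl (t : P.TT') :
    F.ev'S.tmap (BHom.id P.S P.S P.TT') (H.γl t) = BTensor.tmul P.S 1 t := by
  induction t using BTensor.induction_on with
  | zero => simp
  | simple y x' =>
    have e : BHom.id P.S P.S P.TT' = (BHom.id P.S P.R P.T).tmap (BHom.id P.R P.S P.T') :=
      BHom.ext fun t => (BHom.tmap_id t).symm
    rw [γl_tmul, e, ← BHom.assoc_tmap, BHom.tmap_tmul, ev'S_tmap_id_γL]
    simp
  | add a b ha hb => simp only [map_add, BTensor.tmul_add, ha, hb]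

/-- The two evaluations act on different legs of `γr t`, and the right one gives `t ⊗ 1`. On `C`,
where `ξC c = 1 ⊗ c`, the result is `1 ⊗ ev(c) = ev(c) ⊗ 1`, the condition for `ev(c)` to come from
`R`. -/
theorem id_tmap_evR_ξC (t : P.T'T) :
    (BHom.id P.R P.R P.A).tmap F.evR (H.ξC t) = BTensor.tmul P.R (F.ev t) 1 := by
  rw [ξC_apply, ← BHom.tmap_eq_right, BHom.tmap_eq_left, id_tmap_evR_γr]
  simp

theorem ev'S_tmap_id_ξD (t : P.TT') :
    F.ev'S.tmap (BHom.id P.S P.S P.B) (H.ξD t) = BTensor.tmul P.S 1 (F.ev' t) := by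
  rw [ξD_apply, ← BHom.tmap_eq_left, BHom.tmap_eq_right, ev'S_tmap_id_γl]
  simp

theorem assoc_ξC_tmap_id_γr (t : P.T'T) :
    BTensor.assoc P.R P.R P.A P.T'T P.T'T (H.ξC.tmap (BHom.id P.R P.R P.T'T) (H.γr t)) =
      (BHom.id P.R P.R P.A).tmap H.γr (H.ξC t) := by
  have e : BHom.id P.R P.R (BTensor P.R P.T'T P.T'T) =
      (BHom.id P.R P.R P.T'T).tmap (BHom.id P.R P.R P.T'T) :=
    BHom.ext fun t => (BHom.tmap_id t).symm
  rw [ξC, BHom.tmap_id_comp, BHom.assoc_tmap, γr_coassoc, ← e, ← BHom.tmap_eq_left, BHom.comp_apply,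
    ← BHom.tmap_eq_right]

theorem id_tmap_ξD_γl (t : P.TT') :
    (BHom.id P.S P.S P.TT').tmap H.ξD (H.γl t) =
      BTensor.assoc P.S P.S P.TT' P.TT' P.B (H.γl.tmap (BHom.id P.S P.S P.B) (H.ξD t)) := by
  have e : BHom.id P.S P.S (BTensor P.S P.TT' P.TT') =
      (BHom.id P.S P.S P.TT').tmap (BHom.id P.S P.S P.TT') :=
    BHom.ext fun t => (BHom.tmap_id t).symm
  rw [ξD, BHom.id_tmap_comp, ← γl_coassoc, ← BHom.assoc_tmap, ← e, ← BHom.tmap_eq_right,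
    BHom.comp_apply, ← BHom.tmap_eq_left]

/-- The first leg of `γr c` still satisfies the equation of `C`: by coassociativity the left side is
`A ⊗ γr` applied to `ξC c = 1 ⊗ c`. -/
theorem ξC_tmap_id_γr_ιC (c : H.C) :
    H.ξC.tmap (BHom.id P.R P.R P.T'T) (H.γr (H.ιC c)) =
      P.ζC.tmap (BHom.id P.R P.R P.T'T) (H.γr (H.ιC c)) := by
  apply (BTensor.assoc P.R P.R P.A P.T'T P.T'T).injective
  rw [assoc_ξC_tmap_id_γr, ξC_ιC, BimodulePair.ζC_apply, BHom.tmap_tmul]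
  generalize H.γr (H.ιC c) = t
  induction t using BTensor.induction_on with
  | zero => simp
  | simple s t => simp
  | add a b ha hb => simp only [map_add, BTensor.tmul_add, ha, hb]

theorem id_tmap_ξD_γl_ιD (d : H.D) :
    (BHom.id P.S P.S P.TT').tmap H.ξD (H.γl (H.ιD d)) =
      (BHom.id P.S P.S P.TT').tmap P.ζD (H.γl (H.ιD d)) := by
  rw [id_tmap_ξD_γl, ξD_ιD, BimodulePair.ζD_apply, BHom.tmap_tmul]
  generalize H.γl (H.ιD d) = t
  induction t using BTensor.induction_on with
  | zero => simp
  | simple s t => simp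
  | add a b ha hb => simp only [map_add, BTensor.add_tmul, ha, hb]

end BimoduleHerd

namespace BimoduleHerd

variable {P : BimodulePair.{u}} {F : FormalDual P} {H : BimoduleHerd F}

namespace Tame

/-! ### The corings `C` and `D` -/

theorem isSplit_T_ιC (hH : H.Tame) : ((BHom.id P.S P.R P.T).tmap H.ιC).IsSplit :=
  ⟨hH.retrC, hH.retrC_id_tmap_ιC⟩

theorem isSplit_ιD_T (hH : H.Tame) : (H.ιD.tmap (BHom.id P.S P.R P.T)).IsSplit :=
  ⟨hH.retrD, hH.retrD_ιD_tmap_id⟩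

theorem isSplit_T'T_ιC (hH : H.Tame) : ((BHom.id P.R P.R P.T'T).tmap H.ιC).IsSplit :=
  hH.isSplit_T_ιC.id_tensor_tmap

theorem isSplit_ιD_TT' (hH : H.Tame) : (H.ιD.tmap (BHom.id P.S P.S P.TT')).IsSplit :=
  hH.isSplit_ιD_T.tmap_id_tensor

/-- The map factors as `C ⊗ X → T'T ⊗ X → T'T ⊗ Y`, whose first arrow is injective for every `X` by
`ιC_tmap_id_equaliser`. Injectivity of a tensor product of inclusions is thus reduced one factor at
a time. -/
theorem ιC_tmap_injective (hH : H.Tame) {L X Y : Type u} [Ring L]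
    [AddCommGroup X] [Module P.R X] [Module Lᵐᵒᵖ X] [SMulCommClass P.R Lᵐᵒᵖ X]
    [AddCommGroup Y] [Module P.R Y] [Module Lᵐᵒᵖ Y] [SMulCommClass P.R Lᵐᵒᵖ Y]
    {f : BHom P.R L X Y} (hf : Function.Injective ((BHom.id P.R P.R P.T'T).tmap f)) :
    Function.Injective (H.ιC.tmap f) := by
  rw [BHom.tmap_comp_right]
  exact hf.comp hH.ιC_tmap_id_equaliser.1

theorem tmap_ιD_injective (hH : H.Tame) {L X Y : Type u} [Ring L]
    [AddCommGroup X] [Module L X] [Module P.Sᵐᵒᵖ X] [SMulCommClass L P.Sᵐᵒᵖ X]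
    [AddCommGroup Y] [Module L Y] [Module P.Sᵐᵒᵖ Y] [SMulCommClass L P.Sᵐᵒᵖ Y]
    {f : BHom L P.S X Y} (hf : Function.Injective (f.tmap (BHom.id P.S P.S P.TT'))) :
    Function.Injective (f.tmap H.ιD) := by
  rw [BHom.tmap_comp_left]
  exact hf.comp hH.id_tmap_ιD_equaliser.1

theorem ιC_tmap_ιC_injective (hH : H.Tame) : Function.Injective (H.ιC.tmap H.ιC) :=
  hH.ιC_tmap_injective hH.isSplit_T'T_ιC.injective

theorem ιD_tmap_ιD_injective (hH : H.Tame) : Function.Injective (H.ιD.tmap H.ιD) :=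
  hH.tmap_ιD_injective hH.isSplit_ιD_TT'.injective

theorem isSplit_T'T_ιC_ιC (hH : H.Tame) :
    ((BHom.id P.R P.R P.T'T).tmap (H.ιC.tmap H.ιC)).IsSplit := by
  have e : (BHom.id P.R P.R P.T'T).tmap (H.ιC.tmap H.ιC) =
      ((BHom.id P.R P.R P.T'T).tmap ((BHom.id P.R P.R P.T'T).tmap H.ιC)).comp
        ((BHom.id P.R P.R P.T'T).tmap (H.ιC.tmap (BHom.id P.R P.R H.C))) := by
    refine BHom.ext fun t => ?_
    rw [BHom.comp_apply, ← BHom.id_tmap_comp, ← BHom.tmap_comp_right]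
  rw [e]
  exact hH.isSplit_T'T_ιC.id_tmap.comp hH.isSplit_T'T_ιC.id_tmap_tmap

theorem isSplit_ιD_ιD_TT' (hH : H.Tame) :
    ((H.ιD.tmap H.ιD).tmap (BHom.id P.S P.S P.TT')).IsSplit := by
  have e : (H.ιD.tmap H.ιD).tmap (BHom.id P.S P.S P.TT') =
      ((H.ιD.tmap (BHom.id P.S P.S P.TT')).tmap (BHom.id P.S P.S P.TT')).comp
        (((BHom.id P.S P.S H.D).tmap H.ιD).tmap (BHom.id P.S P.S P.TT')) := by
    refine BHom.ext fun t => ?_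
    rw [BHom.comp_apply, ← BHom.tmap_id_comp, ← BHom.tmap_comp_left]
  rw [e]
  exact hH.isSplit_ιD_TT'.tmap_id.comp hH.isSplit_ιD_TT'.tmap_tmap_id

theorem ιC_tmap_ιC_tmap_ιC_injective (hH : H.Tame) :
    Function.Injective (H.ιC.tmap (H.ιC.tmap H.ιC)) :=
  hH.ιC_tmap_injective hH.isSplit_T'T_ιC_ιC.injective

theorem ιD_tmap_ιD_tmap_ιD_injective (hH : H.Tame) :
    Function.Injective ((H.ιD.tmap H.ιD).tmap H.ιD) :=
  hH.tmap_ιD_injective hH.isSplit_ιD_ιD_TT'.injective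

/-- `T' ⊗_S ρ`, as a map `T' ⊗_S T → (T' ⊗_S T) ⊗_R C`. -/
def γrC (hH : H.Tame) : BHom P.R P.R P.T'T (BTensor P.R P.T'T H.C) :=
  (BHom.assocSymm P.R P.R P.S P.R P.T' P.T H.C).comp ((BHom.id P.R P.S P.T').tmap hH.ρTC)

theorem id_tmap_ιC_γrC (hH : H.Tame) (t : P.T'T) :
    (BHom.id P.R P.R P.T'T).tmap H.ιC (hH.γrC t) = H.γr t := by
  have e : BHom.id P.R P.R P.T'T = (BHom.id P.R P.S P.T').tmap (BHom.id P.S P.R P.T) :=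
    BHom.ext fun t => (BHom.tmap_id t).symm
  rw [γrC, e, BHom.comp_apply, BHom.assocSymm_apply, ← BHom.assoc_symm_tmap, BHom.tmap_tmap]
  exact congrArg _ (BHom.tmap_congr (fun _ => rfl) hH.ρTC_spec t)

/-- `ρ ⊗_R T'`, as a map `T ⊗_R T' → D ⊗_S (T ⊗_R T')`. -/
def γlD (hH : H.Tame) : BHom P.S P.S P.TT' (BTensor P.S H.D P.TT') :=
  (BHom.assoc P.S P.S P.S P.R H.D P.T P.T').comp (hH.ρTD.tmap (BHom.id P.R P.S P.T'))

theorem ιD_tmap_id_γlD (hH : H.Tame) (t : P.TT') :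
    H.ιD.tmap (BHom.id P.S P.S P.TT') (hH.γlD t) = H.γl t := by
  have e : BHom.id P.S P.S P.TT' = (BHom.id P.S P.R P.T).tmap (BHom.id P.R P.S P.T') :=
    BHom.ext fun t => (BHom.tmap_id t).symm
  rw [γlD, e, BHom.comp_apply, BHom.assoc_apply, ← BHom.assoc_tmap, BHom.tmap_tmap]
  exact congrArg _ (BHom.tmap_congr hH.ρTD_spec (fun _ => rfl) t)

/-- The second leg of `γrC` lies in `C` by construction. The equation for the first leg may be
checked after including the second in `T' ⊗_S T`, since this inclusion remains split next to `A ⊗ T'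
⊗ T`; there it is `ξC_tmap_id_γr_ιC`. -/
theorem exists_comulC (hH : H.Tame) (c : H.C) :
    ∃ w, H.ιC.tmap (BHom.id P.R P.R H.C) w = hH.γrC (H.ιC c) := by
  refine hH.ιC_tmap_id_equaliser.2 _ ?_
  apply BHom.IsSplit.injective (f := (BHom.id P.R P.R (BTensor P.R P.A P.T'T)).tmap H.ιC)
    hH.isSplit_T'T_ιC.id_tensor_tmap
  rw [← BHom.tmap_eq_right, ← BHom.tmap_eq_right, BHom.tmap_eq_left, BHom.tmap_eq_left H.ξC,
    hH.id_tmap_ιC_γrC, H.ξC_tmap_id_γr_ιC]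

theorem exists_comulD (hH : H.Tame) (d : H.D) :
    ∃ w, (BHom.id P.S P.S H.D).tmap H.ιD w = hH.γlD (H.ιD d) := by
  refine hH.id_tmap_ιD_equaliser.2 _ ?_
  apply BHom.IsSplit.injective (f := H.ιD.tmap (BHom.id P.S P.S (BTensor P.S P.TT' P.B)))
    hH.isSplit_ιD_TT'.tmap_id_tensor
  rw [← BHom.tmap_eq_left, ← BHom.tmap_eq_left, BHom.tmap_eq_right, BHom.tmap_eq_right _ H.ξD,
    hH.ιD_tmap_id_γlD, H.id_tmap_ξD_γl_ιD]

/-- The coproduct of `C`. -/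
def comulC (hH : H.Tame) : BHom P.R P.R H.C (BTensor P.R H.C H.C) :=
  BHom.factor (H.ιC.tmap (BHom.id P.R P.R H.C)) hH.ιC_tmap_id_equaliser.1 (hH.γrC.comp H.ιC)
    hH.exists_comulC

theorem ιC_tmap_id_comulC (hH : H.Tame) (c : H.C) :
    H.ιC.tmap (BHom.id P.R P.R H.C) (hH.comulC c) = hH.γrC (H.ιC c) :=
  BHom.apply_factor _ _ _ _ c

theorem ιC_tmap_ιC_comulC (hH : H.Tame) (c : H.C) :
    H.ιC.tmap H.ιC (hH.comulC c) = H.γr (H.ιC c) := by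
  rw [BHom.tmap_eq_right, ιC_tmap_id_comulC, id_tmap_ιC_γrC]

/-- The coproduct of `D`. -/
def comulD (hH : H.Tame) : BHom P.S P.S H.D (BTensor P.S H.D H.D) :=
  BHom.factor ((BHom.id P.S P.S H.D).tmap H.ιD) hH.id_tmap_ιD_equaliser.1 (hH.γlD.comp H.ιD)
    hH.exists_comulD

theorem id_tmap_ιD_comulD (hH : H.Tame) (d : H.D) :
    (BHom.id P.S P.S H.D).tmap H.ιD (hH.comulD d) = hH.γlD (H.ιD d) :=
  BHom.apply_factor _ _ _ _ d

theorem ιD_tmap_ιD_comulD (hH : H.Tame) (d : H.D) :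
    H.ιD.tmap H.ιD (hH.comulD d) = H.γl (H.ιD d) := by
  rw [BHom.tmap_eq_left, id_tmap_ιD_comulD, ιD_tmap_id_γlD]

/-- The threefold tensor power of `C` embeds in that of `T' ⊗_S T`, where the claim is `γr_coassoc`.
-/
theorem comulC_coassoc (hH : H.Tame) (c : H.C) :
    BTensor.assoc P.R P.R H.C H.C H.C (hH.comulC.tmap (BHom.id P.R P.R H.C) (hH.comulC c)) =
      (BHom.id P.R P.R H.C).tmap hH.comulC (hH.comulC c) := by
  apply hH.ιC_tmap_ιC_tmap_ιC_injective
  have h₁ : ∀ t, (H.ιC.tmap H.ιC).tmap H.ιC (hH.comulC.tmap (BHom.id P.R P.R H.C) t) =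
      H.γr.tmap (BHom.id P.R P.R P.T'T) (H.ιC.tmap H.ιC t) := fun t => by
    rw [BHom.tmap_tmap, BHom.tmap_tmap]
    exact BHom.tmap_congr hH.ιC_tmap_ιC_comulC (fun _ => rfl) t
  have h₂ : ∀ t, H.ιC.tmap (H.ιC.tmap H.ιC) ((BHom.id P.R P.R H.C).tmap hH.comulC t) =
      (BHom.id P.R P.R P.T'T).tmap H.γr (H.ιC.tmap H.ιC t) := fun t => by
    rw [BHom.tmap_tmap, BHom.tmap_tmap]
    exact BHom.tmap_congr (fun _ => rfl) hH.ιC_tmap_ιC_comulC t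
  rw [← BHom.assoc_tmap, h₁, h₂, ιC_tmap_ιC_comulC, γr_coassoc]

theorem comulD_coassoc (hH : H.Tame) (d : H.D) :
    BTensor.assoc P.S P.S H.D H.D H.D (hH.comulD.tmap (BHom.id P.S P.S H.D) (hH.comulD d)) =
      (BHom.id P.S P.S H.D).tmap hH.comulD (hH.comulD d) := by
  apply (BHom.tmap_tmap_injective_iff _ _ _).1 hH.ιD_tmap_ιD_tmap_ιD_injective
  have h₁ : ∀ t, (H.ιD.tmap H.ιD).tmap H.ιD (hH.comulD.tmap (BHom.id P.S P.S H.D) t) =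
      H.γl.tmap (BHom.id P.S P.S P.TT') (H.ιD.tmap H.ιD t) := fun t => by
    rw [BHom.tmap_tmap, BHom.tmap_tmap]
    exact BHom.tmap_congr hH.ιD_tmap_ιD_comulD (fun _ => rfl) t
  have h₂ : ∀ t, H.ιD.tmap (H.ιD.tmap H.ιD) ((BHom.id P.S P.S H.D).tmap hH.comulD t) =
      (BHom.id P.S P.S P.TT').tmap H.γl (H.ιD.tmap H.ιD t) := fun t => by
    rw [BHom.tmap_tmap, BHom.tmap_tmap]
    exact BHom.tmap_congr (fun _ => rfl) hH.ιD_tmap_ιD_comulD t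
  rw [← BHom.assoc_tmap, h₁, h₂, ιD_tmap_ιD_comulD, γl_coassoc]

/-- `R → A` is the equaliser of `a ↦ 1 ⊗ a` and `a ↦ a ⊗ 1`. -/
theorem unitMap_equaliser_right (hH : H.Tame) : Function.Injective (unitMap P.R P.A) ∧
    ∀ a, oneTmul P.R P.A P.R P.A a = tmulOne P.R P.A P.R P.A a → ∃ r, unitMap P.R P.A r = a := by
  -- As `T` is itself an `A`-module, the fork splits after `T ⊗_R -`, by `p : x ⊗ a ↦ xa ⊗ 1` and `q
  -- : x ⊗ a ⊗ b ↦ xa ⊗ b`.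
  let p : BHom P.S P.R (BTensor P.R P.T P.A) (BTensor P.R P.T P.R) :=
    { toAddMonoidHom := ((BTensor.mk P.R P.T P.R).flip 1).comp
        (ract P.R P.A P.S P.T).toAddMonoidHom
      map_smul' := fun s t => by
        change BTensor.tmul P.R (ract P.R P.A P.S P.T (s • t)) 1 =
          s • BTensor.tmul P.R (ract P.R P.A P.S P.T t) 1
        rw [BHom.map_smul, BTensor.smul_tmul']
      map_op_smul' := fun r t => by
        change BTensor.tmul P.R (ract P.R P.A P.S P.T (op r • t)) 1 =
          op r • BTensor.tmul P.R (ract P.R P.A P.S P.T t) 1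
        rw [BHom.map_op_smul, BTensor.smul_tmul, BTensor.op_smul_tmul, smul_eq_mul, mul_one,
          op_smul_eq_mul, one_mul] }
  have hp : ∀ x a, p (BTensor.tmul P.R x a) = BTensor.tmul P.R (op a • x) 1 := fun x a =>
    congrArg (fun y => BTensor.tmul P.R y (1 : P.R)) (ract_tmul x a)
  let q : BHom P.S P.R (BTensor P.R P.T (BTensor P.R P.A P.A)) (BTensor P.R P.T P.A) :=
    ((ract P.R P.A P.S P.T).tmap (BHom.id P.R P.R P.A)).comp
      (BHom.assocSymm P.S P.R P.R P.R P.T P.A P.A)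
  refine RightFaithfullyFlat.equaliser_of_split hH.flat_right _ _ _ p q ?_ ?_ ?_ ?_
  · intro t
    obtain ⟨x, rfl⟩ := BTensor.exists_eq_tmul_one t
    simp [hp]
  · intro t
    induction t using BTensor.induction_on with
    | zero => simp
    | simple m n => simp [q]
    | add a b ha hb => simp only [map_add, ha, hb]
  · intro t
    induction t using BTensor.induction_on with
    | zero => simp
    | simple m n => simp [q, hp]
    | add a b ha hb => simp only [map_add, ha, hb]
  · intro r
    rw [oneTmul_apply, tmulOne_apply, unitMap_apply]
    have h := BTensor.smul_tmul (1 : P.A) r (1 : P.A)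
    rwa [RingMap.op_smul_def, RingMap.smul_def, one_mul, mul_one, eq_comm] at h

/-- `S → B` is the equaliser of `b ↦ b ⊗ 1` and `b ↦ 1 ⊗ b`. -/
theorem unitMap_equaliser_left (hH : H.Tame) : Function.Injective (unitMap P.S P.B) ∧
    ∀ b, tmulOne P.S P.B P.S P.B b = oneTmul P.S P.B P.S P.B b → ∃ s, unitMap P.S P.B s = b := by
  let p : BHom P.S P.R (BTensor P.S P.B P.T) (BTensor P.S P.S P.T) :=
    { toAddMonoidHom := (BTensor.mk P.S P.S P.T 1).comp (lact P.S P.B P.R P.T).toAddMonoidHom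
      map_smul' := fun s t => by
        change BTensor.tmul P.S 1 (lact P.S P.B P.R P.T (s • t)) =
          s • BTensor.tmul P.S 1 (lact P.S P.B P.R P.T t)
        rw [BHom.map_smul, ← BTensor.smul_tmul, BTensor.smul_tmul', smul_eq_mul, mul_one,
          op_smul_eq_mul, one_mul]
      map_op_smul' := fun r t => by
        change BTensor.tmul P.S 1 (lact P.S P.B P.R P.T (op r • t)) =
          op r • BTensor.tmul P.S 1 (lact P.S P.B P.R P.T t)
        rw [BHom.map_op_smul, BTensor.op_smul_tmul] }
  have hp : ∀ b x, p (BTensor.tmul P.S b x) = BTensor.tmul P.S 1 (b • x) := fun b x =>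
    congrArg (fun y => BTensor.tmul P.S (1 : P.S) y) (lact_tmul b x)
  let q : BHom P.S P.R (BTensor P.S (BTensor P.S P.B P.B) P.T) (BTensor P.S P.B P.T) :=
    ((BHom.id P.S P.S P.B).tmap (lact P.S P.B P.R P.T)).comp
      (BHom.assoc P.S P.R P.S P.S P.B P.B P.T)
  refine LeftFaithfullyFlat.equaliser_of_split hH.flat_left _ _ _ p q ?_ ?_ ?_ ?_
  · intro t
    obtain ⟨x, rfl⟩ := BTensor.exists_eq_one_tmul t
    simp [hp]
  · intro t
    induction t using BTensor.induction_on with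
    | zero => simp
    | simple m n => simp [q]
    | add a b ha hb => simp only [map_add, ha, hb]
  · intro t
    induction t using BTensor.induction_on with
    | zero => simp
    | simple m n => simp [q, hp]
    | add a b ha hb => simp only [map_add, ha, hb]
  · intro r
    rw [oneTmul_apply, tmulOne_apply, unitMap_apply]
    have h := BTensor.smul_tmul (1 : P.B) r (1 : P.B)
    rwa [RingMap.op_smul_def, RingMap.smul_def, one_mul, mul_one] at h

/-- The counit of `C`. -/
def counitC (hH : H.Tame) : BHom P.R P.R H.C P.R :=
  BHom.factor (unitMap P.R P.A) hH.unitMap_equaliser_right.1 (F.evR.comp H.ιC) fun c => by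
    refine hH.unitMap_equaliser_right.2 _ ?_
    have h := H.id_tmap_evR_ξC (H.ιC c)
    rw [ξC_ιC] at h
    simpa using h

theorem unitMap_counitC (hH : H.Tame) (c : H.C) :
    unitMap P.R P.A (hH.counitC c) = F.ev (H.ιC c) :=
  BHom.apply_factor _ _ _ _ c

/-- The counit of `D`. -/
def counitD (hH : H.Tame) : BHom P.S P.S H.D P.S :=
  BHom.factor (unitMap P.S P.B) hH.unitMap_equaliser_left.1 (F.ev'S.comp H.ιD) fun d => by
    refine hH.unitMap_equaliser_left.2 _ ?_
    have h := H.ev'S_tmap_id_ξD (H.ιD d)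
    rw [ξD_ιD] at h
    simpa using h

theorem unitMap_counitD (hH : H.Tame) (d : H.D) :
    unitMap P.S P.B (hH.counitD d) = F.ev' (H.ιD d) :=
  BHom.apply_factor _ _ _ _ d

/-- The coring `C`. -/
def coringC (hH : H.Tame) : Coring P.R H.C where
  comul := hH.comulC
  counit := hH.counitC
  coassoc := hH.comulC_coassoc
  counit_left c := by
    -- In `A ⊗ T' ⊗ T` the counit becomes `ev` and the coproduct becomes `γr`, so the left side is
    -- `ξC c` and the axiom is the defining equation of `C`. The right counit axiom is instead a
    -- unit law of `γ`.
    apply unitMap_tmap_injective (A := P.A) H.ιC_injective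
    refine Eq.trans (BHom.tmap_tmap_congr (h := F.evR) (k := BHom.id P.R P.R P.T'T)
      (k' := H.ιC) hH.unitMap_counitC (fun _ => by rfl) _) ?_
    rw [ιC_tmap_ιC_comulC, ← ξC_apply, ξC_ιC]
    simp
  counit_right c := by
    apply tmap_unitMap_injective (A := P.A) H.ιC_injective
    refine Eq.trans (BHom.tmap_tmap_congr (k := F.evR) (h := BHom.id P.R P.R P.T'T)
      (h' := H.ιC) (fun _ => by rfl) hH.unitMap_counitC _) ?_
    rw [ιC_tmap_ιC_comulC, id_tmap_evR_γr]
    simp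

/-- The coring `D`. -/
def coringD (hH : H.Tame) : Coring P.S H.D where
  comul := hH.comulD
  counit := hH.counitD
  coassoc := hH.comulD_coassoc
  counit_left c := by
    apply unitMap_tmap_injective (A := P.B) H.ιD_injective
    refine Eq.trans (BHom.tmap_tmap_congr (h := F.ev'S) (k := BHom.id P.S P.S P.TT')
      (k' := H.ιD) hH.unitMap_counitD (fun _ => by rfl) _) ?_
    rw [ιD_tmap_ιD_comulD, ev'S_tmap_id_γl]
    simp
  counit_right c := by
    apply tmap_unitMap_injective (A := P.B) H.ιD_injective
    refine Eq.trans (BHom.tmap_tmap_congr (k := F.ev'S) (h := BHom.id P.S P.S P.TT')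
      (h' := H.ιD) (fun _ => by rfl) hH.unitMap_counitD _) ?_
    rw [ιD_tmap_ιD_comulD, ← ξD_apply, ξD_ιD]
    simp

end Tame

end BimoduleHerd

namespace BimoduleHerd

variable {P : BimodulePair.{u}} {F : FormalDual P} (H : BimoduleHerd F)

/-! ### Compatibility of the shepherd with the actions of `A` and `B` -/

/-- The second triangle identity turns `ev(x' ⊗ x) z' ⊗ y` into `x' ev'(x ⊗ z') ⊗ y`, for `x ⊗ z' ⊗
y` running through the terms of `γ`, and `unit_left` collapses the sum. -/
theorem lact_ξC (t : P.T'T) : lact P.R P.A P.R P.T'T (H.ξC t) = t := by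
  have h : ∀ (x' : P.T') (u : P.TT'T), lact P.R P.A P.R P.T'T (F.evR.tmap (BHom.id P.R P.R P.T'T)
      ((BTensor.assoc P.S P.R P.T' P.T P.T'T).symm (BTensor.tmul P.S x' u))) =
      (ract P.S P.B P.R P.T').tmap (BHom.id P.S P.R P.T)
        ((BTensor.assoc P.S P.S P.T' P.B P.T).symm (BTensor.tmul P.S x'
          (F.ev'S.tmap (BHom.id P.S P.R P.T) ((BTensor.assoc P.R P.S P.T P.T' P.T).symm u)))) := by
    intro x' u
    induction u using BTensor.induction_on_right with
    | zero => simp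
    | simple x z y => simp [F.triangle']
    | add a b ha hb => simp only [map_add, BTensor.tmul_add, ha, hb]
  induction t using BTensor.induction_on with
  | zero => simp
  | simple x' y => rw [ξC_apply, γr_tmul, h, ← γL_apply, ev'S_tmap_id_γL]; simp
  | add a b ha hb => simp only [map_add, ha, hb]

theorem ract_ξD (t : P.TT') : ract P.S P.B P.S P.TT' (H.ξD t) = t := by
  have h : ∀ (x' : P.T') (u : BTensor P.S P.TT' P.T),
      ract P.S P.B P.S P.TT' ((BHom.id P.S P.S P.TT').tmap F.ev'S
        (BTensor.assoc P.S P.R P.TT' P.T P.T' (BTensor.tmul P.R u x'))) =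
      (BHom.id P.S P.R P.T).tmap (lact P.R P.A P.S P.T')
        (BTensor.assoc P.R P.R P.T P.A P.T' (BTensor.tmul P.R
          ((BHom.id P.S P.R P.T).tmap F.evR (BTensor.assoc P.R P.S P.T P.T' P.T u)) x')) := by
    intro x' u
    induction u using BTensor.induction_on_left with
    | zero => simp
    | simple x z y => simp [F.triangle']
    | add a b ha hb => simp only [map_add, BTensor.add_tmul, ha, hb]
  induction t using BTensor.induction_on with
  | zero => simp
  | simple y x' => rw [ξD_apply, γl_tmul, h, assoc_γL, id_tmap_evR_γ]; simp
  | add a b ha hb => simp only [map_add, ha, hb]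

theorem γr_smul (a : P.A) (t : P.T'T) : H.γr (a • t) = a • H.γr t := by
  have h : ∀ (x' : P.T') (u : P.TT'T),
      (BTensor.assoc P.S P.R P.T' P.T P.T'T).symm (BTensor.tmul P.S (a • x') u) =
      a • (BTensor.assoc P.S P.R P.T' P.T P.T'T).symm (BTensor.tmul P.S x' u) := by
    intro x' u
    induction u using BTensor.induction_on with
    | zero => simp
    | simple x y => simp
    | add a b ha hb => simp only [map_add, BTensor.tmul_add, smul_add, ha, hb]
  induction t using BTensor.induction_on with
  | zero => simp
  | simple x' y => rw [BTensor.smul_tmul', γr_tmul, γr_tmul, h]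
  | add a b ha hb => simp only [map_add, smul_add, ha, hb]

theorem γl_op_smul (b : P.B) (t : P.TT') : H.γl (op b • t) = op b • H.γl t := by
  have h : ∀ (x' : P.T') (u : BTensor P.S P.TT' P.T),
      BTensor.assoc P.S P.R P.TT' P.T P.T' (BTensor.tmul P.R u (op b • x')) =
      op b • BTensor.assoc P.S P.R P.TT' P.T P.T' (BTensor.tmul P.R u x') := by
    intro x' u
    induction u using BTensor.induction_on with
    | zero => simp
    | simple x y => simp
    | add a b ha hb => simp only [map_add, BTensor.add_tmul, smul_add, ha, hb]
  induction t using BTensor.induction_on with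
  | zero => simp
  | simple y x' => rw [BTensor.op_smul_tmul, γl_tmul, γl_tmul, h]
  | add a b ha hb => simp only [map_add, smul_add, ha, hb]

/-- The map `t ↦ ξ_C(t a)`. -/
def ξCa (a : P.A) : P.T'T →ₗ[P.R] BTensor P.R P.A P.T'T where
  toFun t := H.ξC (op a • t)
  map_add' s t := by rw [smul_add, map_add]
  map_smul' r t := by rw [← smul_comm, H.ξC.map_smul]; rfl

@[simp] theorem ξCa_apply (a : P.A) (t : P.T'T) : H.ξCa a t = H.ξC (op a • t) := rfl

/-- The map `t ↦ ξ_D(b t)`. -/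
def ξDb (b : P.B) : P.TT' →ₗ[P.Sᵐᵒᵖ] BTensor P.S P.TT' P.B where
  toFun t := H.ξD (b • t)
  map_add' s t := by rw [smul_add, map_add]
  map_smul' r t := by rw [smul_comm b r t]; exact H.ξD.map_op_smul r.unop _

@[simp] theorem ξDb_apply (b : P.B) (t : P.TT') : H.ξDb b t = H.ξD (b • t) := rfl

/-- The map `y ↦ γ(y a)`. -/
def γa (a : P.A) : P.T →ₗ[P.S] P.TT'T where
  toFun t := H.γ (op a • t)
  map_add' s t := by rw [smul_add, map_add]
  map_smul' r t := by rw [← smul_comm, H.γ.map_smul]; rfl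

/-- The map `y ↦ γ(b y)`. -/
def γb (b : P.B) : P.T →ₗ[P.Rᵐᵒᵖ] BTensor P.S P.TT' P.T where
  toFun t := H.γL (b • t)
  map_add' s t := by rw [smul_add, map_add]
  map_smul' r t := by rw [smul_comm b r t]; exact H.γL.map_op_smul r.unop _

/-- By `absorbRight_ξC`, a term `z ⊗ x' ⊗ y` of `γ x` contributes `ev'(z ⊗ x') γ(ya)` to the right
side, and `unit_left` sums these to `γ(xa)`. This is the entwined module condition for `T` before
corestriction to `C`. As `ξCa` and `γa` respect only one of the two actions, they occur inside
`BTensor.map`. -/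
theorem γ_op_smul (a : P.A) (x : P.T) : H.γ (op a • x) =
    P.absorbRight (BTensor.map LinearMap.id (H.ξCa a) (H.γ x)) := by
  have h : ∀ u : P.TT'T, P.absorbRight (BTensor.map LinearMap.id (H.ξCa a) u) =
      leftAct P.S P.B P.TT'T (BTensor.map LinearMap.id (H.γa a)
        (F.ev'S.tmap (BHom.id P.S P.R P.T) ((BTensor.assoc P.R P.S P.T P.T' P.T).symm u))) := by
    intro u
    induction u using BTensor.induction_on_right with
    | zero => simp
    | simple x x' y => simp [absorbRight_ξC, γa]
    | add a b ha hb => simp only [map_add, ha, hb]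
  rw [h, ← γL_apply, ev'S_tmap_id_γL]
  simp [γa]

theorem γL_smul (b : P.B) (x : P.T) : H.γL (b • x) =
    P.absorbLeft (BTensor.map (H.ξDb b) LinearMap.id (H.γL x)) := by
  have h : ∀ u : BTensor P.S P.TT' P.T, P.absorbLeft (BTensor.map (H.ξDb b) LinearMap.id u) =
      rightAct P.R P.A (BTensor P.S P.TT' P.T) (BTensor.map (H.γb b) LinearMap.id
        ((BHom.id P.S P.R P.T).tmap F.evR (BTensor.assoc P.R P.S P.T P.T' P.T u))) := by
    intro u
    induction u using BTensor.induction_on_left with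
    | zero => simp
    | simple x x' y => simp [absorbLeft_ξD, γb]
    | add a b ha hb => simp only [map_add, ha, hb]
  rw [h, assoc_γL, id_tmap_evR_γ]
  simp [γb]

/-- `γ_op_smul` with a factor `T'` in front. In this form it becomes the comultiplication axiom of
the entwining. -/
theorem γr_op_smul (a : P.A) (t : P.T'T) : H.γr (op a • t) =
    (ract P.R P.A P.R P.T'T).tmap (BHom.id P.R P.R P.T'T)
      ((BTensor.assoc P.R P.R P.T'T P.A P.T'T).symm
        (BTensor.map LinearMap.id (H.ξCa a) (H.γr t))) := by
  have h₁ : ∀ (x' : P.T') (y : P.T) (w : BTensor P.R P.A P.T'T),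
      (ract P.R P.A P.R P.T'T).tmap (BHom.id P.R P.R P.T'T)
        ((BTensor.assoc P.R P.R P.T'T P.A P.T'T).symm
          (BTensor.tmul P.R (BTensor.tmul P.S x' y) w)) =
      (BTensor.assoc P.S P.R P.T' P.T P.T'T).symm
        (BTensor.tmul P.S x' (P.absorbRight (BTensor.tmul P.R y w))) := by
    intro x' y w
    induction w using BTensor.induction_on with
    | zero => simp
    | simple a s => simp
    | add a b ha hb => simp only [map_add, BTensor.tmul_add, ha, hb]
  have h₂ : ∀ (x' : P.T') (u : P.TT'T),
      (ract P.R P.A P.R P.T'T).tmap (BHom.id P.R P.R P.T'T)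
        ((BTensor.assoc P.R P.R P.T'T P.A P.T'T).symm (BTensor.map LinearMap.id (H.ξCa a)
          ((BTensor.assoc P.S P.R P.T' P.T P.T'T).symm (BTensor.tmul P.S x' u)))) =
      (BTensor.assoc P.S P.R P.T' P.T P.T'T).symm (BTensor.tmul P.S x'
        (P.absorbRight (BTensor.map LinearMap.id (H.ξCa a) u))) := by
    intro x' u
    induction u using BTensor.induction_on with
    | zero => simp
    | simple y s =>
      rw [BTensor.assoc_symm_tmul, BTensor.map_tmul, BTensor.map_tmul, LinearMap.id_apply,
        LinearMap.id_apply, h₁]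
    | add a b ha hb => simp only [map_add, BTensor.tmul_add, ha, hb]
  induction t using BTensor.induction_on with
  | zero => simp
  | simple x' y => rw [BTensor.op_smul_tmul, γr_tmul, γr_tmul, h₂, γ_op_smul]
  | add a b ha hb => simp only [map_add, smul_add, ha, hb]

theorem γl_smul (b : P.B) (t : P.TT') : H.γl (b • t) =
    (BHom.id P.S P.S P.TT').tmap (lact P.S P.B P.S P.TT')
      (BTensor.assoc P.S P.S P.TT' P.B P.TT'
        (BTensor.map (H.ξDb b) LinearMap.id (H.γl t))) := by
  have h₁ : ∀ (x' : P.T') (y : P.T) (w : BTensor P.S P.TT' P.B),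
      (BHom.id P.S P.S P.TT').tmap (lact P.S P.B P.S P.TT')
        (BTensor.assoc P.S P.S P.TT' P.B P.TT' (BTensor.tmul P.S w (BTensor.tmul P.R y x'))) =
      BTensor.assoc P.S P.R P.TT' P.T P.T'
        (BTensor.tmul P.R (P.absorbLeft (BTensor.tmul P.S w y)) x') := by
    intro x' y w
    induction w using BTensor.induction_on with
    | zero => simp
    | simple a s => simp
    | add a b ha hb => simp only [map_add, BTensor.add_tmul, ha, hb]
  have h₂ : ∀ (x' : P.T') (u : BTensor P.S P.TT' P.T),
      (BHom.id P.S P.S P.TT').tmap (lact P.S P.B P.S P.TT')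
        (BTensor.assoc P.S P.S P.TT' P.B P.TT' (BTensor.map (H.ξDb b) LinearMap.id
          (BTensor.assoc P.S P.R P.TT' P.T P.T' (BTensor.tmul P.R u x')))) =
      BTensor.assoc P.S P.R P.TT' P.T P.T' (BTensor.tmul P.R
        (P.absorbLeft (BTensor.map (H.ξDb b) LinearMap.id u)) x') := by
    intro x' u
    induction u using BTensor.induction_on with
    | zero => simp
    | simple y s =>
      rw [BTensor.assoc_tmul, BTensor.map_tmul, BTensor.map_tmul, LinearMap.id_apply,
        LinearMap.id_apply, h₁]
    | add a b ha hb => simp only [map_add, BTensor.add_tmul, ha, hb]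
  induction t using BTensor.induction_on with
  | zero => simp
  | simple y x' => rw [BTensor.smul_tmul', γl_tmul, γl_tmul, h₂, γL_smul]
  | add a b ha hb => simp only [map_add, smul_add, ha, hb]

theorem assoc_γ_tmap_id_γ (x : P.T) :
    BTensor.assoc P.R P.R P.T P.T'T P.T'T (H.γ.tmap (BHom.id P.R P.R P.T'T) (H.γ x)) =
      (BHom.id P.S P.R P.T).tmap H.γr (H.γ x) := by
  have h := congrArg ((BHom.id P.S P.R P.T).tmap (BHom.assocSymm P.R P.R P.S P.R P.T' P.T P.T'T))
    (H.coassoc x)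
  rw [BHom.tmap_tmap, BHom.tmap_eq_self (fun _ => rfl) (fun t => by simp)] at h
  rw [h, γr, BHom.id_tmap_comp]

theorem id_tmap_γL_γL (x : P.T) :
    (BTensor.assoc P.S P.S P.TT' P.TT' P.T).symm ((BHom.id P.S P.S P.TT').tmap H.γL (H.γL x)) =
      H.γl.tmap (BHom.id P.S P.R P.T) (H.γL x) := by
  have h := congrArg ((BHom.assoc P.S P.S P.S P.R P.TT' P.T P.T').tmap (BHom.id P.S P.R P.T))
    (H.γL_coassoc x)
  rw [BHom.tmap_tmap, BHom.tmap_eq_self (fun t => by simp) (fun _ => rfl)] at h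
  rw [h, ← BHom.tmap_id_comp]
  rfl

end BimoduleHerd

namespace BimoduleHerd

variable {P : BimodulePair.{u}} {F : FormalDual P} {H : BimoduleHerd F}

variable (H) in
/-- The map `A ⊗_R C → T' ⊗_S T`, `a ⊗ c ↦ a c`. -/
def actC : BHom P.R P.R (BTensor P.R P.A H.C) P.T'T :=
  (lact P.R P.A P.R P.T'T).comp ((BHom.id P.R P.R P.A).tmap H.ιC)

theorem actC_apply (w : BTensor P.R P.A H.C) :
    H.actC w = lact P.R P.A P.R P.T'T ((BHom.id P.R P.R P.A).tmap H.ιC w) := rfl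

@[simp] theorem actC_tmul (a : P.A) (c : H.C) : H.actC (BTensor.tmul P.R a c) = a • H.ιC c := by
  simp [actC]

variable (H) in
/-- The map `D ⊗_S B → T ⊗_R T'`, `d ⊗ b ↦ d b`. -/
def actD : BHom P.S P.S (BTensor P.S H.D P.B) P.TT' :=
  (ract P.S P.B P.S P.TT').comp (H.ιD.tmap (BHom.id P.S P.S P.B))

theorem actD_apply (w : BTensor P.S H.D P.B) :
    H.actD w = ract P.S P.B P.S P.TT' (H.ιD.tmap (BHom.id P.S P.S P.B) w) := rfl

@[simp] theorem actD_tmul (d : H.D) (b : P.B) :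
    H.actD (BTensor.tmul P.S d b) = op b • H.ιD d := by
  simp [actD]

namespace Tame

/-! ### The entwining structures -/

/-- The inverse of `A ⊗_R C → T' ⊗_S T`. -/
def actCInv (hH : H.Tame) : BHom P.R P.R P.T'T (BTensor P.R P.A H.C) :=
  (F.evR.tmap (BHom.id P.R P.R H.C)).comp hH.γrC

theorem id_tmap_ιC_actCInv (hH : H.Tame) (t : P.T'T) :
    (BHom.id P.R P.R P.A).tmap H.ιC (hH.actCInv t) = H.ξC t := by
  rw [actCInv, BHom.comp_apply, ← BHom.tmap_eq_right, BHom.tmap_eq_left, id_tmap_ιC_γrC, ξC_apply]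

theorem actC_actCInv (hH : H.Tame) (t : P.T'T) : H.actC (hH.actCInv t) = t := by
  rw [actC_apply, id_tmap_ιC_actCInv, lact_ξC]

/-- The action of `A` touches only the factor `T'`, and `ev` is left `A`-linear. Linearity reduces
`actCInv_actC` to elements of `C`. -/
theorem actCInv_smul (hH : H.Tame) (a : P.A) (t : P.T'T) :
    hH.actCInv (a • t) = a • hH.actCInv t := by
  have h : ∀ (x' : P.T') (u : BTensor P.R P.T H.C), F.evR.tmap (BHom.id P.R P.R H.C)
      ((BTensor.assoc P.S P.R P.T' P.T H.C).symm (BTensor.tmul P.S (a • x') u)) =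
      a • F.evR.tmap (BHom.id P.R P.R H.C)
        ((BTensor.assoc P.S P.R P.T' P.T H.C).symm (BTensor.tmul P.S x' u)) := by
    intro x' u
    induction u using BTensor.induction_on with
    | zero => simp
    | simple x c =>
      have e := (congrArg F.ev (BTensor.smul_tmul' (R := P.S) a x' x)).symm.trans
        (F.ev.map_smul a _)
      simp [e]
    | add a b ha hb => simp only [map_add, BTensor.tmul_add, smul_add, ha, hb]
  induction t using BTensor.induction_on with
  | zero => simp
  | simple x' y => simpa [actCInv, γrC] using h x' (hH.ρTC y)
  | add a b ha hb => simp only [map_add, smul_add, ha, hb]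

/-- On `C` the map `actCInv` is `(ev ⊗ C) ∘ Δ`. As `ev` on `C` is the counit followed by `R → A`,
the left counit axiom applies. -/
theorem actCInv_ιC (hH : H.Tame) (c : H.C) : hH.actCInv (H.ιC c) = BTensor.tmul P.R 1 c := by
  rw [actCInv, BHom.comp_apply, ← ιC_tmap_id_comulC]
  refine Eq.trans (BHom.tmap_tmap_congr (h := unitMap P.R P.A) (k := BHom.id P.R P.R H.C)
    (h' := hH.counitC) (k' := BHom.id P.R P.R H.C) (fun c => (hH.unitMap_counitC c).symm)
    (fun _ => rfl) _) ?_
  have h := hH.coringC.counit_left c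
  change hH.counitC.tmap (BHom.id P.R P.R H.C) (hH.comulC c) = _ at h
  rw [h, BHom.tmap_tmul, unitMap_one, BHom.id_apply]

theorem actCInv_actC (hH : H.Tame) (w : BTensor P.R P.A H.C) : hH.actCInv (H.actC w) = w := by
  induction w using BTensor.induction_on with
  | zero => simp
  | simple a c => rw [actC_tmul, actCInv_smul, actCInv_ιC]; simp
  | add a b ha hb => simp only [map_add, ha, hb]

theorem actC_isSplit (hH : H.Tame) : H.actC.IsSplit := ⟨hH.actCInv, hH.actCInv_actC⟩

/-- The entwining map `C ⊗_R A → A ⊗_R C`. -/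
def ψ (hH : H.Tame) : BHom P.R P.R (BTensor P.R H.C P.A) (BTensor P.R P.A H.C) :=
  hH.actCInv.comp ((ract P.R P.A P.R P.T'T).comp (H.ιC.tmap (BHom.id P.R P.R P.A)))

/-- Under the bijection `actC`, the map `ψ` is the right action of `A` on `T' ⊗_S T`. The entwining
axioms are verified in this form. -/
theorem actC_ψ (hH : H.Tame) (c : H.C) (a : P.A) :
    H.actC (hH.ψ (BTensor.tmul P.R c a)) = op a • H.ιC c := by
  simp [ψ, actC_actCInv]

theorem id_tmap_ιC_ψ (hH : H.Tame) (c : H.C) (a : P.A) :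
    (BHom.id P.R P.R P.A).tmap H.ιC (hH.ψ (BTensor.tmul P.R c a)) = H.ξC (op a • H.ιC c) := by
  simp [ψ, id_tmap_ιC_actCInv]

theorem actC_tmap_ιC_injective (hH : H.Tame) : Function.Injective (H.actC.tmap H.ιC) := by
  rw [BHom.tmap_comp_right]
  exact (hH.isSplit_T'T_ιC.comp hH.actC_isSplit.tmap_id).injective

/-- Under `actC`, the map `A ⊗ Δ` becomes `γr`, because `γr` is left `A`-linear and extends `Δ`. -/
theorem actC_tmap_ιC_comulC (hH : H.Tame) (w : BTensor P.R P.A H.C) :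
    H.actC.tmap H.ιC ((BTensor.assoc P.R P.R P.A H.C H.C).symm
      ((BHom.id P.R P.R P.A).tmap hH.comulC w)) = H.γr (H.actC w) := by
  have h : ∀ (a : P.A) (v : BTensor P.R H.C H.C),
      H.actC.tmap H.ιC ((BTensor.assoc P.R P.R P.A H.C H.C).symm (BTensor.tmul P.R a v)) =
      a • H.ιC.tmap H.ιC v := by
    intro a v
    induction v using BTensor.induction_on with
    | zero => simp
    | simple c c' => simp
    | add a b ha hb => simp only [map_add, BTensor.tmul_add, smul_add, ha, hb]
  induction w using BTensor.induction_on with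
  | zero => simp
  | simple a c =>
    rw [BHom.tmap_tmul, BHom.id_apply, h, ιC_tmap_ιC_comulC, actC_tmul, γr_smul]
  | add a b ha hb => simp only [map_add, ha, hb]

theorem actC_tmap_ιC_ψ (hH : H.Tame) (a : P.A) (v : BTensor P.R H.C H.C) :
    H.actC.tmap H.ιC (hH.ψ.tmap (BHom.id P.R P.R H.C) ((BTensor.assoc P.R P.R H.C P.A H.C).symm
      ((BHom.id P.R P.R H.C).tmap hH.ψ (BTensor.assoc P.R P.R H.C H.C P.A
        (BTensor.tmul P.R v a))))) =
    (ract P.R P.A P.R P.T'T).tmap (BHom.id P.R P.R P.T'T)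
      ((BTensor.assoc P.R P.R P.T'T P.A P.T'T).symm
        (BTensor.map LinearMap.id (H.ξCa a) (H.ιC.tmap H.ιC v))) := by
  have h : ∀ (c : H.C) (w : BTensor P.R P.A H.C),
      H.actC.tmap H.ιC (hH.ψ.tmap (BHom.id P.R P.R H.C)
        ((BTensor.assoc P.R P.R H.C P.A H.C).symm (BTensor.tmul P.R c w))) =
      (ract P.R P.A P.R P.T'T).tmap (BHom.id P.R P.R P.T'T)
        ((BTensor.assoc P.R P.R P.T'T P.A P.T'T).symm
          (BTensor.tmul P.R (H.ιC c) ((BHom.id P.R P.R P.A).tmap H.ιC w))) := by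
    intro c w
    induction w using BTensor.induction_on with
    | zero => simp
    | simple a c' => simp [actC_ψ]
    | add a b ha hb => simp only [map_add, BTensor.tmul_add, ha, hb]
  induction v using BTensor.induction_on with
  | zero => simp
  | simple c c' => simp [h, id_tmap_ιC_ψ]
  | add a b ha hb => simp only [map_add, BTensor.add_tmul, ha, hb]

/-- After `actC`, the multiplication axiom is associativity of the right `A`-action and its
commutation with the left one, the comultiplication axiom is `γr_op_smul`, and the counit axiom is
right `A`-linearity of `ev`. -/
theorem isRightEntwining (hH : H.Tame) : IsRightEntwining hH.coringC hH.ψ where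
  mul c a b := by
    apply hH.actC_isSplit.injective
    have h₁ : ∀ (a : P.A) (v : BTensor P.R P.A H.C),
        H.actC ((mulMap P.R P.A).tmap (BHom.id P.R P.R H.C)
          ((BTensor.assoc P.R P.R P.A P.A H.C).symm (BTensor.tmul P.R a v))) = a • H.actC v := by
      intro a v
      induction v using BTensor.induction_on with
      | zero => simp
      | simple c c' => simp [← mul_smul]
      | add a b ha hb => simp only [map_add, BTensor.tmul_add, smul_add, ha, hb]
    have h₂ : ∀ w : BTensor P.R P.A H.C, H.actC ((mulMap P.R P.A).tmap (BHom.id P.R P.R H.C)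
        ((BTensor.assoc P.R P.R P.A P.A H.C).symm ((BHom.id P.R P.R P.A).tmap hH.ψ
          (BTensor.assoc P.R P.R P.A H.C P.A (BTensor.tmul P.R w b))))) = op b • H.actC w := by
      intro w
      induction w using BTensor.induction_on with
      | zero => simp
      | simple c c' => simp [h₁, actC_ψ, smul_comm]
      | add a b ha hb => simp only [map_add, BTensor.add_tmul, smul_add, ha, hb]
    rw [h₂, actC_ψ, actC_ψ, op_mul, mul_smul]
  one c := by
    apply hH.actC_isSplit.injective
    rw [actC_ψ, actC_tmul, op_one, one_smul, one_smul]
  comul c a := by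
    apply (BTensor.assoc P.R P.R P.A H.C H.C).symm.injective
    rw [AddEquiv.symm_apply_apply]
    apply hH.actC_tmap_ιC_injective
    have h := hH.actC_tmap_ιC_ψ a (hH.comulC c)
    rw [ιC_tmap_ιC_comulC, ← γr_op_smul] at h
    refine Eq.trans ?_ h.symm
    refine (hH.actC_tmap_ιC_comulC _).trans ?_
    rw [actC_ψ]
  counit c a := by
    have h : ∀ w : BTensor P.R P.A H.C, (BHom.id P.R P.R P.A).tmap hH.counitC w =
        BTensor.tmul P.R (F.ev (H.actC w)) 1 := by
      intro w
      induction w using BTensor.induction_on with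
      | zero => simp
      | simple a c =>
        rw [BHom.tmap_tmul, actC_tmul, F.ev.map_smul, ← hH.unitMap_counitC, unitMap_apply,
          smul_eq_mul, ← RingMap.op_smul_def, BTensor.smul_tmul, smul_eq_mul, mul_one,
          BHom.id_apply]
      | add a b ha hb => simp only [map_add, BTensor.add_tmul, ha, hb]
    refine (h _).trans ?_
    rw [actC_ψ, F.ev.map_op_smul, ← hH.unitMap_counitC, unitMap_apply, RingMap.smul_def,
      op_smul_eq_mul]
    rfl

/-- Coassociativity, counit and compatibility are `assoc_γ_tmap_id_γ`, `id_tmap_evR_γ` and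
`γ_op_smul`, each read after an injection out of the corresponding tensor product with `C` or `R`.
-/
theorem isRightEntwinedModule_T (hH : H.Tame) :
    IsRightEntwinedModule hH.coringC hH.ψ hH.ρTC.r where
  comodule :=
    { coassoc := fun x => by
        apply hH.id_tmap_injective hH.ιC_tmap_ιC_injective
        change (BHom.id P.S P.R P.T).tmap (H.ιC.tmap H.ιC) (BTensor.assoc P.R P.R P.T H.C H.C
          (hH.ρTC.tmap (BHom.id P.R P.R H.C) (hH.ρTC x))) =
          (BHom.id P.S P.R P.T).tmap (H.ιC.tmap H.ιC) ((BHom.id P.S P.R P.T).tmap hH.comulC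
            (hH.ρTC x))
        rw [← BHom.assoc_tmap,
          BHom.tmap_tmap_congr (f := (BHom.id P.S P.R P.T).tmap H.ιC) (g := H.ιC)
            (f' := hH.ρTC) (g' := BHom.id P.R P.R H.C)
            (h := H.γ) (k := BHom.id P.R P.R P.T'T) (h' := BHom.id P.S P.R P.T) (k' := H.ιC)
            hH.ρTC_spec (fun _ => rfl),
          BHom.tmap_tmap_congr (f := BHom.id P.S P.R P.T) (g := H.ιC.tmap H.ιC)
            (f' := BHom.id P.S P.R P.T) (g' := hH.comulC)
            (h := BHom.id P.S P.R P.T) (k := H.γr) (h' := BHom.id P.S P.R P.T) (k' := H.ιC)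
            (fun _ => rfl) hH.ιC_tmap_ιC_comulC, ρTC_spec, assoc_γ_tmap_id_γ]
      counit := fun x => by
        apply tmap_unitMap_injective (A := P.A) (f := BHom.id P.S P.R P.T) Function.injective_id
        change (BHom.id P.S P.R P.T).tmap (unitMap P.R P.A)
          ((BHom.id P.S P.R P.T).tmap hH.counitC (hH.ρTC x)) = _
        rw [BHom.tmap_tmap_congr (f := BHom.id P.S P.R P.T) (g := unitMap P.R P.A)
            (f' := BHom.id P.S P.R P.T) (g' := hH.counitC)
            (h := BHom.id P.S P.R P.T) (k := F.evR) (h' := BHom.id P.S P.R P.T) (k' := H.ιC)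
            (fun _ => rfl) hH.unitMap_counitC, ρTC_spec, id_tmap_evR_γ]
        simp }
  compat x a := by
    apply hH.id_tmap_injective H.ιC_injective
    have h₁ : ∀ (x : P.T) (w : BTensor P.R P.A H.C),
        (BHom.id P.S P.R P.T).tmap H.ιC (BTensor.map (rightAct P.R P.A P.T) LinearMap.id
          ((BTensor.assoc P.R P.R P.T P.A H.C).symm (BTensor.tmul P.R x w))) =
        P.absorbRight (BTensor.tmul P.R x ((BHom.id P.R P.R P.A).tmap H.ιC w)) := by
      intro x w
      induction w using BTensor.induction_on with
      | zero => simp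
      | simple a c' => simp
      | add a b ha hb => simp only [map_add, BTensor.tmul_add, ha, hb]
    have h₂ : ∀ v : BTensor P.R P.T H.C,
        (BHom.id P.S P.R P.T).tmap H.ιC (BTensor.map (rightAct P.R P.A P.T) LinearMap.id
          ((BTensor.assoc P.R P.R P.T P.A H.C).symm (BTensor.map LinearMap.id hH.ψ.l
            (BTensor.assoc P.R P.R P.T H.C P.A (BTensor.tmul P.R v a))))) =
        P.absorbRight (BTensor.map LinearMap.id (H.ξCa a)
          ((BHom.id P.S P.R P.T).tmap H.ιC v)) := by
      intro v
      induction v using BTensor.induction_on with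
      | zero => simp
      | simple x c => simp [h₁, id_tmap_ιC_ψ]
      | add a b ha hb => simp only [map_add, BTensor.add_tmul, ha, hb]
    rw [h₂, BHom.r_apply, BHom.r_apply, ρTC_spec, ρTC_spec, γ_op_smul]

/-- The inverse of `D ⊗_S B → T ⊗_R T'`. -/
def actDInv (hH : H.Tame) : BHom P.S P.S P.TT' (BTensor P.S H.D P.B) :=
  ((BHom.id P.S P.S H.D).tmap F.ev'S).comp hH.γlD

theorem ιD_tmap_id_actDInv (hH : H.Tame) (t : P.TT') :
    H.ιD.tmap (BHom.id P.S P.S P.B) (hH.actDInv t) = H.ξD t := by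
  rw [actDInv, BHom.comp_apply, ← BHom.tmap_eq_left, BHom.tmap_eq_right, ιD_tmap_id_γlD, ξD_apply]

theorem actD_actDInv (hH : H.Tame) (t : P.TT') : H.actD (hH.actDInv t) = t := by
  rw [actD_apply, ιD_tmap_id_actDInv, ract_ξD]

theorem actDInv_op_smul (hH : H.Tame) (b : P.B) (t : P.TT') :
    hH.actDInv (op b • t) = op b • hH.actDInv t := by
  have h : ∀ (x' : P.T') (u : BTensor P.S H.D P.T), (BHom.id P.S P.S H.D).tmap F.ev'S
      (BTensor.assoc P.S P.R H.D P.T P.T' (BTensor.tmul P.R u (op b • x'))) =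
      op b • (BHom.id P.S P.S H.D).tmap F.ev'S
        (BTensor.assoc P.S P.R H.D P.T P.T' (BTensor.tmul P.R u x')) := by
    intro x' u
    induction u using BTensor.induction_on with
    | zero => simp
    | simple c x =>
      have e := (congrArg F.ev' (BTensor.op_smul_tmul (R := P.R) (op b) x x')).symm.trans
        (F.ev'.map_op_smul b _)
      simp [e]
    | add a b ha hb => simp only [map_add, BTensor.add_tmul, smul_add, ha, hb]
  induction t using BTensor.induction_on with
  | zero => simp
  | simple y x' => simpa [actDInv, γlD] using h x' (hH.ρTD y)
  | add a b ha hb => simp only [map_add, smul_add, ha, hb]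

theorem actDInv_ιD (hH : H.Tame) (d : H.D) : hH.actDInv (H.ιD d) = BTensor.tmul P.S d 1 := by
  rw [actDInv, BHom.comp_apply, ← id_tmap_ιD_comulD]
  refine Eq.trans (BHom.tmap_tmap_congr (k := unitMap P.S P.B) (h := BHom.id P.S P.S H.D)
    (k' := hH.counitD) (h' := BHom.id P.S P.S H.D)
    (fun _ => rfl) (fun c => (hH.unitMap_counitD c).symm) _) ?_
  have h := hH.coringD.counit_right d
  change (BHom.id P.S P.S H.D).tmap hH.counitD (hH.comulD d) = _ at h
  rw [h, BHom.tmap_tmul, unitMap_one, BHom.id_apply]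

theorem actDInv_actD (hH : H.Tame) (w : BTensor P.S H.D P.B) : hH.actDInv (H.actD w) = w := by
  induction w using BTensor.induction_on with
  | zero => simp
  | simple d b => rw [actD_tmul, actDInv_op_smul, actDInv_ιD]; simp
  | add a b ha hb => simp only [map_add, ha, hb]

theorem actD_isSplit (hH : H.Tame) : H.actD.IsSplit := ⟨hH.actDInv, hH.actDInv_actD⟩

/-- The entwining map `B ⊗_S D → D ⊗_S B`. -/
def φ (hH : H.Tame) : BHom P.S P.S (BTensor P.S P.B H.D) (BTensor P.S H.D P.B) :=
  hH.actDInv.comp ((lact P.S P.B P.S P.TT').comp ((BHom.id P.S P.S P.B).tmap H.ιD))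

theorem actD_φ (hH : H.Tame) (b : P.B) (d : H.D) :
    H.actD (hH.φ (BTensor.tmul P.S b d)) = b • H.ιD d := by
  simp [φ, actD_actDInv]

theorem ιD_tmap_id_φ (hH : H.Tame) (b : P.B) (d : H.D) :
    H.ιD.tmap (BHom.id P.S P.S P.B) (hH.φ (BTensor.tmul P.S b d)) = H.ξD (b • H.ιD d) := by
  simp [φ, ιD_tmap_id_actDInv]

/-- The composite `D ⊗ (D ⊗ B) → D ⊗ TT' → TT' ⊗ TT'` is split at both stages. The comultiplication
axiom for `φ` is compared in the last term. -/
theorem ιD_tmap_actD_injective (hH : H.Tame) : Function.Injective (H.ιD.tmap H.actD) := by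
  rw [BHom.tmap_comp_left]
  exact (hH.isSplit_ιD_TT'.comp hH.actD_isSplit.id_tmap).injective

theorem ιD_tmap_actD_comulD (hH : H.Tame) (w : BTensor P.S H.D P.B) :
    H.ιD.tmap H.actD (BTensor.assoc P.S P.S H.D H.D P.B
      (hH.comulD.tmap (BHom.id P.S P.S P.B) w)) = H.γl (H.actD w) := by
  have h : ∀ (b : P.B) (v : BTensor P.S H.D H.D),
      H.ιD.tmap H.actD (BTensor.assoc P.S P.S H.D H.D P.B (BTensor.tmul P.S v b)) =
      op b • H.ιD.tmap H.ιD v := by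
    intro a v
    induction v using BTensor.induction_on with
    | zero => simp
    | simple c c' => simp
    | add a b ha hb => simp only [map_add, BTensor.add_tmul, smul_add, ha, hb]
  induction w using BTensor.induction_on with
  | zero => simp
  | simple d b =>
    rw [BHom.tmap_tmul, BHom.id_apply, h, ιD_tmap_ιD_comulD, actD_tmul, γl_op_smul]
  | add a b ha hb => simp only [map_add, ha, hb]

theorem ιD_tmap_actD_φ (hH : H.Tame) (b : P.B) (v : BTensor P.S H.D H.D) :
    H.ιD.tmap H.actD ((BHom.id P.S P.S H.D).tmap hH.φ (BTensor.assoc P.S P.S H.D P.B H.D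
      (hH.φ.tmap (BHom.id P.S P.S H.D) ((BTensor.assoc P.S P.S P.B H.D H.D).symm
        (BTensor.tmul P.S b v))))) =
    (BHom.id P.S P.S P.TT').tmap (lact P.S P.B P.S P.TT')
      (BTensor.assoc P.S P.S P.TT' P.B P.TT'
        (BTensor.map (H.ξDb b) LinearMap.id (H.ιD.tmap H.ιD v))) := by
  have h : ∀ (d : H.D) (w : BTensor P.S H.D P.B),
      H.ιD.tmap H.actD ((BHom.id P.S P.S H.D).tmap hH.φ
        (BTensor.assoc P.S P.S H.D P.B H.D (BTensor.tmul P.S w d))) =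
      (BHom.id P.S P.S P.TT').tmap (lact P.S P.B P.S P.TT')
        (BTensor.assoc P.S P.S P.TT' P.B P.TT'
          (BTensor.tmul P.S (H.ιD.tmap (BHom.id P.S P.S P.B) w) (H.ιD d))) := by
    intro c w
    induction w using BTensor.induction_on with
    | zero => simp
    | simple a c' => simp [actD_φ]
    | add a b ha hb => simp only [map_add, BTensor.add_tmul, ha, hb]
  induction v using BTensor.induction_on with
  | zero => simp
  | simple c c' => simp [h, ιD_tmap_id_φ]
  | add a b ha hb => simp only [map_add, BTensor.tmul_add, ha, hb]

theorem isLeftEntwining (hH : H.Tame) : IsLeftEntwining hH.coringD hH.φ where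
  mul a b d := by
    apply hH.actD_isSplit.injective
    have h₁ : ∀ (a : P.B) (v : BTensor P.S H.D P.B),
        H.actD ((BHom.id P.S P.S H.D).tmap (mulMap P.S P.B)
          (BTensor.assoc P.S P.S H.D P.B P.B (BTensor.tmul P.S v a))) = op a • H.actD v := by
      intro a v
      induction v using BTensor.induction_on with
      | zero => simp
      | simple c c' => simp [← mul_smul]
      | add a b ha hb => simp only [map_add, BTensor.add_tmul, smul_add, ha, hb]
    have h₂ : ∀ w : BTensor P.S H.D P.B, H.actD ((BHom.id P.S P.S H.D).tmap (mulMap P.S P.B)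
        (BTensor.assoc P.S P.S H.D P.B P.B (hH.φ.tmap (BHom.id P.S P.S P.B)
          ((BTensor.assoc P.S P.S P.B H.D P.B).symm (BTensor.tmul P.S a w))))) =
        a • H.actD w := by
      intro w
      induction w using BTensor.induction_on with
      | zero => simp
      | simple c c' => simp [h₁, actD_φ, smul_comm]
      | add a b ha hb => simp only [map_add, BTensor.tmul_add, smul_add, ha, hb]
    rw [h₂, actD_φ, actD_φ, mul_smul]
  one c := by
    apply hH.actD_isSplit.injective
    rw [actD_φ, actD_tmul, op_one, one_smul, one_smul]
  comul b d := by
    apply (BTensor.assoc P.S P.S H.D H.D P.B).injective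
    rw [AddEquiv.apply_symm_apply]
    apply hH.ιD_tmap_actD_injective
    have h := hH.ιD_tmap_actD_φ b (hH.comulD d)
    rw [ιD_tmap_ιD_comulD, ← γl_smul] at h
    refine Eq.trans ?_ h.symm
    refine (hH.ιD_tmap_actD_comulD _).trans ?_
    rw [actD_φ]
  counit b d := by
    have h : ∀ w : BTensor P.S H.D P.B, hH.counitD.tmap (BHom.id P.S P.S P.B) w =
        BTensor.tmul P.S 1 (F.ev' (H.actD w)) := by
      intro w
      induction w using BTensor.induction_on with
      | zero => simp
      | simple d b =>
        rw [BHom.tmap_tmul, actD_tmul, F.ev'.map_op_smul, ← hH.unitMap_counitD, unitMap_apply,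
          op_smul_eq_mul, ← RingMap.smul_def, ← BTensor.smul_tmul, op_smul_eq_mul, one_mul,
          BHom.id_apply]
      | add a b ha hb => simp only [map_add, BTensor.tmul_add, ha, hb]
    refine (h _).trans ?_
    rw [actD_φ, F.ev'.map_smul, ← hH.unitMap_counitD, unitMap_apply, RingMap.op_smul_def,
      smul_eq_mul]
    rfl

theorem isLeftEntwinedModule_T (hH : H.Tame) :
    IsLeftEntwinedModule hH.coringD hH.φ hH.ρTD.l where
  comodule :=
    { coassoc := fun x => by
        apply hH.tmap_id_injective hH.ιD_tmap_ιD_injective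
        change (H.ιD.tmap H.ιD).tmap (BHom.id P.S P.R P.T) ((BTensor.assoc P.S P.S H.D H.D P.T).symm
          ((BHom.id P.S P.S H.D).tmap hH.ρTD (hH.ρTD x))) =
          (H.ιD.tmap H.ιD).tmap (BHom.id P.S P.R P.T) (hH.comulD.tmap (BHom.id P.S P.R P.T)
            (hH.ρTD x))
        rw [← BHom.assoc_symm_tmap,
          BHom.tmap_tmap_congr (g := H.ιD.tmap (BHom.id P.S P.R P.T)) (f := H.ιD)
            (g' := hH.ρTD) (f' := BHom.id P.S P.S H.D)
            (k := H.γL) (h := BHom.id P.S P.S P.TT') (k' := BHom.id P.S P.R P.T) (h' := H.ιD)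
            (fun _ => rfl) hH.ρTD_spec,
          BHom.tmap_tmap_congr (g := BHom.id P.S P.R P.T) (f := H.ιD.tmap H.ιD)
            (g' := BHom.id P.S P.R P.T) (f' := hH.comulD)
            (k := BHom.id P.S P.R P.T) (h := H.γl) (k' := BHom.id P.S P.R P.T) (h' := H.ιD)
            hH.ιD_tmap_ιD_comulD (fun _ => rfl), ρTD_spec, id_tmap_γL_γL]
      counit := fun x => by
        apply unitMap_tmap_injective (A := P.B) (f := BHom.id P.S P.R P.T) Function.injective_id
        change (unitMap P.S P.B).tmap (BHom.id P.S P.R P.T)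
          (hH.counitD.tmap (BHom.id P.S P.R P.T) (hH.ρTD x)) = _
        rw [BHom.tmap_tmap_congr (g := BHom.id P.S P.R P.T) (f := unitMap P.S P.B)
            (g' := BHom.id P.S P.R P.T) (f' := hH.counitD)
            (k := BHom.id P.S P.R P.T) (h := F.ev'S) (k' := BHom.id P.S P.R P.T) (h' := H.ιD)
            hH.unitMap_counitD (fun _ => rfl), ρTD_spec, ev'S_tmap_id_γL]
        simp }
  compat b x := by
    apply hH.tmap_id_injective H.ιD_injective
    have h₁ : ∀ (x : P.T) (w : BTensor P.S H.D P.B),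
        H.ιD.tmap (BHom.id P.S P.R P.T) (BTensor.map LinearMap.id (leftAct P.S P.B P.T)
          (BTensor.assoc P.S P.S H.D P.B P.T (BTensor.tmul P.S w x))) =
        P.absorbLeft (BTensor.tmul P.S (H.ιD.tmap (BHom.id P.S P.S P.B) w) x) := by
      intro x w
      induction w using BTensor.induction_on with
      | zero => simp
      | simple a c' => simp
      | add a b ha hb => simp only [map_add, BTensor.add_tmul, ha, hb]
    have h₂ : ∀ v : BTensor P.S H.D P.T,
        H.ιD.tmap (BHom.id P.S P.R P.T) (BTensor.map LinearMap.id (leftAct P.S P.B P.T)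
          (BTensor.assoc P.S P.S H.D P.B P.T (BTensor.map hH.φ.r LinearMap.id
            ((BTensor.assoc P.S P.S P.B H.D P.T).symm (BTensor.tmul P.S b v))))) =
        P.absorbLeft (BTensor.map (H.ξDb b) LinearMap.id
          (H.ιD.tmap (BHom.id P.S P.R P.T) v)) := by
      intro v
      induction v using BTensor.induction_on with
      | zero => simp
      | simple x c => simp [h₁, ιD_tmap_id_φ]
      | add a b ha hb => simp only [map_add, BTensor.tmul_add, ha, hb]
    rw [h₂, BHom.l_apply, BHom.l_apply, ρTD_spec, ρTD_spec, γL_smul]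

end Tame

end BimoduleHerd

/-! ### Free entwined modules -/

section Right

variable {R A C : Type*} [Ring R] [Ring A] [RingMap R A]
  [AddCommGroup C] [Module R C] [Module Rᵐᵒᵖ C] [SMulCommClass R Rᵐᵒᵖ C]

theorem rightEntwinedCoaction_tmul (cC : Coring R C)
    (ψ : BHom R R (BTensor R C A) (BTensor R A C)) (c : C) (a : A) :
    rightEntwinedCoaction cC ψ (BTensor.tmul R c a) = (BTensor.assoc R R C A C).symm
      ((BHom.id R R C).tmap ψ (BTensor.assoc R R C C A (BTensor.tmul R (cC.comul c) a))) := by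
  simp [rightEntwinedCoaction]

/-- The map `C ⊗_R (A ⊗_R C) → A ⊗_R (C ⊗_R C)` induced by `ψ`. -/
def entwineRight (ψ : BHom R R (BTensor R C A) (BTensor R A C)) :
    BHom R R (BTensor R C (BTensor R A C)) (BTensor R A (BTensor R C C)) :=
  (BHom.assoc R R R R A C C).comp ((ψ.tmap (BHom.id R R C)).comp (BHom.assocSymm R R R R C A C))

/-- The map `w ↦ (ψ ⊗ C)(C ⊗ ψ)(w ⊗ a)`. -/
def entwineRightTwice (ψ : BHom R R (BTensor R C A) (BTensor R A C)) (a : A) :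
    BTensor R C C →ₗ[R] BTensor R A (BTensor R C C) where
  toFun w := entwineRight ψ
    ((BHom.id R R C).tmap ψ (BTensor.assoc R R C C A (BTensor.tmul R w a)))
  map_add' s t := by simp only [BTensor.add_tmul, map_add]
  map_smul' r t := by
    rw [← BTensor.smul_tmul', ← BHom.map_smul, ← BHom.map_smul]
    exact congrArg (fun z => entwineRight ψ ((BHom.id R R C).tmap ψ z))
      ((BHom.assoc R R R R C C A).map_smul r _)

/-- This is a fact about arbitrary entwining structures. For coassociativity, both sides are
`entwineRightTwice` applied to an iterated coproduct: on one side this uses the axiom `comul`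
(`hR`), on the other only naturality and rebracketing (`hL`), and coassociativity of the coring
identifies the two. The counit and compatibility conditions use the axioms `counit` and `mul`. -/
theorem IsRightEntwining.isRightEntwinedModule {cC : Coring R C}
    {ψ : BHom R R (BTensor R C A) (BTensor R A C)} (h : IsRightEntwining cC ψ) :
    IsRightEntwinedModule cC ψ (rightEntwinedCoaction cC ψ).r where
  comodule :=
    { coassoc := fun t => by
        change BTensor.assoc R R (BTensor R C A) C C ((rightEntwinedCoaction cC ψ).tmap
          (BHom.id R R C) (rightEntwinedCoaction cC ψ t)) =
          (BHom.id R R (BTensor R C A)).tmap cC.comul (rightEntwinedCoaction cC ψ t)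
        have e : BHom.id R R (BTensor R C A) = (BHom.id R R C).tmap (BHom.id R R A) :=
          BHom.ext fun t => (BHom.tmap_id t).symm
        have hR : ∀ (a : A) (v : BTensor R C C), (BHom.id R R (BTensor R C A)).tmap cC.comul
            ((BTensor.assoc R R C A C).symm ((BHom.id R R C).tmap ψ
              (BTensor.assoc R R C C A (BTensor.tmul R v a)))) =
            (BTensor.assoc R R C A (BTensor R C C)).symm (BTensor.map LinearMap.id
              (entwineRightTwice ψ a) ((BHom.id R R C).tmap cC.comul v)) := by
          intro a v
          induction v using BTensor.induction_on with
          | zero => simp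
          | simple c c' =>
            rw [e, ← BHom.assoc_symm_tmap, BTensor.assoc_tmul, BHom.tmap_tmul, BHom.tmap_tmul,
              h.comul]
            simp [entwineRightTwice, entwineRight]
          | add a b ha hb => simp only [map_add, BTensor.add_tmul, ha, hb]
        have h₁ : ∀ (c c' : C) (p : BTensor R A C),
            BTensor.assoc R R (BTensor R C A) C C (BTensor.tmul R
              ((BTensor.assoc R R C A C).symm (BTensor.tmul R c p)) c') =
            (BTensor.assoc R R C A (BTensor R C C)).symm (BTensor.tmul R c
              (BTensor.assoc R R A C C (BTensor.tmul R p c'))) := by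
          intro c c' p
          induction p using BTensor.induction_on with
          | zero => simp
          | simple a c' => simp
          | add a b ha hb => simp only [map_add, BTensor.add_tmul, BTensor.tmul_add, ha, hb]
        have h₂ : ∀ (a : A) (c : C) (w : BTensor R C C),
            BTensor.assoc R R (BTensor R C A) C C (BTensor.tmul R
              ((BTensor.assoc R R C A C).symm ((BHom.id R R C).tmap ψ
                (BTensor.assoc R R C C A (BTensor.tmul R w a)))) c) =
            (BTensor.assoc R R C A (BTensor R C C)).symm ((BHom.id R R C).tmap (entwineRight ψ)
              (BTensor.assoc R R C C (BTensor R A C)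
                (BTensor.tmul R w (BTensor.tmul R a c)))) := by
          intro a c w
          induction w using BTensor.induction_on with
          | zero => simp
          | simple c c' => simp [entwineRight, h₁]
          | add a b ha hb => simp only [map_add, BTensor.add_tmul, ha, hb]
        have h₃ : ∀ (c : C) (u : BTensor R A C),
            BTensor.assoc R R (BTensor R C A) C C ((rightEntwinedCoaction cC ψ).tmap
              (BHom.id R R C) ((BTensor.assoc R R C A C).symm (BTensor.tmul R c u))) =
            (BTensor.assoc R R C A (BTensor R C C)).symm ((BHom.id R R C).tmap (entwineRight ψ)
              (BTensor.assoc R R C C (BTensor R A C) (BTensor.tmul R (cC.comul c) u))) := by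
          intro c u
          induction u using BTensor.induction_on with
          | zero => simp
          | simple a c' => simp [rightEntwinedCoaction_tmul, h₂]
          | add a b ha hb => simp only [map_add, BTensor.tmul_add, ha, hb]
        have h₄ : ∀ (a : A) (c : C) (w : BTensor R C C),
            (BHom.id R R C).tmap (entwineRight ψ)
              (BTensor.assoc R R C C (BTensor R A C)
                (BTensor.tmul R w (ψ (BTensor.tmul R c a)))) =
            BTensor.map LinearMap.id (entwineRightTwice ψ a)
              (BTensor.assoc R R C C C (BTensor.tmul R w c)) := by
          intro a c w
          induction w using BTensor.induction_on with
          | zero => simp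
          | simple c c' => simp [entwineRightTwice]
          | add a b ha hb => simp only [map_add, BTensor.add_tmul, ha, hb]
        have hL : ∀ (a : A) (v : BTensor R C C),
            BTensor.assoc R R (BTensor R C A) C C ((rightEntwinedCoaction cC ψ).tmap
              (BHom.id R R C) ((BTensor.assoc R R C A C).symm ((BHom.id R R C).tmap ψ
                (BTensor.assoc R R C C A (BTensor.tmul R v a))))) =
            (BTensor.assoc R R C A (BTensor R C C)).symm (BTensor.map LinearMap.id
              (entwineRightTwice ψ a) (BTensor.assoc R R C C C
                (cC.comul.tmap (BHom.id R R C) v))) := by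
          intro a v
          induction v using BTensor.induction_on with
          | zero => simp
          | simple c c' =>
            rw [BTensor.assoc_tmul, BHom.tmap_tmul, BHom.id_apply, h₃, h₄, BHom.tmap_tmul,
              BHom.id_apply]
          | add a b ha hb => simp only [map_add, BTensor.add_tmul, ha, hb]
        induction t using BTensor.induction_on with
        | zero => simp
        | simple c a => rw [rightEntwinedCoaction_tmul, hR, hL, cC.coassoc]
        | add a b ha hb => simp only [map_add, ha, hb]
      counit := fun t => by
        change (BHom.id R R (BTensor R C A)).tmap cC.counit (rightEntwinedCoaction cC ψ t) = _
        have e : BHom.id R R (BTensor R C A) = (BHom.id R R C).tmap (BHom.id R R A) :=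
          BHom.ext fun t => (BHom.tmap_id t).symm
        -- The axiom `counit` moves the counit from after `ψ` to before it: a term `c ⊗ c'` of `v`
        -- contributes `c ⊗ ε(c') a ⊗ 1`, so the right counit axiom of the coring can be applied to
        -- `v`.
        have hv : ∀ (a : A) (v : BTensor R C C), (BHom.id R R (BTensor R C A)).tmap cC.counit
            ((BTensor.assoc R R C A C).symm ((BHom.id R R C).tmap ψ
              (BTensor.assoc R R C C A (BTensor.tmul R v a)))) =
            BTensor.tmul R (BTensor.map LinearMap.id (LinearMap.toSpanSingleton R A a)
              ((BHom.id R R C).tmap cC.counit v)) 1 := by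
          intro a v
          induction v using BTensor.induction_on with
          | zero => simp
          | simple c c' =>
            rw [e, ← BHom.assoc_symm_tmap, BTensor.assoc_tmul, BHom.tmap_tmul, BHom.tmap_tmul,
              h.counit]
            simp
          | add a b ha hb => simp only [map_add, BTensor.add_tmul, ha, hb]
        induction t using BTensor.induction_on with
        | zero => simp
        | simple c a => rw [rightEntwinedCoaction_tmul, hv, cC.counit_right]; simp
        | add a b ha hb => simp only [map_add, BTensor.add_tmul, ha, hb] }
  compat t a := by
    have h₁ : ∀ (c : C) (a : A) (q : BTensor R A C),
        BTensor.map (rightAct R A (BTensor R C A)) (LinearMap.id : C →ₗ[R] C)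
          ((BTensor.assoc R R (BTensor R C A) A C).symm
            (BTensor.tmul R (BTensor.tmul R c a) q)) =
        (BTensor.assoc R R C A C).symm (BTensor.tmul R c ((mulMap R A).tmap (BHom.id R R C)
          ((BTensor.assoc R R A A C).symm (BTensor.tmul R a q)))) := by
      intro c a q
      induction q using BTensor.induction_on with
      | zero => simp
      | simple c c' => simp
      | add a b ha hb => simp only [map_add, BTensor.tmul_add, ha, hb]
    have h₂ : ∀ (c : C) (p : BTensor R A C),
        BTensor.map (rightAct R A (BTensor R C A)) (LinearMap.id : C →ₗ[R] C)
          ((BTensor.assoc R R (BTensor R C A) A C).symm (BTensor.map LinearMap.id ψ.l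
            (BTensor.assoc R R (BTensor R C A) C A (BTensor.tmul R
              ((BTensor.assoc R R C A C).symm (BTensor.tmul R c p)) a)))) =
        (BTensor.assoc R R C A C).symm (BTensor.tmul R c ((mulMap R A).tmap (BHom.id R R C)
          ((BTensor.assoc R R A A C).symm ((BHom.id R R A).tmap ψ (BTensor.assoc R R A C A
            (BTensor.tmul R p a)))))) := by
      intro c p
      induction p using BTensor.induction_on with
      | zero => simp
      | simple c c' => simp [h₁]
      | add a b ha hb => simp only [map_add, BTensor.add_tmul, BTensor.tmul_add, ha, hb]
    have h₃ : ∀ (b : A) (v : BTensor R C C),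
        BTensor.map (rightAct R A (BTensor R C A)) (LinearMap.id : C →ₗ[R] C)
          ((BTensor.assoc R R (BTensor R C A) A C).symm (BTensor.map LinearMap.id ψ.l
            (BTensor.assoc R R (BTensor R C A) C A (BTensor.tmul R
              ((BTensor.assoc R R C A C).symm ((BHom.id R R C).tmap ψ
                (BTensor.assoc R R C C A (BTensor.tmul R v b)))) a)))) =
        (BTensor.assoc R R C A C).symm ((BHom.id R R C).tmap ψ
          (BTensor.assoc R R C C A (BTensor.tmul R v (b * a)))) := by
      intro b v
      induction v using BTensor.induction_on with
      | zero => simp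
      | simple c c' =>
        rw [BTensor.assoc_tmul, BHom.tmap_tmul, BHom.id_apply, h₂, ← h.mul]
        simp
      | add a b ha hb => simp only [map_add, BTensor.add_tmul, ha, hb]
    simp only [BHom.r_apply]
    induction t using BTensor.induction_on with
    | zero => simp
    | simple c b =>
      rw [BTensor.op_smul_tmul, op_smul_eq_mul, rightEntwinedCoaction_tmul,
        rightEntwinedCoaction_tmul, h₃]
    | add a b ha hb => simp only [smul_add, map_add, BTensor.add_tmul, ha, hb]

end Right

section Left

variable {S B D : Type*} [Ring S] [Ring B] [RingMap S B]
  [AddCommGroup D] [Module S D] [Module Sᵐᵒᵖ D] [SMulCommClass S Sᵐᵒᵖ D]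

theorem leftEntwinedCoaction_tmul (cD : Coring S D)
    (φ : BHom S S (BTensor S B D) (BTensor S D B)) (b : B) (d : D) :
    leftEntwinedCoaction cD φ (BTensor.tmul S b d) = BTensor.assoc S S D B D
      (φ.tmap (BHom.id S S D) ((BTensor.assoc S S B D D).symm
        (BTensor.tmul S b (cD.comul d)))) := by
  simp [leftEntwinedCoaction]

/-- The map `(D ⊗_S B) ⊗_S D → (D ⊗_S D) ⊗_S B` induced by `φ`. -/
def entwineLeft (φ : BHom S S (BTensor S B D) (BTensor S D B)) :
    BHom S S (BTensor S (BTensor S D B) D) (BTensor S (BTensor S D D) B) :=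
  (BHom.assocSymm S S S S D D B).comp (((BHom.id S S D).tmap φ).comp (BHom.assoc S S S S D B D))

/-- The map `w ↦ (D ⊗ φ)(φ ⊗ D)(b ⊗ w)`. -/
def entwineLeftTwice (φ : BHom S S (BTensor S B D) (BTensor S D B)) (b : B) :
    BTensor S D D →ₗ[Sᵐᵒᵖ] BTensor S (BTensor S D D) B where
  toFun w := entwineLeft φ
    (φ.tmap (BHom.id S S D) ((BTensor.assoc S S B D D).symm (BTensor.tmul S b w)))
  map_add' s t := by simp only [BTensor.tmul_add, map_add]
  map_smul' r t := by
    induction r using MulOpposite.rec' with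
    | _ r =>
    rw [← BTensor.op_smul_tmul, RingHom.id_apply, ← BHom.map_op_smul, ← BHom.map_op_smul]
    exact congrArg (fun z => entwineLeft φ (φ.tmap (BHom.id S S D) z))
      ((BHom.assocSymm S S S S B D D).map_op_smul r _)

/-- Mirror image of `IsRightEntwining.isRightEntwinedModule`: again `hR` carries the axiom `comul`,
and `hL` is naturality and rebracketing. -/
theorem IsLeftEntwining.isLeftEntwinedModule {cD : Coring S D}
    {φ : BHom S S (BTensor S B D) (BTensor S D B)} (h : IsLeftEntwining cD φ) :
    IsLeftEntwinedModule cD φ (leftEntwinedCoaction cD φ).l where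
  comodule :=
    { coassoc := fun t => by
        change (BTensor.assoc S S D D (BTensor S B D)).symm ((BHom.id S S D).tmap
          (leftEntwinedCoaction cD φ) (leftEntwinedCoaction cD φ t)) =
          cD.comul.tmap (BHom.id S S (BTensor S B D)) (leftEntwinedCoaction cD φ t)
        have e : BHom.id S S (BTensor S B D) = (BHom.id S S B).tmap (BHom.id S S D) :=
          BHom.ext fun t => (BHom.tmap_id t).symm
        have hR : ∀ (b : B) (v : BTensor S D D), cD.comul.tmap (BHom.id S S (BTensor S B D))
            (BTensor.assoc S S D B D (φ.tmap (BHom.id S S D)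
              ((BTensor.assoc S S B D D).symm (BTensor.tmul S b v)))) =
            BTensor.assoc S S (BTensor S D D) B D (BTensor.map
              (entwineLeftTwice φ b) LinearMap.id (cD.comul.tmap (BHom.id S S D) v)) := by
          intro a v
          induction v using BTensor.induction_on with
          | zero => simp
          | simple c c' =>
            rw [e, ← BHom.assoc_tmap, BTensor.assoc_symm_tmul, BHom.tmap_tmul, BHom.tmap_tmul,
              h.comul]
            simp [entwineLeftTwice, entwineLeft]
          | add a b ha hb => simp only [map_add, BTensor.tmul_add, ha, hb]
        have h₁ : ∀ (c c' : D) (p : BTensor S D B),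
            (BTensor.assoc S S D D (BTensor S B D)).symm (BTensor.tmul S c'
              (BTensor.assoc S S D B D (BTensor.tmul S p c))) =
            BTensor.assoc S S (BTensor S D D) B D (BTensor.tmul S
              ((BTensor.assoc S S D D B).symm (BTensor.tmul S c' p)) c) := by
          intro c c' p
          induction p using BTensor.induction_on with
          | zero => simp
          | simple a c' => simp
          | add a b ha hb => simp only [map_add, BTensor.add_tmul, BTensor.tmul_add, ha, hb]
        have h₂ : ∀ (a : B) (c : D) (w : BTensor S D D),
            (BTensor.assoc S S D D (BTensor S B D)).symm (BTensor.tmul S c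
              (BTensor.assoc S S D B D (φ.tmap (BHom.id S S D)
                ((BTensor.assoc S S B D D).symm (BTensor.tmul S a w))))) =
            BTensor.assoc S S (BTensor S D D) B D ((entwineLeft φ).tmap (BHom.id S S D)
              ((BTensor.assoc S S (BTensor S D B) D D).symm
                (BTensor.tmul S (BTensor.tmul S c a) w))) := by
          intro a c w
          induction w using BTensor.induction_on with
          | zero => simp
          | simple c c' => simp [entwineLeft, h₁]
          | add a b ha hb => simp only [map_add, BTensor.tmul_add, ha, hb]
        have h₃ : ∀ (c : D) (u : BTensor S D B),
            (BTensor.assoc S S D D (BTensor S B D)).symm ((BHom.id S S D).tmap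
              (leftEntwinedCoaction cD φ) (BTensor.assoc S S D B D (BTensor.tmul S u c))) =
            BTensor.assoc S S (BTensor S D D) B D ((entwineLeft φ).tmap (BHom.id S S D)
              ((BTensor.assoc S S (BTensor S D B) D D).symm
                (BTensor.tmul S u (cD.comul c)))) := by
          intro c u
          induction u using BTensor.induction_on with
          | zero => simp
          | simple a c' => simp [leftEntwinedCoaction_tmul, h₂]
          | add a b ha hb => simp only [map_add, BTensor.add_tmul, ha, hb]
        have h₄ : ∀ (a : B) (c : D) (w : BTensor S D D),
            (entwineLeft φ).tmap (BHom.id S S D)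
              ((BTensor.assoc S S (BTensor S D B) D D).symm
                (BTensor.tmul S (φ (BTensor.tmul S a c)) w)) =
            BTensor.map (entwineLeftTwice φ a) LinearMap.id
              ((BTensor.assoc S S D D D).symm (BTensor.tmul S c w)) := by
          intro a c w
          induction w using BTensor.induction_on with
          | zero => simp
          | simple c c' => simp [entwineLeftTwice]
          | add a b ha hb => simp only [map_add, BTensor.tmul_add, ha, hb]
        have hL : ∀ (a : B) (v : BTensor S D D),
            (BTensor.assoc S S D D (BTensor S B D)).symm ((BHom.id S S D).tmap
              (leftEntwinedCoaction cD φ) (BTensor.assoc S S D B D (φ.tmap (BHom.id S S D)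
                ((BTensor.assoc S S B D D).symm (BTensor.tmul S a v))))) =
            BTensor.assoc S S (BTensor S D D) B D (BTensor.map (entwineLeftTwice φ a)
              LinearMap.id ((BTensor.assoc S S D D D).symm
                ((BHom.id S S D).tmap cD.comul v))) := by
          intro a v
          induction v using BTensor.induction_on with
          | zero => simp
          | simple c c' =>
            rw [BTensor.assoc_symm_tmul, BHom.tmap_tmul, BHom.id_apply, h₃, h₄, BHom.tmap_tmul,
              BHom.id_apply]
          | add a b ha hb => simp only [map_add, BTensor.tmul_add, ha, hb]
        induction t using BTensor.induction_on with
        | zero => simp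
        | simple c a =>
          rw [leftEntwinedCoaction_tmul, hR, hL, ← cD.coassoc, AddEquiv.symm_apply_apply]
        | add a b ha hb => simp only [map_add, ha, hb]
      counit := fun t => by
        change cD.counit.tmap (BHom.id S S (BTensor S B D)) (leftEntwinedCoaction cD φ t) = _
        have e : BHom.id S S (BTensor S B D) = (BHom.id S S B).tmap (BHom.id S S D) :=
          BHom.ext fun t => (BHom.tmap_id t).symm
        have hv : ∀ (a : B) (v : BTensor S D D), cD.counit.tmap (BHom.id S S (BTensor S B D))
            (BTensor.assoc S S D B D (φ.tmap (BHom.id S S D)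
              ((BTensor.assoc S S B D D).symm (BTensor.tmul S a v)))) =
            BTensor.tmul S 1 (BTensor.map
              ({ toFun := fun s => op s • a
                 map_add' := fun s t => by rw [op_add, add_smul]
                 map_smul' := fun r s => by
                   rw [← op_unop r, op_smul_eq_mul, op_mul, mul_smul]; rfl }
                : S →ₗ[Sᵐᵒᵖ] B) LinearMap.id (cD.counit.tmap (BHom.id S S D) v)) := by
          intro a v
          induction v using BTensor.induction_on with
          | zero => simp
          | simple c c' =>
            rw [e, ← BHom.assoc_tmap, BTensor.assoc_symm_tmul, BHom.tmap_tmul, BHom.tmap_tmul,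
              h.counit]
            simp
          | add a b ha hb => simp only [map_add, BTensor.tmul_add, ha, hb]
        induction t using BTensor.induction_on with
        | zero => simp
        | simple a c => rw [leftEntwinedCoaction_tmul, hv, cD.counit_left]; simp
        | add a b ha hb => simp only [map_add, BTensor.tmul_add, ha, hb] }
  compat a t := by
    have h₁ : ∀ (c : D) (a : B) (q : BTensor S D B),
        BTensor.map (LinearMap.id : D →ₗ[Sᵐᵒᵖ] D) (leftAct S B (BTensor S B D))
          (BTensor.assoc S S D B (BTensor S B D)
            (BTensor.tmul S q (BTensor.tmul S a c))) =
        BTensor.assoc S S D B D (BTensor.tmul S ((BHom.id S S D).tmap (mulMap S B)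
          (BTensor.assoc S S D B B (BTensor.tmul S q a))) c) := by
      intro c a q
      induction q using BTensor.induction_on with
      | zero => simp
      | simple c c' => simp
      | add a b ha hb => simp only [map_add, BTensor.add_tmul, ha, hb]
    have h₂ : ∀ (c : D) (p : BTensor S D B),
        BTensor.map (LinearMap.id : D →ₗ[Sᵐᵒᵖ] D) (leftAct S B (BTensor S B D))
          (BTensor.assoc S S D B (BTensor S B D) (BTensor.map φ.r LinearMap.id
            ((BTensor.assoc S S B D (BTensor S B D)).symm (BTensor.tmul S a
              (BTensor.assoc S S D B D (BTensor.tmul S p c)))))) =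
        BTensor.assoc S S D B D (BTensor.tmul S ((BHom.id S S D).tmap (mulMap S B)
          (BTensor.assoc S S D B B (φ.tmap (BHom.id S S B) ((BTensor.assoc S S B D B).symm
            (BTensor.tmul S a p))))) c) := by
      intro c p
      induction p using BTensor.induction_on with
      | zero => simp
      | simple c c' => simp [h₁]
      | add a b ha hb => simp only [map_add, BTensor.add_tmul, BTensor.tmul_add, ha, hb]
    have h₃ : ∀ (b : B) (v : BTensor S D D),
        BTensor.map (LinearMap.id : D →ₗ[Sᵐᵒᵖ] D) (leftAct S B (BTensor S B D))
          (BTensor.assoc S S D B (BTensor S B D) (BTensor.map φ.r LinearMap.id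
            ((BTensor.assoc S S B D (BTensor S B D)).symm (BTensor.tmul S a
              (BTensor.assoc S S D B D (φ.tmap (BHom.id S S D)
                ((BTensor.assoc S S B D D).symm (BTensor.tmul S b v)))))))) =
        BTensor.assoc S S D B D (φ.tmap (BHom.id S S D)
          ((BTensor.assoc S S B D D).symm (BTensor.tmul S (a * b) v))) := by
      intro b v
      induction v using BTensor.induction_on with
      | zero => simp
      | simple c c' =>
        rw [BTensor.assoc_symm_tmul, BHom.tmap_tmul, BHom.id_apply, h₂, ← h.mul]
        simp
      | add a b ha hb => simp only [map_add, BTensor.tmul_add, ha, hb]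
    simp only [BHom.l_apply]
    induction t using BTensor.induction_on with
    | zero => simp
    | simple b c =>
      rw [BTensor.smul_tmul', smul_eq_mul, leftEntwinedCoaction_tmul,
        leftEntwinedCoaction_tmul, h₃]
    | add a b ha hb => simp only [smul_add, map_add, BTensor.tmul_add, ha, hb]

end Left

/-! ### Comodule morphisms as colinear maps -/

section Right

variable {R A C M N : Type*} [Ring R] [Ring A] [RingMap R A]
  [AddCommGroup C] [Module R C] [Module Rᵐᵒᵖ C] [SMulCommClass R Rᵐᵒᵖ C]
  [AddCommGroup M] [AddCommGroup N]
  [Module Aᵐᵒᵖ M] [Module Rᵐᵒᵖ M] [RightRestricted R A M]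
  [Module Aᵐᵒᵖ N] [Module Rᵐᵒᵖ N] [RightRestricted R A N]

variable (R) in
/-- A right `A`-linear map as a right `R`-linear map. -/
def restrictRight (f : M →ₗ[Aᵐᵒᵖ] N) : M →ₗ[Rᵐᵒᵖ] N where
  toFun := f
  map_add' := map_add f
  map_smul' r m := by
    induction r using MulOpposite.rec' with
    | _ r =>
    rw [RightRestricted.op_smul_eq (A := A) r m, map_smul]
    exact (RightRestricted.op_smul_eq (A := A) r (f m)).symm

@[simp] theorem restrictRight_apply (f : M →ₗ[Aᵐᵒᵖ] N) (m : M) : restrictRight R f m = f m := rfl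

theorem map_restrictRight_zero (v : BTensor R M C) :
    BTensor.map (restrictRight R (0 : M →ₗ[Aᵐᵒᵖ] N)) (LinearMap.id : C →ₗ[R] C) v = 0 := by
  induction v using BTensor.induction_on with
  | zero => simp
  | simple m c => simp
  | add a b ha hb => rw [map_add, ha, hb, add_zero]

theorem map_restrictRight_add (f g : M →ₗ[Aᵐᵒᵖ] N) (v : BTensor R M C) :
    BTensor.map (restrictRight R (f + g)) (LinearMap.id : C →ₗ[R] C) v =
      BTensor.map (restrictRight R f) LinearMap.id v +
        BTensor.map (restrictRight R g) LinearMap.id v := by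
  induction v using BTensor.induction_on with
  | zero => simp
  | simple m c => simp [BTensor.add_tmul]
  | add a b ha hb => simp only [map_add, ha, hb]; abel

theorem toRightCoring_tmul (m : M) (c : C) : toRightCoring R A C M (BTensor.tmul R m c) =
    BTensor.tmul A m (BTensor.tmul R 1 c) := by
  simp [toRightCoring]

/-- The map `m ⊗ (a ⊗ c) ↦ ma ⊗ c` is a retraction; `h` says that it is balanced over `A`. -/
theorem toRightCoring_injective : Function.Injective (toRightCoring R A C M) := by
  have h : ∀ (m : M) (a : A) (w : BTensor R A C),
      BTensor.map (rightAct R A M) (LinearMap.id : C →ₗ[R] C)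
        ((BTensor.assoc R R M A C).symm (BTensor.tmul R (op a • m) w)) =
      BTensor.map (rightAct R A M) (LinearMap.id : C →ₗ[R] C)
        ((BTensor.assoc R R M A C).symm (BTensor.tmul R m (a • w))) := by
    intro m a w
    induction w using BTensor.induction_on with
    | zero => simp
    | simple b c => simp [mul_smul]
    | add a b ha hb => simp only [smul_add, BTensor.tmul_add, map_add, ha, hb]
  let g : BTensor A M (BTensor R A C) →+ BTensor R M C := BTensor.lift
    (AddMonoidHom.mk' (fun m => ((BTensor.map (rightAct R A M) (LinearMap.id : C →ₗ[R] C)).comp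
      (BTensor.assoc R R M A C).symm.toAddMonoidHom).comp (BTensor.mk R M (BTensor R A C) m))
      (fun m n => by ext w; simp)) (fun m a w => h m a w)
  refine Function.LeftInverse.injective (g := g) fun t => ?_
  induction t using BTensor.induction_on with
  | zero => simp
  | simple m c => rw [toRightCoring_tmul]; simp [g]
  | add a b ha hb => simp only [map_add, ha, hb]

/-- `toRightCoring` is natural in `A`-linear maps and injective, so it cancels. Morphisms over the
`A`-coring are thus the `A`-linear maps that are `C`-colinear. -/
theorem mem_rightComoduleHom_iff (ρM : M →ₗ[Rᵐᵒᵖ] BTensor R M C) (ρN : N →ₗ[Rᵐᵒᵖ] BTensor R N C)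
    (f : M →ₗ[Aᵐᵒᵖ] N) : f ∈ rightComoduleHom ρM ρN ↔
      ∀ m, BTensor.map (restrictRight R f) (LinearMap.id : C →ₗ[R] C) (ρM m) = ρN (f m) := by
  have h : ∀ t : BTensor R M C, BTensor.map f (LinearMap.id : BTensor R A C →ₗ[A] BTensor R A C)
      (toRightCoring R A C M t) = toRightCoring R A C N
        (BTensor.map (restrictRight R f) (LinearMap.id : C →ₗ[R] C) t) := by
    intro t
    induction t using BTensor.induction_on with
    | zero => simp
    | simple m c => simp [toRightCoring_tmul]
    | add a b ha hb => simp only [map_add, ha, hb]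
  refine forall_congr' fun m => ?_
  rw [h]
  exact toRightCoring_injective.eq_iff

end Right

section Left

variable {S B D M N : Type*} [Ring S] [Ring B] [RingMap S B]
  [AddCommGroup D] [Module S D] [Module Sᵐᵒᵖ D] [SMulCommClass S Sᵐᵒᵖ D]
  [AddCommGroup M] [AddCommGroup N]
  [Module B M] [Module S M] [LeftRestricted S B M]
  [Module B N] [Module S N] [LeftRestricted S B N]

variable (S) in
/-- A left `B`-linear map as a left `S`-linear map. -/
def restrictLeft (f : M →ₗ[B] N) : M →ₗ[S] N where
  toFun := f
  map_add' := map_add f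
  map_smul' r m := by
    rw [LeftRestricted.smul_eq (A := B) r m, map_smul]
    exact (LeftRestricted.smul_eq (A := B) r (f m)).symm

@[simp] theorem restrictLeft_apply (f : M →ₗ[B] N) (m : M) : restrictLeft S f m = f m := rfl

theorem map_restrictLeft_zero (v : BTensor S D M) :
    BTensor.map (LinearMap.id : D →ₗ[Sᵐᵒᵖ] D) (restrictLeft S (0 : M →ₗ[B] N)) v = 0 := by
  induction v using BTensor.induction_on with
  | zero => simp
  | simple m c => simp
  | add a b ha hb => rw [map_add, ha, hb, add_zero]

theorem map_restrictLeft_add (f g : M →ₗ[B] N) (v : BTensor S D M) :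
    BTensor.map (LinearMap.id : D →ₗ[Sᵐᵒᵖ] D) (restrictLeft S (f + g)) v =
      BTensor.map LinearMap.id (restrictLeft S f) v +
        BTensor.map LinearMap.id (restrictLeft S g) v := by
  induction v using BTensor.induction_on with
  | zero => simp
  | simple m c => simp [BTensor.tmul_add]
  | add a b ha hb => simp only [map_add, ha, hb]; abel

theorem toLeftCoring_tmul (d : D) (m : M) : toLeftCoring S B D M (BTensor.tmul S d m) =
    BTensor.tmul B (BTensor.tmul S d 1) m := by
  simp [toLeftCoring]

theorem toLeftCoring_injective : Function.Injective (toLeftCoring S B D M) := by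
  have h : ∀ (w : BTensor S D B) (b : B) (m : M),
      BTensor.map (LinearMap.id : D →ₗ[Sᵐᵒᵖ] D) (leftAct S B M)
        (BTensor.assoc S S D B M (BTensor.tmul S (op b • w) m)) =
      BTensor.map (LinearMap.id : D →ₗ[Sᵐᵒᵖ] D) (leftAct S B M)
        (BTensor.assoc S S D B M (BTensor.tmul S w (b • m))) := by
    intro w b m
    induction w using BTensor.induction_on with
    | zero => simp
    | simple b c => simp [mul_smul]
    | add a b ha hb => simp only [smul_add, BTensor.add_tmul, map_add, ha, hb]
  let g : BTensor B (BTensor S D B) M →+ BTensor S D M := BTensor.lift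
    (AddMonoidHom.mk' (fun w => ((BTensor.map (LinearMap.id : D →ₗ[Sᵐᵒᵖ] D) (leftAct S B M)).comp
      (BTensor.assoc S S D B M).toAddMonoidHom).comp (BTensor.mk S (BTensor S D B) M w))
      (fun m n => by ext w; simp)) (fun m a w => h m a w)
  refine Function.LeftInverse.injective (g := g) fun t => ?_
  induction t using BTensor.induction_on with
  | zero => simp
  | simple m c => rw [toLeftCoring_tmul]; simp [g]
  | add a b ha hb => simp only [map_add, ha, hb]

theorem mem_leftComoduleHom_iff (ρM : M →ₗ[S] BTensor S D M) (ρN : N →ₗ[S] BTensor S D N)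
    (f : M →ₗ[B] N) : f ∈ leftComoduleHom ρM ρN ↔
      ∀ m, BTensor.map (LinearMap.id : D →ₗ[Sᵐᵒᵖ] D) (restrictLeft S f) (ρM m) = ρN (f m) := by
  have h : ∀ t : BTensor S D M,
      BTensor.map (LinearMap.id : BTensor S D B →ₗ[Bᵐᵒᵖ] BTensor S D B) f
        (toLeftCoring S B D M t) = toLeftCoring S B D N
          (BTensor.map (LinearMap.id : D →ₗ[Sᵐᵒᵖ] D) (restrictLeft S f) t) := by
    intro t
    induction t using BTensor.induction_on with
    | zero => simp
    | simple m c => simp [toLeftCoring_tmul]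
    | add a b ha hb => simp only [map_add, ha, hb]
  refine forall_congr' fun m => ?_
  rw [h]
  exact toLeftCoring_injective.eq_iff

end Left

namespace BimoduleHerd

variable {P : BimodulePair.{u}} {F : FormalDual P} {H : BimoduleHerd F}

/-! ### The bimodule `T̄` -/

theorem Tame.fromCT'_injective (hH : H.Tame) : Function.Injective H.fromCT' :=
  hH.ιC_tmap_id_equaliser.1

theorem Tame.fromT'D_injective (hH : H.Tame) : Function.Injective H.fromT'D :=
  (BTensor.assoc P.S P.R P.T' P.T P.T').symm.injective.comp hH.id_tmap_ιD_equaliser.1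

theorem assoc_fromT'D (v : BTensor P.S P.T' H.D) :
    BTensor.assoc P.S P.R P.T' P.T P.T' (H.fromT'D v) = (BHom.id P.R P.S P.T').tmap H.ιD v :=
  AddEquiv.apply_symm_apply _ _

theorem ιT_injective : Function.Injective H.ιT := Subtype.val_injective

/-- The inclusion `T̄ → C ⊗_R T'`. -/
def Tame.toCT' (hH : H.Tame) : BHom P.R P.S H.Tbar (BTensor P.R H.C P.T') :=
  BHom.factor H.fromCT' hH.fromCT'_injective H.ιT fun z => z.2.1

theorem Tame.fromCT'_toCT' (hH : H.Tame) (z : H.Tbar) : H.fromCT' (hH.toCT' z) = H.ιT z :=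
  BHom.apply_factor _ _ _ _ z

/-- The inclusion `T̄ → T' ⊗_S D`. -/
def Tame.toT'D (hH : H.Tame) : BHom P.R P.S H.Tbar (BTensor P.S P.T' H.D) :=
  BHom.factor H.fromT'D hH.fromT'D_injective H.ιT fun z => z.2.2

theorem Tame.fromT'D_toT'D (hH : H.Tame) (z : H.Tbar) : H.fromT'D (hH.toT'D z) = H.ιT z :=
  BHom.apply_factor _ _ _ _ z

theorem Tame.toCT'_injective (hH : H.Tame) : Function.Injective hH.toCT' := fun a b h =>
  ιT_injective (by rw [← hH.fromCT'_toCT', h, hH.fromCT'_toCT'])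

theorem Tame.toT'D_injective (hH : H.Tame) : Function.Injective hH.toT'D := fun a b h =>
  ιT_injective (by rw [← hH.fromT'D_toT'D, h, hH.fromT'D_toT'D])

theorem exists_ιT {z : P.T'TT'} (hC : ∃ w, H.fromCT' w = z) (hD : ∃ w, H.fromT'D w = z) :
    ∃ t, H.ιT t = z := ⟨⟨z, hC, hD⟩, rfl⟩

theorem ξC_tmap_id_fromCT' (w : BTensor P.R H.C P.T') :
    H.ξC.tmap (BHom.id P.R P.S P.T') (H.fromCT' w) =
      P.ζC.tmap (BHom.id P.R P.S P.T') (H.fromCT' w) := by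
  rw [fromCT']
  exact BHom.tmap_tmap_congr H.ξC_ιC (fun _ => rfl) w

theorem id_tmap_ξD_fromT'D (w : BTensor P.S P.T' H.D) :
    (BHom.id P.R P.S P.T').tmap H.ξD (BTensor.assoc P.S P.R P.T' P.T P.T' (H.fromT'D w)) =
      (BHom.id P.R P.S P.T').tmap P.ζD (BTensor.assoc P.S P.R P.T' P.T P.T' (H.fromT'D w)) := by
  rw [assoc_fromT'D]
  exact BHom.tmap_tmap_congr (fun _ => rfl) H.ξD_ιD w

/-- Converse of `ξC_tmap_id_fromCT'`. With `exists_fromT'D` it turns membership in `T̄` into two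
equations in `T' ⊗ T ⊗ T'`. -/
theorem Tame.exists_fromCT' (hH : H.Tame) {z : P.T'TT'}
    (h : H.ξC.tmap (BHom.id P.R P.S P.T') z = P.ζC.tmap (BHom.id P.R P.S P.T') z) :
    ∃ w, H.fromCT' w = z :=
  hH.ιC_tmap_id_equaliser.2 z h.symm

theorem Tame.exists_fromT'D (hH : H.Tame) {z : P.T'TT'}
    (h : (BHom.id P.R P.S P.T').tmap H.ξD (BTensor.assoc P.S P.R P.T' P.T P.T' z) =
      (BHom.id P.R P.S P.T').tmap P.ζD (BTensor.assoc P.S P.R P.T' P.T P.T' z)) :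
    ∃ w, H.fromT'D w = z := by
  obtain ⟨w, hw⟩ := hH.id_tmap_ιD_equaliser.2 _ h.symm
  exact ⟨w, (BTensor.assoc P.S P.R P.T' P.T P.T').injective ((assoc_fromT'D w).trans hw)⟩

/-! ### The isomorphism `h₁` -/

theorem ev_tmul_op_smul (x' : P.T') (a : P.A) (y : P.T) :
    F.ev (BTensor.tmul P.S x' (op a • y)) = F.ev (BTensor.tmul P.S x' y) * a :=
  F.ev.map_op_smul a (BTensor.tmul P.S x' y)

theorem ev_smul_tmul (x' : P.T') (a : P.A) (y : P.T) :
    F.ev (BTensor.tmul P.S (a • x') y) = a * F.ev (BTensor.tmul P.S x' y) :=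
  F.ev.map_smul a (BTensor.tmul P.S x' y)

theorem ev'_tmul_op_smul (x : P.T) (b : P.B) (x' : P.T') :
    F.ev' (BTensor.tmul P.R x (op b • x')) = F.ev' (BTensor.tmul P.R x x') * b :=
  F.ev'.map_op_smul b (BTensor.tmul P.R x x')

theorem ev'_smul_tmul (x : P.T) (b : P.B) (x' : P.T') :
    F.ev' (BTensor.tmul P.R (b • x) x') = b * F.ev' (BTensor.tmul P.R x x') :=
  F.ev'.map_smul b (BTensor.tmul P.R x x')

variable (H) in
/-- The map `C ⊗_R T' → Hom_A(T, C ⊗_R A)`, `c ⊗ x' ↦ (y ↦ c ⊗ ev(x' ⊗ y))`. -/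
def contractC : BTensor P.R H.C P.T' →+ (P.T →ₗ[P.Aᵐᵒᵖ] BTensor P.R H.C P.A) :=
  AddMonoidHom.mk' (fun w =>
    { toFun := fun y => (BHom.id P.R P.R H.C).tmap F.evR
        (BTensor.assoc P.R P.S H.C P.T' P.T (BTensor.tmul P.S w y))
      map_add' := fun y z => by simp only [BTensor.tmul_add, map_add]
      map_smul' := fun a y => by
        induction a using MulOpposite.rec' with
        | _ a =>
        induction w using BTensor.induction_on with
        | zero => simp
        | simple c x' => simp [ev_tmul_op_smul]
        | add a b ha hb => simp only [BTensor.add_tmul, map_add, smul_add, ha, hb] })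
    (fun w w' => LinearMap.ext fun y => by
      change (BHom.id P.R P.R H.C).tmap F.evR _ = (BHom.id P.R P.R H.C).tmap F.evR _ +
        (BHom.id P.R P.R H.C).tmap F.evR _
      simp only [BTensor.add_tmul, map_add])

theorem contractC_apply (w : BTensor P.R H.C P.T') (y : P.T) :
    H.contractC w y = (BHom.id P.R P.R H.C).tmap F.evR
      (BTensor.assoc P.R P.S H.C P.T' P.T (BTensor.tmul P.S w y)) := rfl

@[simp] theorem contractC_tmul (c : H.C) (x' : P.T') (y : P.T) :
    H.contractC (BTensor.tmul P.R c x') y = BTensor.tmul P.R c (F.ev (BTensor.tmul P.S x' y)) := by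
  simp [contractC_apply]

theorem contractC_smul (r : P.R) (w : BTensor P.R H.C P.T') (y : P.T) :
    H.contractC (r • w) y = r • H.contractC w y := by
  induction w using BTensor.induction_on with
  | zero => simp
  | simple c x' => simp
  | add a b ha hb => simp only [smul_add, map_add, LinearMap.add_apply, ha, hb]

theorem contractC_op_smul (s : P.S) (w : BTensor P.R H.C P.T') (y : P.T) :
    H.contractC (op s • w) y = H.contractC w (s • y) := by
  induction w using BTensor.induction_on with
  | zero => simp
  | simple c x' => simp [BTensor.smul_tmul]
  | add a b ha hb => simp only [smul_add, map_add, LinearMap.add_apply, ha, hb]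

theorem ιC_tmap_id_contractC (w : BTensor P.R H.C P.T') (y : P.T) :
    H.ιC.tmap (BHom.id P.R P.R P.A) (H.contractC w y) = F.contractRight (H.fromCT' w) y := by
  induction w using BTensor.induction_on with
  | zero => simp [FormalDual.contractRight]
  | simple c x' => simp [FormalDual.contractRight, fromCT']
  | add a b ha hb =>
    simp only [FormalDual.contractRight, map_add, LinearMap.add_apply, BTensor.add_tmul] at ha hb ⊢
    rw [ha, hb]

variable (H) in
/-- The map `x ⊗ x' ↦ f(x) x'`. -/
def expandC (f : P.T →ₗ[P.Aᵐᵒᵖ] BTensor P.R H.C P.A) : P.TT' →+ BTensor P.R H.C P.T' :=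
  ((BHom.id P.R P.R H.C).tmap (lact P.R P.A P.S P.T')).toAddMonoidHom.comp
    ((BTensor.assoc P.R P.R H.C P.A P.T').toAddMonoidHom.comp
      (BTensor.map (restrictRight P.R f) (LinearMap.id : P.T' →ₗ[P.R] P.T')))

theorem expandC_tmul (f : P.T →ₗ[P.Aᵐᵒᵖ] BTensor P.R H.C P.A) (x : P.T) (x' : P.T') :
    H.expandC f (BTensor.tmul P.R x x') = (BHom.id P.R P.R H.C).tmap (lact P.R P.A P.S P.T')
      (BTensor.assoc P.R P.R H.C P.A P.T' (BTensor.tmul P.R (f x) x')) :=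
  congrArg (fun t => (BHom.id P.R P.R H.C).tmap (lact P.R P.A P.S P.T')
      (BTensor.assoc P.R P.R H.C P.A P.T' t)) (BTensor.map_tmul _ _ _ _)

/-- On simple tensors this is `c ⊗ ev(y' ⊗ x) x' = c ⊗ y' ev'(x ⊗ x')`. An element `t` with `ev'(t)
= 1` therefore provides a left inverse of `contractC`. -/
theorem expandC_contractC (w : BTensor P.R H.C P.T') (t : P.TT') :
    H.expandC (H.contractC w) t = op (F.ev' t) • w := by
  induction t using BTensor.induction_on with
  | zero => simp
  | simple x x' =>
    rw [expandC_tmul]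
    induction w using BTensor.induction_on with
    | zero => simp
    | simple c y' => simp [F.triangle']
    | add a b ha hb =>
      simp only [map_add, LinearMap.add_apply, BTensor.add_tmul, smul_add, ha, hb]
  | add a b ha hb => simp only [map_add, op_add, add_smul, ha, hb]

/-- By `A`-linearity, `f(x) ev(x' ⊗ y) = f(x ev(x' ⊗ y)) = f(ev'(x ⊗ x') y)`. With `ev'(t) = 1` this
is the right inverse. -/
theorem contractC_expandC (f : P.T →ₗ[P.Aᵐᵒᵖ] BTensor P.R H.C P.A) (t : P.TT') (y : P.T) :
    H.contractC (H.expandC f t) y = f (F.ev' t • y) := by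
  induction t using BTensor.induction_on with
  | zero => simp
  | simple x x' =>
    rw [expandC_tmul, F.triangle, map_smul]
    generalize f x = p
    induction p using BTensor.induction_on with
    | zero => simp
    | simple c a => simp [ev_smul_tmul]
    | add a b ha hb =>
      simp only [map_add, LinearMap.add_apply, BTensor.add_tmul, smul_add, ha, hb]
  | add a b ha hb => simp only [map_add, LinearMap.add_apply, add_smul, ha, hb]

/-- The map `t ⊗ b ↦ t ⊗ b y`. -/
def applyB (P : BimodulePair.{u}) (y : P.T) :
    BTensor P.S P.TT' P.B →ₗ[P.S] BTensor P.S P.TT' P.T where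
  toFun s := P.absorbLeft (BTensor.tmul P.S s y)
  map_add' s t := by rw [BTensor.add_tmul, map_add]
  map_smul' r s := by rw [← BTensor.smul_tmul', BHom.map_smul]; rfl

theorem applyB_apply (y : P.T) (s : BTensor P.S P.TT' P.B) :
    applyB P y s = P.absorbLeft (BTensor.tmul P.S s y) := rfl

/-- The rebracketing `(T' ⊗ T) ⊗ (T' ⊗ T) → T' ⊗ ((T ⊗ T') ⊗ T)`. -/
def rebracketC (P : BimodulePair.{u}) :
    BTensor P.R P.T'T P.T'T →+ BTensor P.S P.T' (BTensor P.S P.TT' P.T) :=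
  ((BHom.id P.R P.S P.T').tmap (BHom.assocSymm P.S P.R P.R P.S P.T P.T' P.T)).toAddMonoidHom.comp
    (BTensor.assoc P.S P.R P.T' P.T P.T'T).toAddMonoidHom

theorem rebracketC_apply (t : BTensor P.R P.T'T P.T'T) : rebracketC P t =
    (BHom.id P.R P.S P.T').tmap (BHom.assocSymm P.S P.R P.R P.S P.T P.T' P.T)
      (BTensor.assoc P.S P.R P.T' P.T P.T'T t) := rfl

theorem rebracketC_injective : Function.Injective (rebracketC P) := by
  have h : ((BHom.id P.R P.S P.T').tmap
      (BHom.assocSymm P.S P.R P.R P.S P.T P.T' P.T)).IsSplit :=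
    BHom.IsSplit.id_tmap ⟨BHom.assoc P.S P.R P.R P.S P.T P.T' P.T, fun t => by simp⟩
  exact h.injective.comp (BTensor.assoc P.S P.R P.T' P.T P.T'T).injective

/-- This is `absorbLeft_ξD` with a factor `T'` in front: it exchanges an evaluation against `y` on
the `C` side for `ξD` on the `D` side. -/
theorem rebracketC_op_smul_γr (t : P.T'T) (x' : P.T') (y : P.T) :
    rebracketC P (op (F.ev (BTensor.tmul P.S x' y)) • H.γr t) =
      BTensor.map LinearMap.id (applyB P y) ((BHom.id P.R P.S P.T').tmap H.ξD
        (BTensor.assoc P.S P.R P.T' P.T P.T' (BTensor.tmul P.R t x'))) := by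
  have h : ∀ (a : P.A) (z' : P.T') (u : P.TT'T), rebracketC P (op a •
      (BTensor.assoc P.S P.R P.T' P.T P.T'T).symm (BTensor.tmul P.S z' u)) =
      BTensor.tmul P.S z' (op a • (BTensor.assoc P.R P.S P.T P.T' P.T).symm u) := by
    intro a z' u
    induction u using BTensor.induction_on_right with
    | zero => simp
    | simple x y' y => simp [rebracketC_apply]
    | add a b ha hb => simp only [map_add, BTensor.tmul_add, smul_add, ha, hb]
  induction t using BTensor.induction_on with
  | zero => simp
  | simple z' x =>
    rw [γr_tmul, h, BTensor.assoc_tmul, BHom.tmap_tmul, BTensor.map_tmul, LinearMap.id_apply,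
      BHom.id_apply, applyB_apply, absorbLeft_ξD]
    rfl
  | add a b ha hb => simp only [map_add, BTensor.add_tmul, smul_add, ha, hb]

theorem rebracketC_tmul (t : P.T'T) (x' : P.T') (y : P.T) :
    rebracketC P (BTensor.tmul P.R t (BTensor.tmul P.S x' y)) =
      BTensor.map LinearMap.id (applyB P y) ((BHom.id P.R P.S P.T').tmap P.ζD
        (BTensor.assoc P.S P.R P.T' P.T P.T' (BTensor.tmul P.R t x'))) := by
  induction t using BTensor.induction_on with
  | zero => simp
  | simple z' x => simp [rebracketC_apply, applyB_apply]
  | add a b ha hb => simp only [map_add, BTensor.add_tmul, ha, hb]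

/-- Inserting `x` into the slot of `B` and then contracting with `x'` through `ev'` multiplies `s`
on the right by `ev'(x ⊗ x')`. Surjectivity of `ev'` makes a sum of such scalars equal to `1`. -/
theorem eq_of_applyB (hev : Function.Surjective F.ev')
    {s s' : BTensor P.S P.T' (BTensor P.S P.TT' P.B)}
    (h : ∀ y : P.T, BTensor.map (LinearMap.id : P.T' →ₗ[P.Sᵐᵒᵖ] P.T') (applyB P y) s =
      BTensor.map LinearMap.id (applyB P y) s') : s = s' := by
  let N : BHom P.R P.S (BTensor P.R (BTensor P.S P.T' (BTensor P.S P.TT' P.T)) P.T')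
      (BTensor P.S P.T' (BTensor P.S P.TT' P.B)) :=
    ((BHom.id P.R P.S P.T').tmap (((BHom.id P.S P.S P.TT').tmap F.ev'S).comp
      (BHom.assoc P.S P.S P.S P.R P.TT' P.T P.T'))).comp
        (BHom.assoc P.R P.S P.S P.R P.T' (BTensor P.S P.TT' P.T) P.T')
  have hN : ∀ (s : BTensor P.S P.T' (BTensor P.S P.TT' P.B)) (x : P.T) (x' : P.T'),
      N (BTensor.tmul P.R (BTensor.map LinearMap.id (applyB P x) s) x') =
        op (F.ev' (BTensor.tmul P.R x x')) • s := by
    intro s x x'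
    induction s using BTensor.induction_on_right with
    | zero => simp
    | simple z' t b => simp [N, applyB_apply, ev'_smul_tmul]
    | add a b ha hb => simp only [map_add, BTensor.add_tmul, smul_add, ha, hb]
  have e : ∀ t : P.TT', op (F.ev' t) • s = op (F.ev' t) • s' := by
    intro t
    induction t using BTensor.induction_on with
    | zero => simp
    | simple x x' => rw [← hN, ← hN, h]
    | add a b ha hb => simp only [map_add, op_add, add_smul, ha, hb]
  obtain ⟨t, ht⟩ := hev 1
  simpa [ht] using e t

variable (H) in
/-- The map `(c ⊗ a) ⊗ c' ↦ c ⊗ a c'`. -/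
def embedC : BTensor P.R (BTensor P.R H.C P.A) H.C →+ BTensor P.R P.T'T P.T'T :=
  (H.ιC.tmap H.actC).toAddMonoidHom.comp (BTensor.assoc P.R P.R H.C P.A H.C).toAddMonoidHom

theorem embedC_apply (t : BTensor P.R (BTensor P.R H.C P.A) H.C) :
    H.embedC t = H.ιC.tmap H.actC (BTensor.assoc P.R P.R H.C P.A H.C t) := rfl

namespace Tame

theorem embedC_injective (hH : H.Tame) : Function.Injective H.embedC :=
  (hH.ιC_tmap_injective hH.actC_isSplit.id_tmap.injective).comp
    (BTensor.assoc P.R P.R H.C P.A H.C).injective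

theorem embedC_rightEntwinedCoaction (hH : H.Tame) (c : H.C) (a : P.A) :
    H.embedC (rightEntwinedCoaction hH.coringC hH.ψ (BTensor.tmul P.R c a)) =
      op a • H.γr (H.ιC c) := by
  have h : ∀ v : BTensor P.R H.C H.C, H.ιC.tmap H.actC ((BHom.id P.R P.R H.C).tmap hH.ψ
      (BTensor.assoc P.R P.R H.C H.C P.A (BTensor.tmul P.R v a))) =
      op a • H.ιC.tmap H.ιC v := by
    intro v
    induction v using BTensor.induction_on with
    | zero => simp
    | simple c c' => simp [actC_ψ]
    | add a b ha hb => simp only [map_add, BTensor.add_tmul, smul_add, ha, hb]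
  rw [rightEntwinedCoaction_tmul, embedC_apply, AddEquiv.apply_symm_apply, h]
  exact congrArg _ (hH.ιC_tmap_ιC_comulC c)

theorem rebracketC_rightEntwinedCoaction (hH : H.Tame) (w : BTensor P.R H.C P.T') (y : P.T) :
    rebracketC P (H.embedC (rightEntwinedCoaction hH.coringC hH.ψ (H.contractC w y))) =
      BTensor.map LinearMap.id (applyB P y) ((BHom.id P.R P.S P.T').tmap H.ξD
        (BTensor.assoc P.S P.R P.T' P.T P.T' (H.fromCT' w))) := by
  induction w using BTensor.induction_on with
  | zero => simp
  | simple c x' =>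
    rw [contractC_tmul, embedC_rightEntwinedCoaction, rebracketC_op_smul_γr, fromCT',
      BHom.tmap_tmul, BHom.id_apply]
  | add a b ha hb => simp only [map_add, LinearMap.add_apply, ha, hb]

/-- For `w = c ⊗ x'`, the second factor becomes the action map applied to `ξC(x' ⊗ y)`, which is `x'
⊗ y` by `lact_ξC`. -/
theorem rebracketC_map_contractC (hH : H.Tame) (w : BTensor P.R H.C P.T') (y : P.T) :
    rebracketC P (H.embedC (BTensor.map (restrictRight P.R (H.contractC w)) LinearMap.id
      (hH.ρTC y))) =
      BTensor.map LinearMap.id (applyB P y) ((BHom.id P.R P.S P.T').tmap P.ζD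
        (BTensor.assoc P.S P.R P.T' P.T P.T' (H.fromCT' w))) := by
  have h₂ : ∀ (c : H.C) (x' : P.T') (v : BTensor P.R P.T H.C),
      H.embedC (BTensor.map (restrictRight P.R (H.contractC (BTensor.tmul P.R c x')))
        LinearMap.id v) =
      BTensor.tmul P.R (H.ιC c) (lact P.R P.A P.R P.T'T (F.evR.tmap (BHom.id P.R P.R P.T'T)
        ((BTensor.assoc P.S P.R P.T' P.T P.T'T).symm (BTensor.tmul P.S x'
          ((BHom.id P.S P.R P.T).tmap H.ιC v))))) := by
    intro c x' v
    induction v using BTensor.induction_on with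
    | zero => simp
    | simple x c => simp [embedC_apply]
    | add a b ha hb => simp only [map_add, BTensor.tmul_add, ha, hb]
  induction w using BTensor.induction_on with
  | zero => simp [map_restrictRight_zero]
  | simple c x' =>
    rw [h₂, ρTC_spec, ← γr_tmul, ← ξC_apply, lact_ξC, rebracketC_tmul, fromCT', BHom.tmap_tmul,
      BHom.id_apply]
  | add a b ha hb => simp only [map_restrictRight_add, map_add, ha, hb]

/-- The two sides of colinearity at `y`, embedded in `T'T ⊗ T'T` and rebracketed, are the values of
`applyB P y` on the two sides of the equation for `D`. Letting `y` vary, `eq_of_applyB` recovers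
that equation. -/
theorem contractC_mem_iff (hH : H.Tame) (w : BTensor P.R H.C P.T') :
    H.contractC w ∈ rightComoduleHom hH.ρTC.r (rightEntwinedCoaction hH.coringC hH.ψ).r ↔
      (BHom.id P.R P.S P.T').tmap H.ξD (BTensor.assoc P.S P.R P.T' P.T P.T' (H.fromCT' w)) =
        (BHom.id P.R P.S P.T').tmap P.ζD
          (BTensor.assoc P.S P.R P.T' P.T P.T' (H.fromCT' w)) := by
  rw [mem_rightComoduleHom_iff]
  have e : ∀ y, BTensor.map (restrictRight P.R (H.contractC w)) LinearMap.id (hH.ρTC.r y) =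
      (rightEntwinedCoaction hH.coringC hH.ψ).r (H.contractC w y) ↔
      BTensor.map LinearMap.id (applyB P y) ((BHom.id P.R P.S P.T').tmap H.ξD
        (BTensor.assoc P.S P.R P.T' P.T P.T' (H.fromCT' w))) =
      BTensor.map LinearMap.id (applyB P y) ((BHom.id P.R P.S P.T').tmap P.ζD
        (BTensor.assoc P.S P.R P.T' P.T P.T' (H.fromCT' w))) := by
    intro y
    rw [← (rebracketC_injective.comp hH.embedC_injective).eq_iff, Function.comp_apply,
      Function.comp_apply, BHom.r_apply, BHom.r_apply, rebracketC_rightEntwinedCoaction,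
      rebracketC_map_contractC, eq_comm]
  exact ⟨fun h => eq_of_applyB hH.ev'_surjective fun y => (e y).1 (h y),
    fun h y => (e y).2 (congrArg _ h)⟩

/-- The isomorphism `T̄ → Hom^𝒞(T, C ⊗_R A)`. -/
def h₁ (hH : H.Tame) : H.Tbar →+ (P.T →ₗ[P.Aᵐᵒᵖ] BTensor P.R H.C P.A) :=
  H.contractC.comp hH.toCT'.toAddMonoidHom

theorem h₁_apply (hH : H.Tame) (z : H.Tbar) : hH.h₁ z = H.contractC (hH.toCT' z) := rfl

theorem ιC_tmap_id_h₁ (hH : H.Tame) (z : H.Tbar) (y : P.T) :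
    H.ιC.tmap (BHom.id P.R P.R P.A) (hH.h₁ z y) = F.contractRight (H.ιT z) y := by
  rw [h₁_apply, ιC_tmap_id_contractC, fromCT'_toCT']

theorem h₁_injective (hH : H.Tame) : Function.Injective hH.h₁ := by
  obtain ⟨t, ht⟩ := hH.ev'_surjective 1
  intro a b h
  apply hH.toCT'_injective
  have e := congrArg (fun f => H.expandC f t) h
  simpa [h₁_apply, expandC_contractC, ht] using e

theorem range_h₁ (hH : H.Tame) : Set.range hH.h₁ =
    rightComoduleHom hH.ρTC.r (rightEntwinedCoaction hH.coringC hH.ψ).r := by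
  ext f
  constructor
  · rintro ⟨z, rfl⟩
    rw [h₁_apply, contractC_mem_iff, fromCT'_toCT', ← hH.fromT'D_toT'D]
    exact id_tmap_ξD_fromT'D _
  · intro hf
    -- An element `t` over `1` acts as a dual basis: `f` is the contraction of `expandC f t`, which
    -- lies in `T̄` by the criterion for colinearity.
    obtain ⟨t, ht⟩ := hH.ev'_surjective 1
    have e : H.contractC (H.expandC f t) = f := LinearMap.ext fun y => by
      rw [contractC_expandC, ht, one_smul]
    rw [← e, contractC_mem_iff] at hf
    obtain ⟨z, hz⟩ := exists_ιT ⟨_, rfl⟩ (hH.exists_fromT'D hf)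
    refine ⟨z, ?_⟩
    rw [← e, h₁_apply]
    exact congrArg _ (hH.fromCT'_injective ((hH.fromCT'_toCT' z).trans hz))

theorem h₁_smul (hH : H.Tame) (r : P.R) (z : H.Tbar) (y : P.T) :
    hH.h₁ (r • z) y = r • hH.h₁ z y := by
  rw [h₁_apply, BHom.map_smul, contractC_smul, h₁_apply]

theorem h₁_op_smul (hH : H.Tame) (s : P.S) (z : H.Tbar) (y : P.T) :
    hH.h₁ (op s • z) y = hH.h₁ z (s • y) := by
  rw [h₁_apply, BHom.map_op_smul, contractC_op_smul, h₁_apply]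

end Tame

end BimoduleHerd

namespace BimoduleHerd

variable {P : BimodulePair.{u}} {F : FormalDual P} {H : BimoduleHerd F}

/-! ### The isomorphism `h₂` -/

variable (H) in
/-- The map `T' ⊗_S D → Hom_B(T, B ⊗_S D)`, `x' ⊗ d ↦ (y ↦ ev'(y ⊗ x') ⊗ d)`. -/
def contractD : BTensor P.S P.T' H.D →+ (P.T →ₗ[P.B] BTensor P.S P.B H.D) :=
  AddMonoidHom.mk' (fun v =>
    { toFun := fun y => F.ev'S.tmap (BHom.id P.S P.S H.D)
        ((BTensor.assoc P.R P.S P.T P.T' H.D).symm (BTensor.tmul P.R y v))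
      map_add' := fun y z => by simp only [BTensor.add_tmul, map_add]
      map_smul' := fun b y => by
        induction v using BTensor.induction_on with
        | zero => simp
        | simple x' d => simp [ev'_smul_tmul]
        | add a b ha hb => simp only [BTensor.tmul_add, map_add, smul_add, ha, hb] })
    (fun v v' => LinearMap.ext fun y => by
      change F.ev'S.tmap (BHom.id P.S P.S H.D) _ = F.ev'S.tmap (BHom.id P.S P.S H.D) _ +
        F.ev'S.tmap (BHom.id P.S P.S H.D) _
      simp only [BTensor.tmul_add, map_add])

theorem contractD_apply (v : BTensor P.S P.T' H.D) (y : P.T) :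
    H.contractD v y = F.ev'S.tmap (BHom.id P.S P.S H.D)
      ((BTensor.assoc P.R P.S P.T P.T' H.D).symm (BTensor.tmul P.R y v)) := rfl

@[simp] theorem contractD_tmul (x' : P.T') (d : H.D) (y : P.T) :
    H.contractD (BTensor.tmul P.S x' d) y =
      BTensor.tmul P.S (F.ev' (BTensor.tmul P.R y x')) d := by
  simp [contractD_apply]

theorem contractD_smul (r : P.R) (v : BTensor P.S P.T' H.D) (y : P.T) :
    H.contractD (r • v) y = H.contractD v (op r • y) := by
  induction v using BTensor.induction_on with
  | zero => simp
  | simple x' d => simp [BTensor.smul_tmul]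
  | add a b ha hb => simp only [smul_add, map_add, LinearMap.add_apply, ha, hb]

theorem contractD_op_smul (s : P.S) (v : BTensor P.S P.T' H.D) (y : P.T) :
    H.contractD (op s • v) y = op s • H.contractD v y := by
  induction v using BTensor.induction_on with
  | zero => simp
  | simple x' d => simp
  | add a b ha hb => simp only [smul_add, map_add, LinearMap.add_apply, ha, hb]

theorem id_tmap_ιD_contractD (v : BTensor P.S P.T' H.D) (y : P.T) :
    (BHom.id P.S P.S P.B).tmap H.ιD (H.contractD v y) = F.contractLeft y (H.fromT'D v) := by
  have h : F.contractLeft y (H.fromT'D v) = F.ev'S.tmap (BHom.id P.S P.S P.TT')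
      ((BTensor.assoc P.R P.S P.T P.T' P.TT').symm
        (BTensor.tmul P.R y ((BHom.id P.R P.S P.T').tmap H.ιD v))) := by
    rw [FormalDual.contractLeft, assoc_fromT'D]
  rw [h]
  induction v using BTensor.induction_on with
  | zero => simp
  | simple x' d => simp
  | add a b ha hb =>
    simp only [map_add, LinearMap.add_apply, BTensor.tmul_add] at ha hb ⊢
    rw [ha (by rw [FormalDual.contractLeft, assoc_fromT'D]),
      hb (by rw [FormalDual.contractLeft, assoc_fromT'D])]

variable (H) in
/-- The map `x' ⊗ x ↦ x' f(x)`. -/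
def expandD (f : P.T →ₗ[P.B] BTensor P.S P.B H.D) : P.T'T →+ BTensor P.S P.T' H.D :=
  ((ract P.S P.B P.R P.T').tmap (BHom.id P.S P.S H.D)).toAddMonoidHom.comp
    ((BTensor.assoc P.S P.S P.T' P.B H.D).symm.toAddMonoidHom.comp
      (BTensor.map (LinearMap.id : P.T' →ₗ[P.Sᵐᵒᵖ] P.T') (restrictLeft P.S f)))

theorem expandD_tmul (f : P.T →ₗ[P.B] BTensor P.S P.B H.D) (x' : P.T') (x : P.T) :
    H.expandD f (BTensor.tmul P.S x' x) = (ract P.S P.B P.R P.T').tmap (BHom.id P.S P.S H.D)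
      ((BTensor.assoc P.S P.S P.T' P.B H.D).symm (BTensor.tmul P.S x' (f x))) :=
  congrArg (fun t => (ract P.S P.B P.R P.T').tmap (BHom.id P.S P.S H.D)
      ((BTensor.assoc P.S P.S P.T' P.B H.D).symm t)) (BTensor.map_tmul _ _ _ _)

/-- Here an element with `ev(t) = 1` inverts the contraction, so `h₂` rests on surjectivity of `ev`
where `h₁` rests on that of `ev'`. -/
theorem expandD_contractD (v : BTensor P.S P.T' H.D) (t : P.T'T) :
    H.expandD (H.contractD v) t = F.ev t • v := by
  induction t using BTensor.induction_on with
  | zero => simp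
  | simple x' x =>
    rw [expandD_tmul]
    induction v using BTensor.induction_on with
    | zero => simp
    | simple y' d => simp [← F.triangle']
    | add a b ha hb =>
      simp only [map_add, LinearMap.add_apply, BTensor.tmul_add, smul_add, ha, hb]
  | add a b ha hb => simp only [map_add, add_smul, ha, hb]

theorem contractD_expandD (f : P.T →ₗ[P.B] BTensor P.S P.B H.D) (t : P.T'T) (y : P.T) :
    H.contractD (H.expandD f t) y = f (op (F.ev t) • y) := by
  induction t using BTensor.induction_on with
  | zero => simp
  | simple x' x =>
    rw [expandD_tmul, ← F.triangle, map_smul]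
    generalize f x = p
    induction p using BTensor.induction_on with
    | zero => simp
    | simple b d => simp [ev'_tmul_op_smul]
    | add a b ha hb =>
      simp only [map_add, LinearMap.add_apply, BTensor.tmul_add, smul_add, ha, hb]
  | add a b ha hb => simp only [map_add, LinearMap.add_apply, op_add, add_smul, ha, hb]

/-- The map `a ⊗ t ↦ y a ⊗ t`. -/
def applyA (P : BimodulePair.{u}) (y : P.T) : BTensor P.R P.A P.T'T →ₗ[P.Rᵐᵒᵖ] P.TT'T where
  toFun s := P.absorbRight (BTensor.tmul P.R y s)
  map_add' s t := by rw [BTensor.tmul_add, map_add]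
  map_smul' r s := by rw [← BTensor.op_smul_tmul, BHom.map_mop_smul]; rfl

theorem applyA_apply (y : P.T) (s : BTensor P.R P.A P.T'T) :
    applyA P y s = P.absorbRight (BTensor.tmul P.R y s) := rfl

/-- The rebracketing `(T ⊗ T') ⊗ (T ⊗ T') → (T ⊗ (T' ⊗ T)) ⊗ T'`. -/
def rebracketD (P : BimodulePair.{u}) :
    BTensor P.S P.TT' P.TT' →+ BTensor P.R P.TT'T P.T' :=
  ((BHom.assoc P.S P.R P.R P.S P.T P.T' P.T).tmap (BHom.id P.R P.S P.T')).toAddMonoidHom.comp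
    (BTensor.assoc P.S P.R P.TT' P.T P.T').symm.toAddMonoidHom

theorem rebracketD_apply (t : BTensor P.S P.TT' P.TT') : rebracketD P t =
    (BHom.assoc P.S P.R P.R P.S P.T P.T' P.T).tmap (BHom.id P.R P.S P.T')
      ((BTensor.assoc P.S P.R P.TT' P.T P.T').symm t) := rfl

theorem rebracketD_injective : Function.Injective (rebracketD P) := by
  have h : ((BHom.assoc P.S P.R P.R P.S P.T P.T' P.T).tmap (BHom.id P.R P.S P.T')).IsSplit :=
    BHom.IsSplit.tmap_id ⟨BHom.assocSymm P.S P.R P.R P.S P.T P.T' P.T, fun t => by simp⟩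
  exact h.injective.comp (BTensor.assoc P.S P.R P.TT' P.T P.T').symm.injective

theorem rebracketD_smul_γl (t : P.TT') (x' : P.T') (y : P.T) :
    rebracketD P (F.ev' (BTensor.tmul P.R y x') • H.γl t) =
      BTensor.map (applyA P y) LinearMap.id (H.ξC.tmap (BHom.id P.R P.S P.T')
        ((BTensor.assoc P.S P.R P.T' P.T P.T').symm (BTensor.tmul P.S x' t))) := by
  have h : ∀ (b : P.B) (z' : P.T') (u : BTensor P.S P.TT' P.T), rebracketD P (b •
      BTensor.assoc P.S P.R P.TT' P.T P.T' (BTensor.tmul P.R u z')) =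
      BTensor.tmul P.R (b • BTensor.assoc P.R P.S P.T P.T' P.T u) z' := by
    intro b z' u
    induction u using BTensor.induction_on_left with
    | zero => simp
    | simple x y' y => simp [rebracketD_apply]
    | add a b ha hb => simp only [map_add, BTensor.add_tmul, smul_add, ha, hb]
  induction t using BTensor.induction_on with
  | zero => simp
  | simple x z' =>
    rw [γl_tmul, h, BTensor.assoc_symm_tmul, BHom.tmap_tmul, BTensor.map_tmul, LinearMap.id_apply,
      BHom.id_apply, applyA_apply, absorbRight_ξC, assoc_γL]
  | add a b ha hb => simp only [map_add, BTensor.tmul_add, smul_add, ha, hb]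

theorem rebracketD_tmul (t : P.TT') (x' : P.T') (y : P.T) :
    rebracketD P (BTensor.tmul P.S (BTensor.tmul P.R y x') t) =
      BTensor.map (applyA P y) LinearMap.id (P.ζC.tmap (BHom.id P.R P.S P.T')
        ((BTensor.assoc P.S P.R P.T' P.T P.T').symm (BTensor.tmul P.S x' t))) := by
  induction t using BTensor.induction_on with
  | zero => simp
  | simple z' x => simp [rebracketD_apply, applyA_apply]
  | add a b ha hb => simp only [map_add, BTensor.tmul_add, ha, hb]

/-- Mirror image of `eq_of_applyB`: contraction with `x'` multiplies `s` on the left by `ev(x' ⊗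
x)`. -/
theorem eq_of_applyA (hev : Function.Surjective F.ev)
    {s s' : BTensor P.R (BTensor P.R P.A P.T'T) P.T'}
    (h : ∀ y : P.T, BTensor.map (applyA P y) (LinearMap.id : P.T' →ₗ[P.R] P.T') s =
      BTensor.map (applyA P y) LinearMap.id s') : s = s' := by
  let N : BHom P.R P.S (BTensor P.S P.T' (BTensor P.R P.TT'T P.T'))
      (BTensor P.R (BTensor P.R P.A P.T'T) P.T') :=
    (((F.evR.tmap (BHom.id P.R P.R P.T'T)).comp
      (BHom.assocSymm P.R P.R P.S P.R P.T' P.T P.T'T)).tmap (BHom.id P.R P.S P.T')).comp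
        (BHom.assocSymm P.R P.S P.S P.R P.T' P.TT'T P.T')
  have hN : ∀ (s : BTensor P.R (BTensor P.R P.A P.T'T) P.T') (x : P.T) (x' : P.T'),
      N (BTensor.tmul P.S x' (BTensor.map (applyA P x) LinearMap.id s)) =
        F.ev (BTensor.tmul P.S x' x) • s := by
    intro s x x'
    induction s using BTensor.induction_on_left with
    | zero => simp
    | simple a t z' => simp [N, applyA_apply, ev_tmul_op_smul]
    | add a b ha hb => simp only [map_add, BTensor.tmul_add, smul_add, ha, hb]
  have e : ∀ t : P.T'T, F.ev t • s = F.ev t • s' := by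
    intro t
    induction t using BTensor.induction_on with
    | zero => simp
    | simple x x' => rw [← hN, ← hN, h]
    | add a b ha hb => simp only [map_add, add_smul, ha, hb]
  obtain ⟨t, ht⟩ := hev 1
  simpa [ht] using e t

variable (H) in
/-- The map `d ⊗ (b ⊗ d') ↦ d b ⊗ d'`. -/
def embedD : BTensor P.S H.D (BTensor P.S P.B H.D) →+ BTensor P.S P.TT' P.TT' :=
  (H.actD.tmap H.ιD).toAddMonoidHom.comp (BTensor.assoc P.S P.S H.D P.B H.D).symm.toAddMonoidHom

theorem embedD_apply (t : BTensor P.S H.D (BTensor P.S P.B H.D)) :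
    H.embedD t = H.actD.tmap H.ιD ((BTensor.assoc P.S P.S H.D P.B H.D).symm t) := rfl

theorem fromT'D_tmul (x' : P.T') (d : H.D) : H.fromT'D (BTensor.tmul P.S x' d) =
    (BTensor.assoc P.S P.R P.T' P.T P.T').symm (BTensor.tmul P.S x' (H.ιD d)) := by
  simp [fromT'D]

namespace Tame

theorem embedD_injective (hH : H.Tame) : Function.Injective H.embedD :=
  (hH.tmap_ιD_injective hH.actD_isSplit.tmap_id.injective).comp
    (BTensor.assoc P.S P.S H.D P.B H.D).symm.injective

theorem embedD_leftEntwinedCoaction (hH : H.Tame) (b : P.B) (d : H.D) :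
    H.embedD (leftEntwinedCoaction hH.coringD hH.φ (BTensor.tmul P.S b d)) =
      b • H.γl (H.ιD d) := by
  have h : ∀ v : BTensor P.S H.D H.D, H.actD.tmap H.ιD (hH.φ.tmap (BHom.id P.S P.S H.D)
      ((BTensor.assoc P.S P.S P.B H.D H.D).symm (BTensor.tmul P.S b v))) =
      b • H.ιD.tmap H.ιD v := by
    intro v
    induction v using BTensor.induction_on with
    | zero => simp
    | simple c c' => simp [actD_φ]
    | add a b ha hb => simp only [map_add, BTensor.tmul_add, smul_add, ha, hb]
  rw [leftEntwinedCoaction_tmul, embedD_apply, AddEquiv.symm_apply_apply, h]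
  exact congrArg _ (hH.ιD_tmap_ιD_comulD d)

theorem rebracketD_leftEntwinedCoaction (hH : H.Tame) (v : BTensor P.S P.T' H.D) (y : P.T) :
    rebracketD P (H.embedD (leftEntwinedCoaction hH.coringD hH.φ (H.contractD v y))) =
      BTensor.map (applyA P y) LinearMap.id
        (H.ξC.tmap (BHom.id P.R P.S P.T') (H.fromT'D v)) := by
  induction v using BTensor.induction_on with
  | zero => simp
  | simple x' d =>
    rw [contractD_tmul, embedD_leftEntwinedCoaction, rebracketD_smul_γl, fromT'D_tmul]
  | add a b ha hb => simp only [map_add, LinearMap.add_apply, ha, hb]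

theorem rebracketD_map_contractD (hH : H.Tame) (v : BTensor P.S P.T' H.D) (y : P.T) :
    rebracketD P (H.embedD (BTensor.map LinearMap.id (restrictLeft P.S (H.contractD v))
      (hH.ρTD y))) =
      BTensor.map (applyA P y) LinearMap.id
        (P.ζC.tmap (BHom.id P.R P.S P.T') (H.fromT'D v)) := by
  have h₂ : ∀ (x' : P.T') (d : H.D) (v : BTensor P.S H.D P.T),
      H.embedD (BTensor.map LinearMap.id
        (restrictLeft P.S (H.contractD (BTensor.tmul P.S x' d))) v) =
      BTensor.tmul P.S (ract P.S P.B P.S P.TT' ((BHom.id P.S P.S P.TT').tmap F.ev'S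
        (BTensor.assoc P.S P.R P.TT' P.T P.T' (BTensor.tmul P.R
          (H.ιD.tmap (BHom.id P.S P.R P.T) v) x')))) (H.ιD d) := by
    intro x' d v
    induction v using BTensor.induction_on with
    | zero => simp
    | simple x c => simp [embedD_apply]
    | add a b ha hb => simp only [map_add, BTensor.add_tmul, ha, hb]
  induction v using BTensor.induction_on with
  | zero => simp [map_restrictLeft_zero]
  | simple x' d =>
    rw [h₂, ρTD_spec, ← γl_tmul, ← ξD_apply, ract_ξD, rebracketD_tmul, fromT'D_tmul]
  | add a b ha hb => simp only [map_restrictLeft_add, map_add, ha, hb]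

/-- The roles of `C` and `D` are exchanged: for an element of `T' ⊗_S D`, colinearity is the
equation of `C ⊗_R T'`. -/
theorem contractD_mem_iff (hH : H.Tame) (v : BTensor P.S P.T' H.D) :
    H.contractD v ∈ leftComoduleHom hH.ρTD.l (leftEntwinedCoaction hH.coringD hH.φ).l ↔
      H.ξC.tmap (BHom.id P.R P.S P.T') (H.fromT'D v) =
        P.ζC.tmap (BHom.id P.R P.S P.T') (H.fromT'D v) := by
  rw [mem_leftComoduleHom_iff]
  have e : ∀ y, BTensor.map LinearMap.id (restrictLeft P.S (H.contractD v)) (hH.ρTD.l y) =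
      (leftEntwinedCoaction hH.coringD hH.φ).l (H.contractD v y) ↔
      BTensor.map (applyA P y) LinearMap.id
        (H.ξC.tmap (BHom.id P.R P.S P.T') (H.fromT'D v)) =
      BTensor.map (applyA P y) LinearMap.id
        (P.ζC.tmap (BHom.id P.R P.S P.T') (H.fromT'D v)) := by
    intro y
    rw [← (rebracketD_injective.comp hH.embedD_injective).eq_iff, Function.comp_apply,
      Function.comp_apply, BHom.l_apply, BHom.l_apply, rebracketD_leftEntwinedCoaction,
      rebracketD_map_contractD, eq_comm]
  exact ⟨fun h => eq_of_applyA hH.ev_surjective fun y => (e y).1 (h y),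
    fun h y => (e y).2 (congrArg _ h)⟩

/-- The isomorphism `T̄ → ^𝒟Hom(T, B ⊗_S D)`. -/
def h₂ (hH : H.Tame) : H.Tbar →+ (P.T →ₗ[P.B] BTensor P.S P.B H.D) :=
  H.contractD.comp hH.toT'D.toAddMonoidHom

theorem h₂_apply (hH : H.Tame) (z : H.Tbar) : hH.h₂ z = H.contractD (hH.toT'D z) := rfl

theorem id_tmap_ιD_h₂ (hH : H.Tame) (z : H.Tbar) (y : P.T) :
    (BHom.id P.S P.S P.B).tmap H.ιD (hH.h₂ z y) = F.contractLeft y (H.ιT z) := by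
  rw [h₂_apply, id_tmap_ιD_contractD, fromT'D_toT'D]

theorem h₂_injective (hH : H.Tame) : Function.Injective hH.h₂ := by
  obtain ⟨t, ht⟩ := hH.ev_surjective 1
  intro a b h
  apply hH.toT'D_injective
  have e := congrArg (fun f => H.expandD f t) h
  simpa [h₂_apply, expandD_contractD, ht] using e

theorem range_h₂ (hH : H.Tame) : Set.range hH.h₂ =
    leftComoduleHom hH.ρTD.l (leftEntwinedCoaction hH.coringD hH.φ).l := by
  ext f
  constructor
  · rintro ⟨z, rfl⟩
    rw [h₂_apply, contractD_mem_iff, fromT'D_toT'D, ← hH.fromCT'_toCT']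
    exact ξC_tmap_id_fromCT' _
  · intro hf
    obtain ⟨t, ht⟩ := hH.ev_surjective 1
    have e : H.contractD (H.expandD f t) = f := LinearMap.ext fun y => by
      rw [contractD_expandD, ht, op_one, one_smul]
    rw [← e, contractD_mem_iff] at hf
    obtain ⟨z, hz⟩ := exists_ιT (hH.exists_fromCT' hf) ⟨_, rfl⟩
    refine ⟨z, ?_⟩
    rw [← e, h₂_apply]
    exact congrArg _ (hH.fromT'D_injective ((hH.fromT'D_toT'D z).trans hz))

theorem h₂_smul (hH : H.Tame) (r : P.R) (z : H.Tbar) (y : P.T) :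
    hH.h₂ (r • z) y = hH.h₂ z (op r • y) := by
  rw [h₂_apply, BHom.map_smul, contractD_smul, h₂_apply]

theorem h₂_op_smul (hH : H.Tame) (s : P.S) (z : H.Tbar) (y : P.T) :
    hH.h₂ (op s • z) y = op s • hH.h₂ z y := by
  rw [h₂_apply, BHom.map_op_smul, contractD_op_smul, h₂_apply]

end Tame

/-! ### The map `T̄ → T'` -/

variable (H) in
/-- The common restriction of `ev ⊗_A T'` and `T' ⊗_B ev'`. -/
def h : BHom P.R P.S H.Tbar P.T' :=
  (lact P.R P.A P.S P.T').comp ((F.evR.tmap (BHom.id P.R P.S P.T')).comp H.ιT)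

theorem h_eq_evLeft (z : H.Tbar) : H.h z = F.evLeft (H.ιT z) := rfl

/-- This is the second triangle identity, so the two maps already agree on all of `T' ⊗_S T ⊗_R T'`.
-/
theorem evLeft_eq_evRight (t : P.T'TT') : F.evLeft t = F.evRight t := by
  change leftAct P.R P.A P.T' (F.evR.tmap (BHom.id P.R P.S P.T') t) =
    rightAct P.S P.B P.T' ((BHom.id P.R P.S P.T').tmap F.ev'S
      (BTensor.assoc P.S P.R P.T' P.T P.T' t))
  induction t using BTensor.induction_on_left with
  | zero => simp
  | simple x' x y' => simp [F.triangle']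
  | add a b ha hb => simp only [map_add, ha, hb]

end BimoduleHerd

/-! ### Cancellation for split maps -/

namespace BHom

variable {K L M N P : Type*} [Ring K] [Ring L] [AddCommGroup M] [AddCommGroup N] [AddCommGroup P]
  [Module K M] [Module Lᵐᵒᵖ M] [Module K N] [Module Lᵐᵒᵖ N] [Module K P] [Module Lᵐᵒᵖ P]

theorem IsSplit.of_comp {g : BHom K L N P} {f : BHom K L M N} (h : (g.comp f).IsSplit) :
    f.IsSplit := by
  obtain ⟨k, hk⟩ := h
  exact ⟨k.comp g, hk⟩

end BHom

namespace BimoduleHerd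

variable {P : BimodulePair.{u}} {F : FormalDual P} {H : BimoduleHerd F}

/-! ### The maps `D → T ⊗_R T̄` and `C → T̄ ⊗_S T` -/

variable (H) in
/-- The map `γ ⊗_R T'`, as a map `T ⊗_R T' → T ⊗_R (T' ⊗_S T ⊗_R T')`. -/
def γmidD : BHom P.S P.S P.TT' (BTensor P.R P.T P.T'TT') :=
  (BHom.assoc P.S P.S P.R P.R P.T P.T'T P.T').comp (H.γ.tmap (BHom.id P.R P.S P.T'))

variable (H) in
/-- The map `T' ⊗_S γ`, as a map `T' ⊗_S T → (T' ⊗_S T ⊗_R T') ⊗_S T`. -/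
def γmidC : BHom P.R P.R P.T'T (BTensor P.S P.T'TT' P.T) :=
  (BHom.assocSymm P.R P.R P.R P.S P.T'T P.T' P.T).comp H.γr

theorem γmidD_tmul (y : P.T) (y' : P.T') : H.γmidD (BTensor.tmul P.R y y') =
    BTensor.assoc P.R P.R P.T P.T'T P.T' (BTensor.tmul P.R (H.γ y) y') := by
  simp [γmidD]

theorem γmidC_apply (t : P.T'T) : H.γmidC t =
    (BTensor.assoc P.R P.S P.T'T P.T' P.T).symm (H.γr t) := rfl

theorem id_tmap_assoc_γmidD (t : P.TT') :
    (BHom.id P.S P.R P.T).tmap (BHom.assoc P.R P.S P.S P.R P.T' P.T P.T') (H.γmidD t) =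
      BTensor.assoc P.R P.S P.T P.T' P.TT' (H.γl t) := by
  have h : ∀ (u : P.TT'T) (y' : P.T'),
      (BHom.id P.S P.R P.T).tmap (BHom.assoc P.R P.S P.S P.R P.T' P.T P.T')
        (BTensor.assoc P.R P.R P.T P.T'T P.T' (BTensor.tmul P.R u y')) =
      BTensor.assoc P.R P.S P.T P.T' P.TT' (BTensor.assoc P.S P.R P.TT' P.T P.T'
        (BTensor.tmul P.R ((BTensor.assoc P.R P.S P.T P.T' P.T).symm u) y')) := by
    intro u y'
    induction u using BTensor.induction_on_right with
    | zero => simp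
    | simple x x' y => simp
    | add a b ha hb => simp only [map_add, BTensor.add_tmul, ha, hb]
  induction t using BTensor.induction_on with
  | zero => simp
  | simple y y' => rw [γmidD_tmul, h, γl_tmul, γL_apply]
  | add a b ha hb => simp only [map_add, ha, hb]

/-- Up to bracketing, `γ ⊗ T'` is `γl`, so this is the equation of `D` for the last two legs of `γl
d`. -/
theorem id_tmap_id_tmap_ξD_γmidD (d : H.D) :
    (BHom.id P.S P.R P.T).tmap ((BHom.id P.R P.S P.T').tmap H.ξD)
      ((BHom.id P.S P.R P.T).tmap (BHom.assoc P.R P.S P.S P.R P.T' P.T P.T')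
        (H.γmidD (H.ιD d))) =
    (BHom.id P.S P.R P.T).tmap ((BHom.id P.R P.S P.T').tmap P.ζD)
      ((BHom.id P.S P.R P.T).tmap (BHom.assoc P.R P.S P.S P.R P.T' P.T P.T')
        (H.γmidD (H.ιD d))) := by
  have e : (BHom.id P.S P.R P.T).tmap (BHom.id P.R P.S P.T') = BHom.id P.S P.S P.TT' :=
    BHom.ext fun t => BHom.tmap_id t
  rw [id_tmap_assoc_γmidD, ← BHom.assoc_tmap, ← BHom.assoc_tmap, e, id_tmap_ξD_γl_ιD]

theorem ξC_tmap_id_tmap_id_γmidC (c : H.C) :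
    (H.ξC.tmap (BHom.id P.R P.S P.T')).tmap (BHom.id P.S P.R P.T) (H.γmidC (H.ιC c)) =
      (P.ζC.tmap (BHom.id P.R P.S P.T')).tmap (BHom.id P.S P.R P.T) (H.γmidC (H.ιC c)) := by
  have e : (BHom.id P.R P.S P.T').tmap (BHom.id P.S P.R P.T) = BHom.id P.R P.R P.T'T :=
    BHom.ext fun t => BHom.tmap_id t
  rw [γmidC_apply, ← BHom.assoc_symm_tmap, ← BHom.assoc_symm_tmap, e, ξC_tmap_id_γr_ιC]

namespace Tame

theorem id_tmap_fromCT'_ρTC (hH : H.Tame) (t : P.TT') :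
    (BHom.id P.S P.R P.T).tmap H.fromCT' (BTensor.assoc P.R P.R P.T H.C P.T'
      (hH.ρTC.tmap (BHom.id P.R P.S P.T') t)) = H.γmidD t := by
  rw [fromCT', ← BHom.assoc_tmap, BHom.tmap_tmap]
  exact congrArg _ (BHom.tmap_congr hH.ρTC_spec (fun _ => rfl) t)

theorem fromT'D_tmap_id_ρTD (hH : H.Tame) (t : P.T'T) :
    H.fromT'D.tmap (BHom.id P.S P.R P.T) ((BTensor.assoc P.S P.S P.T' H.D P.T).symm
      ((BHom.id P.R P.S P.T').tmap hH.ρTD t)) = H.γmidC t := by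
  have h : ∀ (x' : P.T') (u : P.TT'T),
      (BHom.assocSymm P.R P.S P.S P.R P.T' P.T P.T').tmap (BHom.id P.S P.R P.T)
        ((BTensor.assoc P.S P.S P.T' P.TT' P.T).symm (BTensor.tmul P.S x'
          ((BTensor.assoc P.R P.S P.T P.T' P.T).symm u))) =
      (BTensor.assoc P.R P.S P.T'T P.T' P.T).symm
        ((BTensor.assoc P.S P.R P.T' P.T P.T'T).symm (BTensor.tmul P.S x' u)) := by
    intro x' u
    induction u using BTensor.induction_on_right with
    | zero => simp
    | simple x x' y => simp
    | add a b ha hb => simp only [map_add, BTensor.tmul_add, ha, hb]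
  induction t using BTensor.induction_on with
  | zero => simp
  | simple x' y =>
    rw [fromT'D, BHom.tmap_id_comp, ← BHom.assoc_symm_tmap, BHom.tmap_tmul, BHom.tmap_tmul,
      ρTD_spec, γmidC_apply, γr_tmul, BHom.id_apply, γL_apply]
    exact h x' (H.γ y)
  | add a b ha hb => simp only [map_add, ha, hb]

/-- Inside `C ⊗_R T'`, the bimodule `T̄` is the equaliser of `T' ⊗ ξD` and `T' ⊗ ζD` (`ha`), and `T
⊗_R -` preserves it. The coaction `ρTC` accounts for the condition on `C`, and the choice of `d` in
`D` accounts for the other. -/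
theorem exists_galD (hH : H.Tame) (d : H.D) : ∃ t : BTensor P.R P.T H.Tbar,
    (BHom.id P.S P.R P.T).tmap hH.toCT' t = BTensor.assoc P.R P.R P.T H.C P.T'
      (hH.ρTC.tmap (BHom.id P.R P.S P.T') (H.ιD d)) := by
  let a : BHom P.R P.S (BTensor P.R H.C P.T') (BTensor P.S P.T' P.TT') :=
    (BHom.assoc P.R P.S P.S P.R P.T' P.T P.T').comp H.fromCT'
  have ha : ∀ w, (BHom.id P.R P.S P.T').tmap H.ξD (a w) =
      (BHom.id P.R P.S P.T').tmap P.ζD (a w) ↔ ∃ z, hH.toCT' z = w := by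
    intro w
    constructor
    · intro h
      obtain ⟨z, hz⟩ := exists_ιT ⟨_, rfl⟩ (hH.exists_fromT'D h)
      exact ⟨z, hH.fromCT'_injective ((hH.fromCT'_toCT' z).trans hz)⟩
    · rintro ⟨z, rfl⟩
      change (BHom.id P.R P.S P.T').tmap H.ξD (BTensor.assoc P.S P.R P.T' P.T P.T'
        (H.fromCT' (hH.toCT' z))) = (BHom.id P.R P.S P.T').tmap P.ζD
          (BTensor.assoc P.S P.R P.T' P.T P.T' (H.fromCT' (hH.toCT' z)))
      rw [fromCT'_toCT', ← hH.fromT'D_toT'D]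
      exact id_tmap_ξD_fromT'D _
  refine ((RightFaithfullyFlat.exact_iff (S := P.S) hH.flat_right hH.toCT'
    (((BHom.id P.R P.S P.T').tmap H.ξD).comp a)
    (((BHom.id P.R P.S P.T').tmap P.ζD).comp a)).1 ha _).1 ?_
  have e : ∀ (f : BHom P.R P.S (BTensor P.S P.T' P.TT') (BTensor P.S P.T'
      (BTensor P.S P.TT' P.B))), (BHom.id P.S P.R P.T).tmap (f.comp a)
        (BTensor.assoc P.R P.R P.T H.C P.T' (hH.ρTC.tmap (BHom.id P.R P.S P.T') (H.ιD d))) =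
      (BHom.id P.S P.R P.T).tmap f
        ((BHom.id P.S P.R P.T).tmap (BHom.assoc P.R P.S P.S P.R P.T' P.T P.T')
          (H.γmidD (H.ιD d))) := by
    intro f
    rw [BHom.id_tmap_comp, BHom.id_tmap_comp, id_tmap_fromCT'_ρTC]
  rw [e, e, id_tmap_id_tmap_ξD_γmidD]

/-- The map `D → T ⊗_R T̄` induced by `γ ⊗_R T'`. -/
def galD (hH : H.Tame) : BHom P.S P.S H.D (BTensor P.R P.T H.Tbar) :=
  BHom.factor ((BHom.id P.S P.R P.T).tmap hH.toCT') (hH.id_tmap_injective hH.toCT'_injective)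
    ((BHom.assoc P.S P.S P.R P.R P.T H.C P.T').comp
      ((hH.ρTC.tmap (BHom.id P.R P.S P.T')).comp H.ιD)) hH.exists_galD

theorem id_tmap_ιT_galD (hH : H.Tame) (d : H.D) :
    (BHom.id P.S P.R P.T).tmap H.ιT (hH.galD d) = H.γmidD (H.ιD d) := by
  have e : H.ιT = H.fromCT'.comp hH.toCT' := BHom.ext fun z => (hH.fromCT'_toCT' z).symm
  rw [e, BHom.id_tmap_comp, ← hH.id_tmap_fromCT'_ρTC]
  exact congrArg _ (BHom.apply_factor _ _ _ _ d)

theorem exists_galC (hH : H.Tame) (c : H.C) : ∃ t : BTensor P.S H.Tbar P.T,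
    hH.toT'D.tmap (BHom.id P.S P.R P.T) t = (BTensor.assoc P.S P.S P.T' H.D P.T).symm
      ((BHom.id P.R P.S P.T').tmap hH.ρTD (H.ιC c)) := by
  have ha : ∀ v, H.ξC.tmap (BHom.id P.R P.S P.T') (H.fromT'D v) =
      P.ζC.tmap (BHom.id P.R P.S P.T') (H.fromT'D v) ↔ ∃ z, hH.toT'D z = v := by
    intro v
    constructor
    · intro h
      obtain ⟨z, hz⟩ := exists_ιT (hH.exists_fromCT' h) ⟨_, rfl⟩
      exact ⟨z, hH.fromT'D_injective ((hH.fromT'D_toT'D z).trans hz)⟩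
    · rintro ⟨z, rfl⟩
      rw [fromT'D_toT'D, ← hH.fromCT'_toCT']
      exact ξC_tmap_id_fromCT' _
  refine ((LeftFaithfullyFlat.exact_iff (R := P.R) hH.flat_left hH.toT'D
    ((H.ξC.tmap (BHom.id P.R P.S P.T')).comp H.fromT'D)
    ((P.ζC.tmap (BHom.id P.R P.S P.T')).comp H.fromT'D)).1 ha _).1 ?_
  rw [BHom.tmap_id_comp, BHom.tmap_id_comp, fromT'D_tmap_id_ρTD, ξC_tmap_id_tmap_id_γmidC]

/-- The map `C → T̄ ⊗_S T` induced by `T' ⊗_S γ`. -/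
def galC (hH : H.Tame) : BHom P.R P.R H.C (BTensor P.S H.Tbar P.T) :=
  BHom.factor (hH.toT'D.tmap (BHom.id P.S P.R P.T)) (hH.tmap_id_injective hH.toT'D_injective)
    ((BHom.assocSymm P.R P.R P.S P.S P.T' H.D P.T).comp
      (((BHom.id P.R P.S P.T').tmap hH.ρTD).comp H.ιC)) hH.exists_galC

theorem ιT_tmap_id_galC (hH : H.Tame) (c : H.C) :
    H.ιT.tmap (BHom.id P.S P.R P.T) (hH.galC c) = H.γmidC (H.ιC c) := by
  have e : H.ιT = H.fromT'D.comp hH.toT'D := BHom.ext fun z => (hH.fromT'D_toT'D z).symm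
  rw [e, BHom.tmap_id_comp, ← hH.fromT'D_tmap_id_ρTD]
  exact congrArg _ (BHom.apply_factor _ _ _ _ c)

/-! ### Purity of `T̄` in `T' ⊗_S T ⊗_R T'` -/

/-- The map `T ⊗_R T̄ → B ⊗_S D` induced by `ev'`. -/
def contractTbar (hH : H.Tame) : BHom P.S P.S (BTensor P.R P.T H.Tbar) (BTensor P.S P.B H.D) :=
  (F.ev'S.tmap (BHom.id P.S P.S H.D)).comp ((BHom.assocSymm P.S P.S P.R P.S P.T P.T' H.D).comp
    ((BHom.id P.S P.R P.T).tmap hH.toT'D))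

/-- The retraction is `b ⊗ d ↦ b galD(d)`. Seen in `T ⊗ (T' ⊗ T ⊗ T')`, the composite sends `x ⊗ z`
to `x` absorbed into `(ξC ⊗ T') z`, by the description of `z` in `T' ⊗ D` and the triangle identity
(`h`, `hξ`). The description of `z` in `C ⊗ T'` then replaces `ξC` by `ζC`, which gives back `x ⊗ z`
(`hζ`). -/
theorem contractTbar_isSplit (hH : H.Tame) : hH.contractTbar.IsSplit := by
  refine ⟨(lact P.S P.B P.S (BTensor P.R P.T H.Tbar)).comp
    ((BHom.id P.S P.S P.B).tmap hH.galD), fun t => ?_⟩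
  apply hH.id_tmap_injective ιT_injective
  have hζ : ∀ (x : P.T) (z : P.T'TT'), BTensor.assoc P.R P.R P.T P.T'T P.T'
      (BTensor.map (applyA P x) LinearMap.id (P.ζC.tmap (BHom.id P.R P.S P.T') z)) =
        BTensor.tmul P.R x z := by
    intro x z
    induction z using BTensor.induction_on with
    | zero => simp
    | simple t x' => simp [applyA_apply]
    | add a b ha hb => simp only [map_add, BTensor.tmul_add, ha, hb]
  have hξ : ∀ (x : P.T) (x' : P.T') (t : P.TT'), BTensor.assoc P.R P.R P.T P.T'T P.T'
      (BTensor.map (applyA P x) LinearMap.id (H.ξC.tmap (BHom.id P.R P.S P.T')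
        ((BTensor.assoc P.S P.R P.T' P.T P.T').symm (BTensor.tmul P.S x' t)))) =
      F.ev' (BTensor.tmul P.R x x') • H.γmidD t := by
    intro x x' t
    induction t using BTensor.induction_on with
    | zero => simp
    | simple y y' =>
      rw [BTensor.assoc_symm_tmul, BHom.tmap_tmul, BTensor.map_tmul, applyA_apply, absorbRight_ξC,
        γmidD_tmul, ← BTensor.smul_tmul']
      exact (BHom.assoc P.B P.S P.R P.R P.T P.T'T P.T').map_smul _ _
    | add a b ha hb => simp only [map_add, BTensor.tmul_add, smul_add, ha, hb]
  have hb : ∀ (b : P.B) (s : BTensor P.R P.T H.Tbar), (BHom.id P.S P.R P.T).tmap H.ιT (b • s) =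
      b • (BHom.id P.S P.R P.T).tmap H.ιT s := fun b s =>
    ((BHom.id P.B P.R P.T).tmap H.ιT).map_smul b s
  have h : ∀ (x : P.T) (v : BTensor P.S P.T' H.D), (BHom.id P.S P.R P.T).tmap H.ιT
      (lact P.S P.B P.S (BTensor P.R P.T H.Tbar) ((BHom.id P.S P.S P.B).tmap hH.galD
        (F.ev'S.tmap (BHom.id P.S P.S H.D)
          ((BTensor.assoc P.R P.S P.T P.T' H.D).symm (BTensor.tmul P.R x v))))) =
      BTensor.assoc P.R P.R P.T P.T'T P.T' (BTensor.map (applyA P x) LinearMap.id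
        (H.ξC.tmap (BHom.id P.R P.S P.T') (H.fromT'D v))) := by
    intro x v
    induction v using BTensor.induction_on with
    | zero => simp
    | simple x' d => rw [fromT'D_tmul, hξ]; simp [hb, id_tmap_ιT_galD]
    | add a b ha hb => simp only [map_add, BTensor.tmul_add, ha, hb]
  induction t using BTensor.induction_on with
  | zero => simp
  | simple x z =>
    refine Eq.trans (?_ : _ = _) ((h x (hH.toT'D z)).trans ?_)
    · simp [contractTbar]
    · rw [fromT'D_toT'D, ← hH.fromCT'_toCT', ξC_tmap_id_fromCT', hζ, BHom.tmap_tmul,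
        fromCT'_toCT', BHom.id_apply]
  | add a b ha hb => simp only [map_add, ha, hb]

/-- The composite `T ⊗ T̄ ⊗ T → B ⊗ D ⊗ T → B ⊗ TT' ⊗ T` is split, the second arrow because `ιD ⊗ T`
is. It equals `T ⊗ ιT ⊗ T` followed by the contraction `g ⊗ T`, and the first factor of a split
composite is split. -/
theorem isSplit_T_ιT_T (hH : H.Tame) :
    (((BHom.id P.S P.R P.T).tmap H.ιT).tmap (BHom.id P.S P.R P.T)).IsSplit := by
  have h : ((((BHom.id P.S P.S P.B).tmap H.ιD).comp hH.contractTbar).tmap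
      (BHom.id P.S P.R P.T)).IsSplit := by
    have e : (((BHom.id P.S P.S P.B).tmap H.ιD).comp hH.contractTbar).tmap (BHom.id P.S P.R P.T) =
        (((BHom.id P.S P.S P.B).tmap H.ιD).tmap (BHom.id P.S P.R P.T)).comp
          (hH.contractTbar.tmap (BHom.id P.S P.R P.T)) :=
      BHom.ext fun t => BHom.tmap_id_comp _ _ t
    rw [e]
    exact hH.isSplit_ιD_T.tmap_tmap_id.comp hH.contractTbar_isSplit.tmap_id
  let g : BHom P.S P.S (BTensor P.R P.T P.T'TT') (BTensor P.S P.B P.TT') :=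
    (F.ev'S.tmap (BHom.id P.S P.S P.TT')).comp ((BHom.assocSymm P.S P.S P.R P.S P.T P.T' P.TT').comp
      ((BHom.id P.S P.R P.T).tmap (BHom.assoc P.R P.S P.S P.R P.T' P.T P.T')))
  have e : ((BHom.id P.S P.S P.B).tmap H.ιD).comp hH.contractTbar =
      g.comp ((BHom.id P.S P.R P.T).tmap H.ιT) := by
    refine BHom.ext fun t => ?_
    have hv : ∀ (x : P.T) (v : BTensor P.S P.T' H.D), (BHom.id P.S P.S P.B).tmap H.ιD
        (F.ev'S.tmap (BHom.id P.S P.S H.D)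
          ((BTensor.assoc P.R P.S P.T P.T' H.D).symm (BTensor.tmul P.R x v))) =
        g (BTensor.tmul P.R x (H.fromT'D v)) := by
      intro x v
      induction v using BTensor.induction_on with
      | zero => simp
      | simple x' d => simp [g, fromT'D_tmul]
      | add a b ha hb => simp only [map_add, BTensor.tmul_add, ha, hb]
    induction t using BTensor.induction_on with
    | zero => simp
    | simple x z =>
      rw [BHom.comp_apply, BHom.comp_apply, BHom.tmap_tmul, ← hH.fromT'D_toT'D, BHom.id_apply, ← hv]
      simp [contractTbar]
    | add a b ha hb => simp only [map_add, ha, hb]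
  rw [e] at h
  refine BHom.IsSplit.of_comp (g := g.tmap (BHom.id P.S P.R P.T)) ?_
  have e' : (g.comp ((BHom.id P.S P.R P.T).tmap H.ιT)).tmap (BHom.id P.S P.R P.T) =
      (g.tmap (BHom.id P.S P.R P.T)).comp
        (((BHom.id P.S P.R P.T).tmap H.ιT).tmap (BHom.id P.S P.R P.T)) :=
    BHom.ext fun t => BHom.tmap_id_comp _ _ t
  rwa [e'] at h

section Purity

variable {K L M N : Type u} [Ring K] [Ring L] [AddCommGroup M] [AddCommGroup N]
  [Module K M] [Module P.Sᵐᵒᵖ M] [SMulCommClass K P.Sᵐᵒᵖ M]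
  [Module P.R N] [Module Lᵐᵒᵖ N] [SMulCommClass P.R Lᵐᵒᵖ N]

theorem isSplit_id_ιT_id (hH : H.Tame) :
    (((BHom.id K P.R (BTensor P.S M P.T)).tmap H.ιT).tmap
      (BHom.id P.S L (BTensor P.R P.T N))).IsSplit := by
  refine BHom.IsSplit.tmap_id_tensor ?_
  rw [BHom.isSplit_tmap_tmap_iff]
  refine BHom.IsSplit.id_tensor_tmap ?_
  rw [← BHom.isSplit_tmap_tmap_iff]
  exact hH.isSplit_T_ιT_T

/-- Injectivity may be tested after `- ⊗_S T`, where the map becomes `M ⊗ (T ⊗ ιT ⊗ T)` and is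
split. A factor `T` next to `T̄` has to be present already; faithful flatness supplies the one on
the other side. -/
theorem id_tmap_ιT_injective (hH : H.Tame) :
    Function.Injective ((BHom.id K P.R (BTensor P.S M P.T)).tmap H.ιT) := by
  refine (LeftFaithfullyFlat.injective_iff (R := P.R) hH.flat_left _).2
    (BHom.IsSplit.injective ?_)
  rw [BHom.isSplit_tmap_tmap_iff]
  refine BHom.IsSplit.id_tensor_tmap ?_
  rw [← BHom.isSplit_tmap_tmap_iff]
  exact hH.isSplit_T_ιT_T

theorem ιT_tmap_id_injective (hH : H.Tame) :
    Function.Injective (H.ιT.tmap (BHom.id P.S L (BTensor P.R P.T N))) := by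
  refine (RightFaithfullyFlat.injective_iff (S := P.S) hH.flat_right _).2
    (BHom.IsSplit.injective ?_)
  rw [← BHom.isSplit_tmap_tmap_iff]
  exact hH.isSplit_T_ιT_T.tmap_id_tensor

end Purity

end Tame

end BimoduleHerd

/-! ### Injectivity inherited by direct summands -/

namespace BHom

variable {K L R M M' N N' : Type*} [Ring K] [Ring L] [Ring R]
  [AddCommGroup M] [AddCommGroup M'] [AddCommGroup N] [AddCommGroup N']
  [Module K M] [Module Rᵐᵒᵖ M] [SMulCommClass K Rᵐᵒᵖ M]
  [Module K M'] [Module Rᵐᵒᵖ M'] [SMulCommClass K Rᵐᵒᵖ M']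
  [Module R N] [Module Lᵐᵒᵖ N] [SMulCommClass R Lᵐᵒᵖ N]
  [Module R N'] [Module Lᵐᵒᵖ N'] [SMulCommClass R Lᵐᵒᵖ N']

/-- By naturality, `M ⊗ f` followed by `e ⊗ N'` is the injective `e ⊗ N` followed by `M' ⊗ f`. In
the applications `e` is a rebracketing. -/
theorem IsSplit.id_tmap_injective {e : BHom K R M M'} (he : e.IsSplit) {f : BHom R L N N'}
    (hf : Function.Injective ((BHom.id K R M').tmap f)) :
    Function.Injective ((BHom.id K R M).tmap f) := by
  have h : (e.tmap (BHom.id R L N')).comp ((BHom.id K R M).tmap f) =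
      ((BHom.id K R M').tmap f).comp (e.tmap (BHom.id R L N)) := by
    rw [← tmap_comp_left, ← tmap_comp_right]
  have h' := hf.comp (he.tmap_id (N := N) (L := L)).injective
  refine Function.Injective.of_comp (f := e.tmap (BHom.id R L N')) ?_
  exact (congrArg (fun k : BHom K L _ _ => Function.Injective k) h).mpr h'

theorem IsSplit.tmap_id_injective {e : BHom R L N N'} (he : e.IsSplit) {f : BHom K R M M'}
    (hf : Function.Injective (f.tmap (BHom.id R L N'))) :
    Function.Injective (f.tmap (BHom.id R L N)) := by
  have h : ((BHom.id K R M').tmap e).comp (f.tmap (BHom.id R L N)) =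
      (f.tmap (BHom.id R L N')).comp ((BHom.id K R M).tmap e) := by
    rw [← tmap_comp_left, ← tmap_comp_right]
  have h' := hf.comp (he.id_tmap (M := M) (K := K)).injective
  refine Function.Injective.of_comp (f := (BHom.id K R M').tmap e) ?_
  exact (congrArg (fun k : BHom K L _ _ => Function.Injective k) h).mpr h'

end BHom

namespace BimoduleHerd

variable {P : BimodulePair.{u}} {F : FormalDual P} {H : BimoduleHerd F}

/-! ### The coactions on `T̄` -/

theorem γmidLeft_tmul (s : P.T'T) (y' : P.T') : H.γmidLeft (BTensor.tmul P.R s y') =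
    BTensor.assoc P.R P.R P.T'T P.T'T P.T' (BTensor.tmul P.R (H.γr s) y') := by
  simp [γmidLeft]

theorem γmidRight_tmul (s : P.T'T) (y' : P.T') : H.γmidRight (BTensor.tmul P.R s y') =
    BTensor.assoc P.S P.R P.T'TT' P.T P.T' (BTensor.tmul P.R (H.γmidC s) y') := by
  simp [γmidRight, γmidC]

theorem γmidLeft_assoc_symm_tmul (x' : P.T') (t : P.TT') :
    H.γmidLeft ((BTensor.assoc P.S P.R P.T' P.T P.T').symm (BTensor.tmul P.S x' t)) =
      (BTensor.assoc P.S P.R P.T' P.T P.T'TT').symm (BTensor.tmul P.S x' (H.γmidD t)) := by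
  have h : ∀ (u : P.TT'T) (y' : P.T'), BTensor.assoc P.R P.R P.T'T P.T'T P.T' (BTensor.tmul P.R
      ((BTensor.assoc P.S P.R P.T' P.T P.T'T).symm (BTensor.tmul P.S x' u)) y') =
      (BTensor.assoc P.S P.R P.T' P.T P.T'TT').symm (BTensor.tmul P.S x'
        (BTensor.assoc P.R P.R P.T P.T'T P.T' (BTensor.tmul P.R u y'))) := by
    intro u y'
    induction u using BTensor.induction_on with
    | zero => simp
    | simple x s => simp
    | add a b ha hb => simp only [map_add, BTensor.tmul_add, BTensor.add_tmul, ha, hb]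
  induction t using BTensor.induction_on with
  | zero => simp
  | simple y y' => rw [BTensor.assoc_symm_tmul, γmidLeft_tmul, γmidD_tmul, γr_tmul, h]
  | add a b ha hb => simp only [map_add, BTensor.tmul_add, ha, hb]

/-- The rebracketing `T' ⊗ ((T ⊗ T') ⊗ X) → (T' ⊗ T ⊗ T') ⊗ X`. -/
def rebracketX (P : BimodulePair.{u}) {L : Type*} [Ring L] (X : Type*) [AddCommGroup X]
    [Module P.S X] [Module Lᵐᵒᵖ X] [SMulCommClass P.S Lᵐᵒᵖ X] :
    BHom P.R L (BTensor P.S P.T' (BTensor P.S P.TT' X)) (BTensor P.S P.T'TT' X) :=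
  ((BHom.assocSymm P.R P.S P.S P.R P.T' P.T P.T').tmap (BHom.id P.S L X)).comp
    (BHom.assocSymm P.R L P.S P.S P.T' P.TT' X)

section Rebracket

variable {L X Y : Type*} [Ring L]
  [AddCommGroup X] [Module P.S X] [Module Lᵐᵒᵖ X] [SMulCommClass P.S Lᵐᵒᵖ X]
  [AddCommGroup Y] [Module P.S Y] [Module Lᵐᵒᵖ Y] [SMulCommClass P.S Lᵐᵒᵖ Y]

@[simp] theorem rebracketX_tmul (x' : P.T') (t : P.TT') (x : X) :
    rebracketX P (L := L) X (BTensor.tmul P.S x' (BTensor.tmul P.S t x)) =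
      BTensor.tmul P.S ((BTensor.assoc P.S P.R P.T' P.T P.T').symm (BTensor.tmul P.S x' t)) x := by
  simp [rebracketX]

theorem id_tmap_rebracketX (f : BHom P.S L X Y) (x' : P.T') (q : BTensor P.S P.TT' X) :
    (BHom.id P.R P.S P.T'TT').tmap f (rebracketX P (L := L) X (BTensor.tmul P.S x' q)) =
      rebracketX P (L := L) Y (BTensor.tmul P.S x' ((BHom.id P.S P.S P.TT').tmap f q)) := by
  induction q using BTensor.induction_on with
  | zero => simp
  | simple t x => simp
  | add a b ha hb => simp only [map_add, BTensor.tmul_add, ha, hb]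

end Rebracket

theorem γmidRight_assoc_symm_tmul (x' : P.T') (t : P.TT') :
    H.γmidRight ((BTensor.assoc P.S P.R P.T' P.T P.T').symm (BTensor.tmul P.S x' t)) =
      rebracketX P (L := P.S) P.TT' (BTensor.tmul P.S x' (H.γl t)) := by
  have h : ∀ (u : P.TT'T) (y' : P.T'), BTensor.assoc P.S P.R P.T'TT' P.T P.T' (BTensor.tmul P.R
      ((BTensor.assoc P.R P.S P.T'T P.T' P.T).symm
        ((BTensor.assoc P.S P.R P.T' P.T P.T'T).symm (BTensor.tmul P.S x' u))) y') =
      rebracketX P (L := P.S) P.TT' (BTensor.tmul P.S x'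
        (BTensor.assoc P.S P.R P.TT' P.T P.T' (BTensor.tmul P.R
          ((BTensor.assoc P.R P.S P.T P.T' P.T).symm u) y'))) := by
    intro u y'
    induction u using BTensor.induction_on_right with
    | zero => simp
    | simple x s => simp
    | add a b ha hb => simp only [map_add, BTensor.tmul_add, BTensor.add_tmul, ha, hb]
  induction t using BTensor.induction_on with
  | zero => simp
  | simple y y' =>
    rw [BTensor.assoc_symm_tmul, γmidRight_tmul, γmidC_apply, γr_tmul, h, γl_tmul, γL_apply]
  | add a b ha hb => simp only [map_add, BTensor.tmul_add, ha, hb]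

theorem γmidLeft_coassoc (t : P.T'TT') : BTensor.assoc P.R P.R P.T'T P.T'T P.T'TT'
    (H.γr.tmap (BHom.id P.R P.S P.T'TT') (H.γmidLeft t)) =
      (BHom.id P.R P.R P.T'T).tmap H.γmidLeft (H.γmidLeft t) := by
  have h₁ : ∀ (q : BTensor P.R P.T'T P.T'T) (y' : P.T'),
      BTensor.assoc P.R P.R P.T'T P.T'T P.T'TT' (H.γr.tmap (BHom.id P.R P.S P.T'TT')
        (BTensor.assoc P.R P.R P.T'T P.T'T P.T' (BTensor.tmul P.R q y'))) =
      (BHom.id P.R P.R P.T'T).tmap (BHom.assoc P.R P.S P.R P.R P.T'T P.T'T P.T')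
        (BTensor.assoc P.R P.R P.T'T (BTensor P.R P.T'T P.T'T) P.T' (BTensor.tmul P.R
          (BTensor.assoc P.R P.R P.T'T P.T'T P.T'T (H.γr.tmap (BHom.id P.R P.R P.T'T) q)) y')) := by
    intro q y'
    induction q using BTensor.induction_on with
    | zero => simp
    | simple s s' =>
      rw [BTensor.assoc_tmul, BHom.tmap_tmul, BHom.tmap_tmul]
      generalize H.γr s = p
      induction p using BTensor.induction_on with
      | zero => simp
      | simple a b => simp
      | add a b ha hb => simp only [map_add, BTensor.add_tmul, ha, hb]
    | add a b ha hb => simp only [map_add, BTensor.add_tmul, ha, hb]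
  have h₂ : ∀ (q : BTensor P.R P.T'T P.T'T) (y' : P.T'),
      (BHom.id P.R P.R P.T'T).tmap H.γmidLeft
        (BTensor.assoc P.R P.R P.T'T P.T'T P.T' (BTensor.tmul P.R q y')) =
      (BHom.id P.R P.R P.T'T).tmap (BHom.assoc P.R P.S P.R P.R P.T'T P.T'T P.T')
        (BTensor.assoc P.R P.R P.T'T (BTensor P.R P.T'T P.T'T) P.T' (BTensor.tmul P.R
          ((BHom.id P.R P.R P.T'T).tmap H.γr q) y')) := by
    intro q y'
    induction q using BTensor.induction_on with
    | zero => simp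
    | simple s s' => simp [γmidLeft_tmul]
    | add a b ha hb => simp only [map_add, BTensor.add_tmul, ha, hb]
  induction t using BTensor.induction_on with
  | zero => simp
  | simple s y' => rw [γmidLeft_tmul, h₁, h₂, γr_coassoc]
  | add a b ha hb => simp only [map_add, ha, hb]

theorem γmidRight_coassoc (t : P.T'TT') : BTensor.assoc P.S P.S P.T'TT' P.TT' P.TT'
    (H.γmidRight.tmap (BHom.id P.S P.S P.TT') (H.γmidRight t)) =
      (BHom.id P.R P.S P.T'TT').tmap H.γl (H.γmidRight t) := by
  have h₁ : ∀ (x' : P.T') (q : BTensor P.S P.TT' P.TT'),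
      BTensor.assoc P.S P.S P.T'TT' P.TT' P.TT' (H.γmidRight.tmap (BHom.id P.S P.S P.TT')
        (rebracketX P (L := P.S) P.TT' (BTensor.tmul P.S x' q))) =
      rebracketX P (L := P.S) (BTensor P.S P.TT' P.TT') (BTensor.tmul P.S x'
        (BTensor.assoc P.S P.S P.TT' P.TT' P.TT' (H.γl.tmap (BHom.id P.S P.S P.TT') q))) := by
    intro x' q
    induction q using BTensor.induction_on with
    | zero => simp
    | simple s s' =>
      rw [rebracketX_tmul, BHom.tmap_tmul, BHom.tmap_tmul, γmidRight_assoc_symm_tmul]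
      generalize H.γl s = p
      induction p using BTensor.induction_on with
      | zero => simp
      | simple a b => simp
      | add a b ha hb => simp only [map_add, BTensor.tmul_add, BTensor.add_tmul, ha, hb]
    | add a b ha hb => simp only [map_add, BTensor.tmul_add, ha, hb]
  obtain ⟨t, rfl⟩ := (BTensor.assoc P.S P.R P.T' P.T P.T').symm.surjective t
  induction t using BTensor.induction_on with
  | zero => simp
  | simple x' t =>
    rw [γmidRight_assoc_symm_tmul, h₁, id_tmap_rebracketX, γl_coassoc]
  | add a b ha hb => simp only [map_add, ha, hb]

/-- Up to bracketing, both sides are the two iterates of `γr` with `y'` appended, hence equal by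
`γr_coassoc`. The auxiliaries `E` and `E'` append `y'` and rebracket. -/
theorem γmidLeft_γmidRight (t : P.T'TT') : BTensor.assoc P.R P.S P.T'T P.T'TT' P.TT'
    (H.γmidLeft.tmap (BHom.id P.S P.S P.TT') (H.γmidRight t)) =
      (BHom.id P.R P.R P.T'T).tmap H.γmidRight (H.γmidLeft t) := by
  let E (y' : P.T') (q : BTensor P.R P.T'T P.T'T) : BTensor P.S P.T'TT' P.TT' :=
    BTensor.assoc P.S P.R P.T'TT' P.T P.T' (BTensor.tmul P.R
      ((BTensor.assoc P.R P.S P.T'T P.T' P.T).symm q) y')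
  let E' (y' : P.T') (p : BTensor P.R P.T'T (BTensor P.R P.T'T P.T'T)) :
      BTensor P.R P.T'T (BTensor P.S P.T'TT' P.TT') :=
    (BHom.id P.R P.R P.T'T).tmap ((BHom.assoc P.R P.S P.S P.R P.T'TT' P.T P.T').comp
      ((BHom.assocSymm P.R P.R P.R P.S P.T'T P.T' P.T).tmap (BHom.id P.R P.S P.T')))
      (BTensor.assoc P.R P.R P.T'T (BTensor P.R P.T'T P.T'T) P.T' (BTensor.tmul P.R p y'))
  have hE : ∀ y' p q, E y' (p + q) = E y' p + E y' q := fun y' p q => by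
    simp only [E, map_add, BTensor.add_tmul]
  have hE₀ : ∀ y', E y' 0 = 0 := fun y' => by simp [E]
  have hE' : ∀ y' p q, E' y' (p + q) = E' y' p + E' y' q := fun y' p q => by
    simp only [E', map_add, BTensor.add_tmul]
  have hE'₀ : ∀ y', E' y' 0 = 0 := fun y' => by simp [E']
  have hE't : ∀ y' s q, E' y' (BTensor.tmul P.R s q) = BTensor.tmul P.R s (E y' q) := by
    intro y' s q
    simp [E', E]
  have h₁ : ∀ (q : BTensor P.R P.T'T P.T'T) (y' : P.T'),
      BTensor.assoc P.R P.S P.T'T P.T'TT' P.TT'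
        (H.γmidLeft.tmap (BHom.id P.S P.S P.TT') (E y' q)) =
      E' y' (BTensor.assoc P.R P.R P.T'T P.T'T P.T'T (H.γr.tmap (BHom.id P.R P.R P.T'T) q)) := by
    intro q y'
    induction q using BTensor.induction_on_right with
    | zero => simp [hE₀, hE'₀]
    | simple s z' y =>
      have e : E y' (BTensor.tmul P.R s (BTensor.tmul P.S z' y)) =
          BTensor.tmul P.S (BTensor.tmul P.R s z') (BTensor.tmul P.R y y') := by simp [E]
      rw [e, BHom.tmap_tmul, BHom.tmap_tmul, γmidLeft_tmul]
      generalize H.γr s = p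
      induction p using BTensor.induction_on with
      | zero => simp [hE'₀]
      | simple a b => simp [hE't, E]
      | add a b ha hb => simp only [map_add, BTensor.add_tmul, ha, hb, hE']
    | add a b ha hb => simp only [map_add, ha, hb, hE, hE']
  have h₂ : ∀ (q : BTensor P.R P.T'T P.T'T) (y' : P.T'),
      (BHom.id P.R P.R P.T'T).tmap H.γmidRight
        (BTensor.assoc P.R P.R P.T'T P.T'T P.T' (BTensor.tmul P.R q y')) =
      E' y' ((BHom.id P.R P.R P.T'T).tmap H.γr q) := by
    intro q y'
    induction q using BTensor.induction_on with
    | zero => simp [hE'₀]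
    | simple s s' =>
      rw [BTensor.assoc_tmul, BHom.tmap_tmul, BHom.tmap_tmul, hE't, γmidRight_tmul]
      rfl
    | add a b ha hb => simp only [map_add, BTensor.add_tmul, ha, hb, hE']
  induction t using BTensor.induction_on with
  | zero => simp
  | simple s y' =>
    rw [γmidLeft_tmul, h₂, γmidRight_tmul, ← γr_coassoc, ← h₁]
    rfl
  | add a b ha hb => simp only [map_add, ha, hb]

theorem evR_tmap_id_γmidLeft (t : P.T'TT') : F.evR.tmap (BHom.id P.R P.S P.T'TT')
    (H.γmidLeft t) = BTensor.assoc P.R P.R P.A P.T'T P.T'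
      (H.ξC.tmap (BHom.id P.R P.S P.T') t) := by
  have e : BHom.id P.R P.S P.T'TT' = (BHom.id P.R P.R P.T'T).tmap (BHom.id P.R P.S P.T') :=
    BHom.ext fun t => (BHom.tmap_id t).symm
  induction t using BTensor.induction_on with
  | zero => simp
  | simple s y' =>
    rw [γmidLeft_tmul, e, ← BHom.assoc_tmap, BHom.tmap_tmul, BHom.tmap_tmul, ξC_apply]
  | add a b ha hb => simp only [map_add, ha, hb]

theorem id_tmap_ev'S_γmidRight (x' : P.T') (t : P.TT') : (BHom.id P.R P.S P.T'TT').tmap F.ev'S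
    (H.γmidRight ((BTensor.assoc P.S P.R P.T' P.T P.T').symm (BTensor.tmul P.S x' t))) =
      rebracketX P (L := P.S) P.B (BTensor.tmul P.S x' (H.ξD t)) := by
  rw [γmidRight_assoc_symm_tmul, id_tmap_rebracketX, ξD_apply]

namespace Tame

/-- The map `T̄ → (T' ⊗_S T) ⊗_R T̄` induced by `T' ⊗_S γ ⊗_R T'`. -/
def liftLeft (hH : H.Tame) : BHom P.R P.S H.Tbar (BTensor P.R P.T'T H.Tbar) :=
  (BHom.assocSymm P.R P.S P.S P.R P.T' P.T H.Tbar).comp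
    (((BHom.id P.R P.S P.T').tmap hH.galD).comp hH.toT'D)

/-- The map `T̄ → T̄ ⊗_S (T ⊗_R T')` induced by `T' ⊗_S γ ⊗_R T'`. -/
def liftRight (hH : H.Tame) : BHom P.R P.S H.Tbar (BTensor P.S H.Tbar P.TT') :=
  (BHom.assoc P.R P.S P.S P.R H.Tbar P.T P.T').comp
    ((hH.galC.tmap (BHom.id P.R P.S P.T')).comp hH.toCT')

/-- Here `z` is viewed in `T' ⊗_S D`, on which `T' ⊗ galD` is the middle application of `γ`. -/
theorem id_tmap_ιT_liftLeft (hH : H.Tame) (z : H.Tbar) :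
    (BHom.id P.R P.R P.T'T).tmap H.ιT (hH.liftLeft z) = H.γmidLeft (H.ιT z) := by
  have e : BHom.id P.R P.R P.T'T = (BHom.id P.R P.S P.T').tmap (BHom.id P.S P.R P.T) :=
    BHom.ext fun t => (BHom.tmap_id t).symm
  have h : ∀ v : BTensor P.S P.T' H.D, (BHom.id P.R P.R P.T'T).tmap H.ιT
      ((BTensor.assoc P.S P.R P.T' P.T H.Tbar).symm ((BHom.id P.R P.S P.T').tmap hH.galD v)) =
      H.γmidLeft (H.fromT'D v) := by
    intro v
    induction v using BTensor.induction_on with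
    | zero => simp
    | simple x' d =>
      rw [e, ← BHom.assoc_symm_tmap, BHom.tmap_tmul, BHom.tmap_tmul, id_tmap_ιT_galD, fromT'D_tmul,
        γmidLeft_assoc_symm_tmul, BHom.id_apply, BHom.id_apply]
    | add a b ha hb => simp only [map_add, ha, hb]
  rw [← hH.fromT'D_toT'D, ← h]
  rfl

theorem ιT_tmap_id_liftRight (hH : H.Tame) (z : H.Tbar) :
    H.ιT.tmap (BHom.id P.S P.S P.TT') (hH.liftRight z) = H.γmidRight (H.ιT z) := by
  have e : BHom.id P.S P.S P.TT' = (BHom.id P.S P.R P.T).tmap (BHom.id P.R P.S P.T') :=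
    BHom.ext fun t => (BHom.tmap_id t).symm
  have h : ∀ w : BTensor P.R H.C P.T', H.ιT.tmap (BHom.id P.S P.S P.TT')
      (BTensor.assoc P.S P.R H.Tbar P.T P.T' (hH.galC.tmap (BHom.id P.R P.S P.T') w)) =
      H.γmidRight (H.fromCT' w) := by
    intro w
    induction w using BTensor.induction_on with
    | zero => simp
    | simple c x' =>
      rw [e, ← BHom.assoc_tmap, BHom.tmap_tmul, BHom.tmap_tmul, ιT_tmap_id_galC, fromCT',
        BHom.tmap_tmul, γmidRight_tmul, BHom.id_apply, BHom.id_apply]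
    | add a b ha hb => simp only [map_add, ha, hb]
  rw [← hH.fromCT'_toCT', ← h]
  rfl

/-- Both descriptions of `T̄` are used: `T' ⊗ D` places the last legs in `T̄` through `liftLeft`,
and `C ⊗ T'` gives the equation of `C` for the first legs, by `ξC_tmap_id_γr_ιC`. The equation is
checked after including `T̄` in `T' ⊗ T ⊗ T'`. -/
theorem exists_coactionC (hH : H.Tame) (z : H.Tbar) :
    ∃ w, H.ιC.tmap (BHom.id P.R P.S H.Tbar) w = hH.liftLeft z := by
  refine hH.ιC_tmap_id_equaliser.2 _ ?_
  -- Writing `A ⊗ (T' ⊗ T)` as `(A ⊗ T') ⊗ T` exhibits the factor `T` next to `T̄` on which the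
  -- purity statement depends.
  have hs : (BHom.assocSymm P.R P.R P.R P.S P.A P.T' P.T).IsSplit :=
    ⟨BHom.assoc P.R P.R P.R P.S P.A P.T' P.T, fun t => by simp⟩
  apply hs.id_tmap_injective hH.id_tmap_ιT_injective
  rw [← BHom.tmap_eq_right, ← BHom.tmap_eq_right, BHom.tmap_eq_left, BHom.tmap_eq_left H.ξC,
    id_tmap_ιT_liftLeft, ← hH.fromCT'_toCT']
  generalize hH.toCT' z = w
  have e : BHom.id P.R P.S P.T'TT' = (BHom.id P.R P.R P.T'T).tmap (BHom.id P.R P.S P.T') :=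
    BHom.ext fun t => (BHom.tmap_id t).symm
  induction w using BTensor.induction_on with
  | zero => simp
  | simple c x' =>
    rw [fromCT', BHom.tmap_tmul, γmidLeft_tmul, e, ← BHom.assoc_tmap, ← BHom.assoc_tmap,
      BHom.tmap_tmul, BHom.tmap_tmul, ξC_tmap_id_γr_ιC]
  | add a b ha hb => simp only [map_add, ha, hb]

/-- The two descriptions of `T̄` change roles: `C ⊗ T'` provides the lift and `T' ⊗ D` the equation.
-/
theorem exists_coactionD (hH : H.Tame) (z : H.Tbar) :
    ∃ v, (BHom.id P.R P.S H.Tbar).tmap H.ιD v = hH.liftRight z := by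
  refine hH.id_tmap_ιD_equaliser.2 _ ?_
  have hs : (BHom.assoc P.S P.S P.R P.S P.T P.T' P.B).IsSplit :=
    ⟨BHom.assocSymm P.S P.S P.R P.S P.T P.T' P.B, fun t => by simp⟩
  apply hs.tmap_id_injective hH.ιT_tmap_id_injective
  rw [← BHom.tmap_eq_left, ← BHom.tmap_eq_left, BHom.tmap_eq_right, BHom.tmap_eq_right _ H.ξD,
    ιT_tmap_id_liftRight, ← hH.fromT'D_toT'D]
  generalize hH.toT'D z = v
  induction v using BTensor.induction_on with
  | zero => simp
  | simple x' d =>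
    rw [fromT'D_tmul, γmidRight_assoc_symm_tmul, id_tmap_rebracketX, id_tmap_rebracketX,
      id_tmap_ξD_γl_ιD]
  | add a b ha hb => simp only [map_add, ha, hb]

/-- The left coaction `T̄ → C ⊗_R T̄`. -/
def coactionC (hH : H.Tame) : BHom P.R P.S H.Tbar (BTensor P.R H.C H.Tbar) :=
  BHom.factor (H.ιC.tmap (BHom.id P.R P.S H.Tbar)) hH.ιC_tmap_id_equaliser.1 hH.liftLeft
    hH.exists_coactionC

/-- The right coaction `T̄ → T̄ ⊗_S D`. -/
def coactionD (hH : H.Tame) : BHom P.R P.S H.Tbar (BTensor P.S H.Tbar H.D) :=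
  BHom.factor ((BHom.id P.R P.S H.Tbar).tmap H.ιD) hH.id_tmap_ιD_equaliser.1 hH.liftRight
    hH.exists_coactionD

theorem ιC_tmap_ιT_coactionC (hH : H.Tame) (z : H.Tbar) :
    H.ιC.tmap H.ιT (hH.coactionC z) = H.γmidLeft (H.ιT z) := by
  rw [BHom.tmap_eq_right, ← hH.id_tmap_ιT_liftLeft]
  exact congrArg _ (BHom.apply_factor _ _ _ _ z)

theorem ιT_tmap_ιD_coactionD (hH : H.Tame) (z : H.Tbar) :
    H.ιT.tmap H.ιD (hH.coactionD z) = H.γmidRight (H.ιT z) := by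
  rw [BHom.tmap_eq_left, ← hH.ιT_tmap_id_liftRight]
  exact congrArg _ (BHom.apply_factor _ _ _ _ z)

end Tame

end BimoduleHerd

namespace BimoduleHerd

variable {P : BimodulePair.{u}} {F : FormalDual P} {H : BimoduleHerd F}

namespace Tame

/-! ### The bicomodule `T̄` -/

/-- The factors `C` are replaced one by one by `T' ⊗ T`. What remains is `(T'T ⊗ T'T) ⊗ ιT`, where
`T̄` has a neighbouring `T`. -/
theorem ιC_tmap_ιC_tmap_ιT_injective (hH : H.Tame) :
    Function.Injective (H.ιC.tmap (H.ιC.tmap H.ιT)) := by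
  refine hH.ιC_tmap_injective ?_
  have e : (BHom.id P.R P.R P.T'T).tmap (H.ιC.tmap H.ιT) =
      ((BHom.id P.R P.R P.T'T).tmap ((BHom.id P.R P.R P.T'T).tmap H.ιT)).comp
        ((BHom.id P.R P.R P.T'T).tmap (H.ιC.tmap (BHom.id P.R P.S H.Tbar))) := by
    refine BHom.ext fun t => ?_
    rw [BHom.comp_apply, ← BHom.id_tmap_comp, ← BHom.tmap_comp_right]
  rw [e]
  suffices h : Function.Injective ((BHom.id P.R P.R P.T'T).tmap
      ((BHom.id P.R P.R P.T'T).tmap H.ιT)) from h.comp hH.isSplit_T'T_ιC.id_tmap_tmap.injective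
  rw [← BHom.tmap_tmap_injective_iff]
  have e' : (BHom.id P.R P.R P.T'T).tmap (BHom.id P.R P.R P.T'T) =
      BHom.id P.R P.R (BTensor P.R P.T'T P.T'T) := BHom.ext fun t => BHom.tmap_id t
  rw [e']
  have hs : (BHom.assocSymm P.R P.R P.R P.S P.T'T P.T' P.T).IsSplit :=
    ⟨BHom.assoc P.R P.R P.R P.S P.T'T P.T' P.T, fun t => by simp⟩
  exact hs.id_tmap_injective hH.id_tmap_ιT_injective

theorem ιT_tmap_ιD_tmap_ιD_injective (hH : H.Tame) :
    Function.Injective ((H.ιT.tmap H.ιD).tmap H.ιD) := by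
  refine hH.tmap_ιD_injective ?_
  have e : (H.ιT.tmap H.ιD).tmap (BHom.id P.S P.S P.TT') =
      ((H.ιT.tmap (BHom.id P.S P.S P.TT')).tmap (BHom.id P.S P.S P.TT')).comp
        (((BHom.id P.R P.S H.Tbar).tmap H.ιD).tmap (BHom.id P.S P.S P.TT')) := by
    refine BHom.ext fun t => ?_
    rw [BHom.comp_apply, ← BHom.tmap_id_comp, ← BHom.tmap_comp_left]
  rw [e]
  suffices h : Function.Injective ((H.ιT.tmap (BHom.id P.S P.S P.TT')).tmap
      (BHom.id P.S P.S P.TT')) from h.comp hH.isSplit_ιD_TT'.tmap_tmap_id.injective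
  rw [BHom.tmap_tmap_injective_iff]
  have e' : (BHom.id P.S P.S P.TT').tmap (BHom.id P.S P.S P.TT') =
      BHom.id P.S P.S (BTensor P.S P.TT' P.TT') := BHom.ext fun t => BHom.tmap_id t
  rw [e']
  have hs : (BHom.assoc P.S P.S P.R P.S P.T P.T' P.TT').IsSplit :=
    ⟨BHom.assocSymm P.S P.S P.R P.S P.T P.T' P.TT', fun t => by simp⟩
  exact hs.tmap_id_injective hH.ιT_tmap_id_injective

/-- Once `C` and `D` are replaced by `T' ⊗ T` and `T ⊗ T'`, there is a factor `T` on each side of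
`T̄`, and the map is split by `isSplit_id_ιT_id`. -/
theorem ιC_tmap_ιT_tmap_ιD_injective (hH : H.Tame) :
    Function.Injective (H.ιC.tmap (H.ιT.tmap H.ιD)) := by
  refine hH.ιC_tmap_injective ?_
  rw [← BHom.tmap_tmap_injective_iff]
  exact hH.tmap_ιD_injective hH.isSplit_id_ιT_id.injective

/-- In the ambient tensor products, coassociativity is `γmidLeft_coassoc`. The counit axiom is the
equation `(ξC ⊗ T') z = (ζC ⊗ T') z`, which holds because `z` lies in `C ⊗ T'`. -/
theorem isLeftComodule_Tbar (hH : H.Tame) : IsLeftComodule hH.coringC hH.coactionC.l where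
  coassoc z := by
    apply (BTensor.assoc P.R P.R H.C H.C H.Tbar).injective
    rw [AddEquiv.apply_symm_apply]
    apply hH.ιC_tmap_ιC_tmap_ιT_injective
    change H.ιC.tmap (H.ιC.tmap H.ιT) ((BHom.id P.R P.R H.C).tmap hH.coactionC (hH.coactionC z)) =
      H.ιC.tmap (H.ιC.tmap H.ιT) (BTensor.assoc P.R P.R H.C H.C H.Tbar
        (hH.comulC.tmap (BHom.id P.R P.S H.Tbar) (hH.coactionC z)))
    rw [← BHom.assoc_tmap,
      BHom.tmap_tmap_congr (f := H.ιC) (g := H.ιC.tmap H.ιT) (f' := BHom.id P.R P.R H.C)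
        (g' := hH.coactionC) (h := BHom.id P.R P.R P.T'T) (k := H.γmidLeft) (h' := H.ιC)
        (k' := H.ιT) (fun _ => rfl) hH.ιC_tmap_ιT_coactionC,
      BHom.tmap_tmap_congr (f := H.ιC.tmap H.ιC) (g := H.ιT) (f' := hH.comulC)
        (g' := BHom.id P.R P.S H.Tbar) (h := H.γr) (k := BHom.id P.R P.S P.T'TT') (h' := H.ιC)
        (k' := H.ιT) hH.ιC_tmap_ιC_comulC (fun _ => rfl),
      ιC_tmap_ιT_coactionC, γmidLeft_coassoc]
  counit z := by
    apply unitMap_tmap_injective (A := P.A) (ιT_injective (H := H))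
    change (unitMap P.R P.A).tmap H.ιT (hH.counitC.tmap (BHom.id P.R P.S H.Tbar)
      (hH.coactionC z)) = _
    rw [BHom.tmap_tmap_congr (f := unitMap P.R P.A) (g := H.ιT) (f' := hH.counitC)
        (g' := BHom.id P.R P.S H.Tbar) (h := F.evR) (k := BHom.id P.R P.S P.T'TT') (h' := H.ιC)
        (k' := H.ιT) hH.unitMap_counitC (fun _ => rfl),
      ιC_tmap_ιT_coactionC, evR_tmap_id_γmidLeft, ← hH.fromCT'_toCT', ξC_tmap_id_fromCT',
      fromCT'_toCT', BHom.tmap_tmul, unitMap_one]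
    generalize H.ιT z = t
    induction t using BTensor.induction_on with
    | zero => simp
    | simple s x' => simp
    | add a b ha hb => simp only [map_add, BTensor.tmul_add, ha, hb]

theorem isRightComodule_Tbar (hH : H.Tame) : IsRightComodule hH.coringD hH.coactionD.r where
  coassoc z := by
    apply (BHom.tmap_tmap_injective_iff _ _ _).1 hH.ιT_tmap_ιD_tmap_ιD_injective
    change H.ιT.tmap (H.ιD.tmap H.ιD) (BTensor.assoc P.S P.S H.Tbar H.D H.D
      (hH.coactionD.tmap (BHom.id P.S P.S H.D) (hH.coactionD z))) =
      H.ιT.tmap (H.ιD.tmap H.ιD) ((BHom.id P.R P.S H.Tbar).tmap hH.comulD (hH.coactionD z))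
    rw [← BHom.assoc_tmap,
      BHom.tmap_tmap_congr (f := H.ιT.tmap H.ιD) (g := H.ιD) (f' := hH.coactionD)
        (g' := BHom.id P.S P.S H.D) (h := H.γmidRight) (k := BHom.id P.S P.S P.TT') (h' := H.ιT)
        (k' := H.ιD) hH.ιT_tmap_ιD_coactionD (fun _ => rfl),
      BHom.tmap_tmap_congr (f := H.ιT) (g := H.ιD.tmap H.ιD) (f' := BHom.id P.R P.S H.Tbar)
        (g' := hH.comulD) (h := BHom.id P.R P.S P.T'TT') (k := H.γl) (h' := H.ιT)
        (k' := H.ιD) (fun _ => rfl) hH.ιD_tmap_ιD_comulD,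
      ιT_tmap_ιD_coactionD, γmidRight_coassoc]
  counit z := by
    apply tmap_unitMap_injective (A := P.B) (ιT_injective (H := H))
    change H.ιT.tmap (unitMap P.S P.B) ((BHom.id P.R P.S H.Tbar).tmap hH.counitD
      (hH.coactionD z)) = _
    rw [BHom.tmap_tmap_congr (f := H.ιT) (g := unitMap P.S P.B) (f' := BHom.id P.R P.S H.Tbar)
        (g' := hH.counitD) (h := BHom.id P.R P.S P.T'TT') (k := F.ev'S) (h' := H.ιT)
        (k' := H.ιD) (fun _ => rfl) hH.unitMap_counitD,
      ιT_tmap_ιD_coactionD, BHom.tmap_tmul, unitMap_one, ← hH.fromT'D_toT'D]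
    generalize hH.toT'D z = v
    induction v using BTensor.induction_on with
    | zero => simp
    | simple x' d => rw [fromT'D_tmul, id_tmap_ev'S_γmidRight, ξD_ιD]; simp
    | add a b ha hb => simp only [map_add, BTensor.add_tmul, ha, hb]

theorem isBicomodule_Tbar (hH : H.Tame) :
    IsBicomodule hH.coringC hH.coringD hH.coactionC hH.coactionD where
  left := hH.isLeftComodule_Tbar
  right := hH.isRightComodule_Tbar
  comm z := by
    apply hH.ιC_tmap_ιT_tmap_ιD_injective
    change H.ιC.tmap (H.ιT.tmap H.ιD) (BTensor.assoc P.R P.S H.C H.Tbar H.D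
      (hH.coactionC.tmap (BHom.id P.S P.S H.D) (hH.coactionD z))) =
      H.ιC.tmap (H.ιT.tmap H.ιD) ((BHom.id P.R P.R H.C).tmap hH.coactionD (hH.coactionC z))
    rw [← BHom.assoc_tmap,
      BHom.tmap_tmap_congr (f := H.ιC.tmap H.ιT) (g := H.ιD) (f' := hH.coactionC)
        (g' := BHom.id P.S P.S H.D) (h := H.γmidLeft) (k := BHom.id P.S P.S P.TT') (h' := H.ιT)
        (k' := H.ιD) hH.ιC_tmap_ιT_coactionC (fun _ => rfl),
      BHom.tmap_tmap_congr (f := H.ιC) (g := H.ιT.tmap H.ιD) (f' := BHom.id P.R P.R H.C)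
        (g' := hH.coactionD) (h := BHom.id P.R P.R P.T'T) (k := H.γmidRight) (h' := H.ιC)
        (k' := H.ιT) (fun _ => rfl) hH.ιT_tmap_ιD_coactionD,
      ιC_tmap_ιT_coactionC, ιT_tmap_ιD_coactionD, γmidLeft_γmidRight]

end Tame

end BimoduleHerd

end BimoduleHerds
end

theorem mainTheorem5 (P : BimodulePair.{u}) (F : FormalDual P) (H : BimoduleHerd F)
    (hH : H.Tame) :
    -- `C ⊗_R T'` and `T' ⊗_S D` are sub-bimodules of `T' ⊗_S T ⊗_R T'`
    Function.Injective H.fromCT' ∧ Function.Injective H.fromT'D ∧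
    ∃ (cC : Coring P.R H.C) (cD : Coring P.S H.D)
      (ψ : BHom P.R P.R (BTensor P.R H.C P.A) (BTensor P.R P.A H.C))
      (φ : BHom P.S P.S (BTensor P.S P.B H.D) (BTensor P.S H.D P.B))
      (ρTC : BHom P.S P.R P.T (BTensor P.R P.T H.C))
      (ρTD : BHom P.S P.R P.T (BTensor P.S H.D P.T)),
    -- the coring `C`: `Δ_C = T' ⊗_S γ` and `ε_C = ev` on `C`
    (∀ c, H.ιC.tmap H.ιC (cC.comul c) = H.γr (H.ιC c)) ∧
    (∀ c, P.α (cC.counit c) = F.ev (H.ιC c)) ∧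
    -- the coring `D`: `Δ_D = γ ⊗_R T'` and `ε_D = ev'` on `D`
    (∀ d, H.ιD.tmap H.ιD (cD.comul d) = H.γl (H.ιD d)) ∧
    (∀ d, P.β (cD.counit d) = F.ev' (H.ιD d)) ∧
    -- `C` is entwined with `A` by `ψ(c ⊗ a) = ((ev ⊗ T' ⊗ T) ∘ (T' ⊗ γ))(c a)`
    IsRightEntwining cC ψ ∧
    (∀ c a, (BHom.id P.R P.R P.A).tmap H.ιC (ψ (BTensor.tmul P.R c a)) =
      H.ξC (MulOpposite.op a • H.ιC c)) ∧
    -- `B` is entwined with `D` by `φ(b ⊗ d) = ((T ⊗ T' ⊗ ev') ∘ (γ ⊗ T'))(b d)`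
    IsLeftEntwining cD φ ∧
    (∀ b d, H.ιD.tmap (BHom.id P.S P.S P.B) (φ (BTensor.tmul P.S b d)) =
      H.ξD (b • H.ιD d)) ∧
    -- `T` is a right and a left entwined module, with both coactions given by `γ`
    IsRightEntwinedModule cC ψ ρTC.r ∧
    (∀ x, (BHom.id P.S P.R P.T).tmap H.ιC (ρTC x) = H.γ x) ∧
    IsLeftEntwinedModule cD φ ρTD.l ∧
    (∀ x, H.ιD.tmap (BHom.id P.S P.R P.T) (ρTD x) =
      (BTensor.assoc P.R P.S P.T P.T' P.T).symm (H.γ x)) ∧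
    -- `C ⊗_R A` is a right and `B ⊗_S D` is a left entwined module
    IsRightEntwinedModule cC ψ (rightEntwinedCoaction cC ψ).r ∧
    IsLeftEntwinedModule cD φ (leftEntwinedCoaction cD φ).l ∧
    -- (1) `h₁ : T̄ → Hom^𝒞(T, C ⊗_R A)` is an isomorphism of `R`-`S` bimodules
    (∃ h₁ : H.Tbar →+ (P.T →ₗ[P.Aᵐᵒᵖ] BTensor P.R H.C P.A),
      (∀ z y, H.ιC.tmap (BHom.id P.R P.R P.A) (h₁ z y) = F.contractRight (H.ιT z) y) ∧
      Function.Injective h₁ ∧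
      Set.range h₁ = rightComoduleHom ρTC.r (rightEntwinedCoaction cC ψ).r ∧
      (∀ (r : P.R) z y, h₁ (r • z) y = r • h₁ z y) ∧
      (∀ (s : P.S) z y, h₁ (MulOpposite.op s • z) y = h₁ z (s • y))) ∧
    -- (2) `h₂ : T̄ → ^𝒟Hom(T, B ⊗_S D)` is an isomorphism of `R`-`S` bimodules
    (∃ h₂ : H.Tbar →+ (P.T →ₗ[P.B] BTensor P.S P.B H.D),
      (∀ z y, (BHom.id P.S P.S P.B).tmap H.ιD (h₂ z y) = F.contractLeft y (H.ιT z)) ∧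
      Function.Injective h₂ ∧
      Set.range h₂ = leftComoduleHom ρTD.l (leftEntwinedCoaction cD φ).l ∧
      (∀ (r : P.R) z y, h₂ (r • z) y = h₂ z (MulOpposite.op r • y)) ∧
      (∀ (s : P.S) z y, h₂ (MulOpposite.op s • z) y = MulOpposite.op s • h₂ z y)) ∧
    -- (3) `ev ⊗_A T'` and `T' ⊗_B ev'` restrict to one and the same bimodule map `h : T̄ → T'`
    (∃ h : BHom P.R P.S H.Tbar P.T',
      (∀ z, h z = F.evLeft (H.ιT z)) ∧ (∀ z, h z = F.evRight (H.ιT z))) ∧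
    -- (4) `T̄` is a `C`-`D` bicomodule, with both coactions given by `T' ⊗_S γ ⊗_R T'`
    (∃ (ρC : BHom P.R P.S H.Tbar (BTensor P.R H.C H.Tbar))
      (ρD : BHom P.R P.S H.Tbar (BTensor P.S H.Tbar H.D)),
      IsBicomodule cC cD ρC ρD ∧
      (∀ z, H.ιC.tmap H.ιT (ρC z) = H.γmidLeft (H.ιT z)) ∧
      (∀ z, H.ιT.tmap H.ιD (ρD z) = H.γmidRight (H.ιT z))) := by
  -- The counit formulas and the formula for `ρTD` match by unfolding: `unitMap` is `α`,
  -- respectively `β`, and `γL` is the rebracketed `γ`.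
  exact ⟨hH.fromCT'_injective, hH.fromT'D_injective, hH.coringC, hH.coringD, hH.ψ, hH.φ, hH.ρTC,
    hH.ρTD, hH.ιC_tmap_ιC_comulC, hH.unitMap_counitC, hH.ιD_tmap_ιD_comulD, hH.unitMap_counitD,
    hH.isRightEntwining, hH.id_tmap_ιC_ψ, hH.isLeftEntwining, hH.ιD_tmap_id_φ,
    hH.isRightEntwinedModule_T, hH.ρTC_spec, hH.isLeftEntwinedModule_T, hH.ρTD_spec,
    hH.isRightEntwining.isRightEntwinedModule, hH.isLeftEntwining.isLeftEntwinedModule,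
    ⟨hH.h₁, hH.ιC_tmap_id_h₁, hH.h₁_injective, hH.range_h₁, hH.h₁_smul, hH.h₁_op_smul⟩,
    ⟨hH.h₂, hH.id_tmap_ιD_h₂, hH.h₂_injective, hH.range_h₂, hH.h₂_smul, hH.h₂_op_smul⟩,
    ⟨H.h, BimoduleHerd.h_eq_evLeft, fun z => BimoduleHerd.evLeft_eq_evRight (H.ιT z)⟩,
    ⟨hH.coactionC, hH.coactionD, hH.isBicomodule_Tbar, hH.ιC_tmap_ιT_coactionC,
      hH.ιT_tmap_ιD_coactionD⟩⟩
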